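/- **Setting.** Let $(E_N)_{N\ge1}$ be countable sets and, for each $N$, let $R_N:E_N\times E_N\to\mathbb R$ satisfy $R_N(\eta,\xi)\ge 0$ for $\eta\ne\xi$, $R_N(\eta,\eta)\le 0$ and $\sum_{\xi}R_N(\eta,\xi)=0$. Let $\{\eta^N_t:t\ge0\}$ be the minimal right-continuous Markov process on $E_N$ with jump rates $R_N$; $\mathbf P_\eta$, $\mathbf E_\eta$ denote probability and expectation when it starts from $\eta$. Assume that it does not explode, is irreducible and positive recurrent, and that its invariant probability measure $\mu_N$ is reversible: $\mu_N(\eta)R_N(\eta,\xi)=\mu_N(\xi)R_N(\xi,\eta)$. Let $\kappa\ge2$, $S=\{1,\dots,\kappa\}$, and let $\mathscr E^x_N$, $x\in S$, be pairwise disjoint subsets of $E_N$ with points $\xi^N_x\in\mathscr E^x_N$. Put $\mathscr E_N=\bigcup_{x}\mathscr E^x_N$, $\breve{\mathscr E}^x_N=\mathscr E_N\setminus\mathscr E^x_N$, $\Delta_N=E_N\setminus\mathscr E_N$. Let $T_A=\inf\{s>0:\eta^N_s\in A\}$ be the hitting time of $A$ ($\inf\varnothing=\infty$). *Trace.* For $A\subseteq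 E_N$ let $\mathcal S^A_t=\sup\{s\ge0:\int_0^s\mathbf 1\{\eta^N_u\in A\}\,du\le t\}$. The trace of the process on $A$ is $\eta^A_t=\eta^N_{\mathcal S^A_t}$ if $\mathcal S^A_t<\infty$, and $\eta^A_t=\mathfrak d$ (an additional point) otherwise. Let $R^{\mathscr E}_N(\eta,\xi)=\lim_{t\downarrow0}\mathbf P_\eta[\eta^{\mathscr E_N}_t=\xi]/t$, for $\eta\neq\xi$ in $\mathscr E_N$, be the jump rates of the trace on $\mathscr E_N$, and for $x\ne y$ let $$r_N(\mathscr E^x,\mathscr E^y)=\frac1{\mu_N(\mathscr E^x_N)}\sum_{\eta\in\mathscr E^x_N}\mu_N(\eta)\sum_{\xi\in\mathscr E^y_N}R^{\mathscr E}_N(\eta,\xi)\in[0,\infty].$$ Let $X^N_t=x$ if $\eta^{\mathscr E_N}_t\in\mathscr E^x_N$, and $X^N_t=\mathfrak d$ if $\eta^{\mathscr E_N}_t=\mathfrak d$. *Capacities.* For $f:E_N\to\mathbb R$ let $D_N(f)=\frac12\sum_{\eta,\xi}\mu_N(\eta)R_N(\eta,\xi)\{f(\xi)-f(\eta)\}^2\in[0,\infty]$.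 For disjoint $A,B\subseteq E_N$ let $\mathrm{Cap}_N(A,B)=\inf\{D_N(f): f\in L^2(\mu_N),\ f=1\text{ on }A,\ f=0\text{ on }B\}$. Let $\mathrm{Cap}_N(\xi_x)=\inf\{\mathrm{Cap}_N(\{\eta\},\{\xi^N_x\}):\eta\in\mathscr E^x_N\setminus\{\xi^N_x\}\}$, with $\inf\varnothing=\infty$ and $a/\infty=0$. **Theorem.** Let $\theta_N>0$, $N\ge1$. Suppose that * **(H1)** for each $x\in S$, $\displaystyle\lim_{N\to\infty}\frac{\mathrm{Cap}_N(\mathscr E^x_N,\breve{\mathscr E}^x_N)}{\mathrm{Cap}_N(\xi_x)}=0$; * **(H0)** for all $x\ne y$ in $S$ the limit $r(x,y)=\lim_{N\to\infty}\theta_N\,r_N(\mathscr E^x,\mathscr E^y)\in[0,\infty)$ exists; * for each $x\in S$ that is absorbing for the rates $r$ (that is, $r(x,y)=0$ for all $y\ne x$), condition **(M3)** below holds at $x$; * **(H2)** for each $x\in S$ that is not absorbing, $\displaystyle\lim_{N\to\infty}\mu_N(\Delta_N)/\mu_N(\mathscr E^x_N)=0$. Then the processes exhibit a tunneling behaviour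 on the time-scale $(\theta_N)$, with metastates $\mathscr E^x$, metapoints $\xi_x$ and asymptotic dynamics the Markov chain on $S$ with jump rates $r(x,y)$. That is, for every $x\in S$: * **(M1)** $\displaystyle\lim_{N\to\infty}\inf_{\eta\in\mathscr E^x_N}\mathbf P_\eta\big[T_{\{\xi^N_x\}}<T_{\breve{\mathscr E}^x_N}\big]=1$; * **(M2)** for every choice of $\eta^N\in\mathscr E^x_N$, $N\ge1$, the law of $\{X^N_{t\theta_N}:t\ge0\}$ under $\mathbf P_{\eta^N}$ converges weakly, in the space $D(\mathbb R_+,S\cup\{\mathfrak d\})$ of right-continuous paths with left limits endowed with the Skorohod topology, to the law of the Markov chain on $S$ with jump rates $r$ started from $x$; * **(M3)** for every $t>0$, $\displaystyle\lim_{N\to\infty}\sup_{\eta\in\mathscr E^x_N}\mathbf E_\eta\Big[\int_0^t\mathbf 1\{\eta^N_{s\theta_N}\in\Delta_N\}\,ds\Big]=0$. -/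

import Mathlib

open Set Filter Topology MeasureTheory ProbabilityTheory
open scoped NNReal ENNReal

noncomputable section

/-! ### Continuous-time Markov chains on a countable state space -/

/-- Matrices `R : E × E → ℝ` with nonnegative off-diagonal entries, nonpositive (finite) diagonal
entries and vanishing row sums. -/
structure RateMatrix (E : Type*) where
  rate : E → E → ℝ
  rate_nonneg : ∀ η ξ, η ≠ ξ → 0 ≤ rate η ξ
  rate_diag_nonpos : ∀ η, rate η η ≤ 0
  hasSum_rate : ∀ η, HasSum (rate η) 0

namespace RateMatrix

/-- The rate matrix on a finite set with prescribed off-diagonal entries `r x y`, `x ≠ y` (the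
diagonal values of `r` are ignored). -/
def ofRates {S : Type*} [Fintype S] [DecidableEq S] (r : S → S → ℝ≥0) : RateMatrix S where
  rate x y := if x = y then -∑ z ∈ Finset.univ.erase x, (r x z : ℝ) else r x y
  rate_nonneg x y h := by simp [h]
  rate_diag_nonpos x := by
    simp only [if_true, Left.neg_nonpos_iff]
    exact Finset.sum_nonneg fun z _ => (r x z).coe_nonneg
  hasSum_rate x := by
    have h : ∑ y, (if x = y then -∑ z ∈ Finset.univ.erase x, (r x z : ℝ) else (r x y : ℝ)) = 0 := by
      rw [← Finset.add_sum_erase _ _ (Finset.mem_univ x), if_pos rfl,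
        Finset.sum_congr rfl (g := fun z => (r x z : ℝ))
          (fun z hz => if_neg (Finset.ne_of_mem_erase hz).symm)]
      simp
    exact h ▸ hasSum_fintype _

variable {E : Type*} (Q : RateMatrix E)

/-- The holding rate `λ(η) = -R(η, η)`. -/
def holdingRate (η : E) : ℝ := -Q.rate η η

open Classical in
/-- The jump probabilities: `p(η, ξ) = R(η, ξ) / λ(η)` for `ξ ≠ η`. Moreover `p(η, η) = 0`,
unless `η` is absorbing (`λ(η) = 0`), in which case `p(η, η) = 1`. -/
def jumpProb (η ξ : E) : ℝ≥0∞ :=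
  if ξ = η then (if Q.holdingRate η = 0 then 1 else 0)
  else ENNReal.ofReal (Q.rate η ξ / Q.holdingRate η)

theorem tsum_jumpProb (η : E) : ∑' ξ, Q.jumpProb η ξ = 1 := by
  classical
  have hsum : HasSum (fun ξ => if ξ = η then 0 else Q.rate η ξ) (Q.holdingRate η) := by
    have h := (Q.hasSum_rate η).update η 0
    have e : Function.update (Q.rate η) η 0 = fun ξ => if ξ = η then 0 else Q.rate η ξ := by
      funext ξ
      simp [Function.update_apply]
    rw [e] at h
    simpa [holdingRate] using h
  have hnn : ∀ ξ, 0 ≤ (if ξ = η then 0 else Q.rate η ξ) := by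
    intro ξ
    split_ifs with h
    · exact le_rfl
    · exact Q.rate_nonneg η ξ (Ne.symm h)
  by_cases h0 : Q.holdingRate η = 0
  · rw [tsum_eq_single η]
    · simp [jumpProb, h0]
    · intro ξ hξ
      simp [jumpProb, hξ, h0]
  · have hpos : 0 < Q.holdingRate η :=
      lt_of_le_of_ne (by simpa [holdingRate] using Q.rate_diag_nonpos η) (Ne.symm h0)
    have hdiv := hsum.div_const (Q.holdingRate η)
    have e : ∀ ξ, Q.jumpProb η ξ
        = ENNReal.ofReal ((if ξ = η then 0 else Q.rate η ξ) / Q.holdingRate η) := by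
      intro ξ
      by_cases h : ξ = η <;> simp [jumpProb, h, h0]
    simp_rw [e]
    rw [← ENNReal.ofReal_tsum_of_nonneg (fun ξ => div_nonneg (hnn ξ) hpos.le) hdiv.summable,
      hdiv.tsum_eq, div_self h0, ENNReal.ofReal_one]

/-- The distribution `p(η, ·)`. -/
def jumpPMF (η : E) : PMF E :=
  ⟨Q.jumpProb η, Q.tsum_jumpProb η ▸ ENNReal.summable.hasSum⟩

/-- The holding times `T_n = e_n / λ(Y_n)` (infinite at an absorbing state). -/
def holdingTime (ω : (ℕ → E) × (ℕ → ℝ)) (n : ℕ) : ℝ≥0∞ :=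
  ENNReal.ofReal (ω.2 n) / ENNReal.ofReal (Q.holdingRate (ω.1 n))

/-- The minimal right-continuous Markov process `η_t = Y_{α(t)}`, with
`α(t) = min {n : T_0 + ⋯ + T_n > t}` (after an explosion the value is irrelevant). -/
def process (ω : (ℕ → E) × (ℕ → ℝ)) (t : ℝ≥0) : E :=
  ω.1 (sInf {n : ℕ | (t : ℝ≥0∞) < ∑ i ∈ Finset.range (n + 1), Q.holdingTime ω i})

variable [Countable E] [MeasurableSpace E] [DiscreteMeasurableSpace E]

/-- The transition kernel of the jump chain. -/
def jumpKernel : Kernel E E where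
  toFun η := (Q.jumpPMF η).toMeasure
  measurable' := measurable_of_countable _

instance : IsMarkovKernel Q.jumpKernel :=
  ⟨fun η => inferInstanceAs (IsProbabilityMeasure (Q.jumpPMF η).toMeasure)⟩

/-- The transition kernel of the jump chain, as a kernel depending on the past `(Y_0, …, Y_n)`. -/
def stepKernel (n : ℕ) : Kernel (Π _ : Finset.Iic n, E) E :=
  Q.jumpKernel.comap (fun h => h ⟨n, Finset.mem_Iic.2 le_rfl⟩) (measurable_pi_apply _)

instance (n : ℕ) : IsMarkovKernel (Q.stepKernel n) :=
  inferInstanceAs (IsMarkovKernel (Q.jumpKernel.comap _ _))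

/-- The law of the jump chain `(Y_n)` started from `η`. -/
def jumpChainLaw (η : E) : Measure (ℕ → E) :=
  Kernel.trajMeasure (X := fun _ => E) (Measure.dirac η) Q.stepKernel

instance (η : E) : IsProbabilityMeasure (Q.jumpChainLaw η) :=
  inferInstanceAs (IsProbabilityMeasure (Kernel.trajMeasure (X := fun _ => E) _ _))

instance isProbabilityMeasure_expMeasure_one : IsProbabilityMeasure (expMeasure 1) :=
  isProbabilityMeasure_expMeasure one_pos

/-- The probability `P_η`, on the space of pairs `(Y, e)`: `Y` is the jump chain started from `η`
and `e` is an independent sequence of i.i.d. mean one exponential variables. -/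
def law (η : E) : Measure ((ℕ → E) × (ℕ → ℝ)) :=
  (Q.jumpChainLaw η).prod (Measure.infinitePi fun _ : ℕ => expMeasure 1)

instance (η : E) : IsProbabilityMeasure (Q.law η) :=
  inferInstanceAs (IsProbabilityMeasure (Measure.prod _ _))

/-- Absence of explosion: `∑ T_n = ∞` almost surely, for every starting point. -/
def NoExplosion : Prop :=
  ∀ η, ∀ᵐ ω ∂Q.law η, ∑' n, Q.holdingTime ω n = ∞

end RateMatrix

/-! ### Functionals of a path `e : ℝ₊ → E` -/

section Paths

variable {E : Type*}

/-- The hitting time `τ_A = inf {s > 0 : e_s ∈ A}`, with `inf ∅ = ∞`. -/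
def hitTime (A : Set E) (e : ℝ≥0 → E) : ℝ≥0∞ :=
  ⨅ (s : ℝ≥0) (_ : 0 < s ∧ e s ∈ A), (s : ℝ≥0∞)

/-- The return time `τ⁺_A = inf {t > 0 : e_t ∈ A, e_s ≠ e_0 for some 0 < s < t}`. -/
def returnTime (A : Set E) (e : ℝ≥0 → E) : ℝ≥0∞ :=
  ⨅ (t : ℝ≥0) (_ : 0 < t ∧ e t ∈ A ∧ ∃ s, 0 < s ∧ s < t ∧ e s ≠ e 0), (t : ℝ≥0∞)

/-- The time `∫_0^t 1{e_s ∈ A} ds` spent in `A` during `[0, t]`. -/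
def occupationTime (A : Set E) (e : ℝ≥0 → E) (t : ℝ≥0) : ℝ≥0∞ :=
  ∫⁻ s in Icc (0 : ℝ) t, A.indicator (fun _ => 1) (e s.toNNReal)

/-- The generalized inverse `sup {s ≥ 0 : ∫_0^s 1{e_u ∈ A} du ≤ t}` of the occupation time. -/
def inverseOccupationTime (A : Set E) (e : ℝ≥0 → E) (t : ℝ≥0) : ℝ≥0∞ :=
  ⨆ (s : ℝ≥0) (_ : occupationTime A e s ≤ t), (s : ℝ≥0∞)

open Classical in
/-- The trace of the path `e` on `A`; the artificial point `𝔡` is `none`. -/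
def tracePath (A : Set E) (e : ℝ≥0 → E) (t : ℝ≥0) : Option E :=
  if inverseOccupationTime A e t < ∞ then some (e (inverseOccupationTime A e t).toNNReal) else none

end Paths

/-! ### Recurrence, reversibility, trace rates, capacities -/

namespace RateMatrix

variable {E : Type*} (Q : RateMatrix E)

/-- Irreducibility: any two states are connected by a chain of jumps of positive rate. -/
def Irreducible : Prop :=
  ∀ η ξ, Relation.ReflTransGen (fun a b => a ≠ b ∧ 0 < Q.rate a b) η ξ

variable [MeasurableSpace E]

/-- Reversibility (detailed balance) of the measure `μ`. -/
def Reversible (μ : Measure E) : Prop :=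
  ∀ η ξ, η ≠ ξ → μ {η} * ENNReal.ofReal (Q.rate η ξ) = μ {ξ} * ENNReal.ofReal (Q.rate ξ η)

/-- The Dirichlet form `½ ∑_{η, ξ} μ(η) R(η, ξ) (f(ξ) - f(η))²`, with values in `[0, ∞]`. (The
diagonal terms vanish, since `ENNReal.ofReal` is `0` on nonpositive reals.) -/
def dirichletForm (μ : Measure E) (f : E → ℝ) : ℝ≥0∞ :=
  2⁻¹ * ∑' (η) (ξ), μ {η} * ENNReal.ofReal (Q.rate η ξ) * ENNReal.ofReal ((f ξ - f η) ^ 2)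

/-- The capacity of two sets: the infimum of the Dirichlet form over the functions in `L²(μ)` which
are equal to `1` on `A` and to `0` on `B`. -/
def capacity (μ : Measure E) (A B : Set E) : ℝ≥0∞ :=
  ⨅ (f : E → ℝ) (_ : MemLp f 2 μ ∧ (∀ η ∈ A, f η = 1) ∧ ∀ ξ ∈ B, f ξ = 0), Q.dirichletForm μ f

/-- `inf {Cap({η}, {ξ}) : η ∈ W \ {ξ}}`, with `inf ∅ = ∞`. -/
def pointCapacity (μ : Measure E) (W : Set E) (ξ : E) : ℝ≥0∞ :=
  ⨅ η ∈ W \ {ξ}, Q.capacity μ {η} {ξ}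

variable [Countable E] [DiscreteMeasurableSpace E]

/-- Positive recurrence: the mean return time to every state is finite. -/
def PositiveRecurrent : Prop :=
  ∀ η, ∫⁻ ω, returnTime {η} (Q.process ω) ∂Q.law η < ∞

/-- The transition rates `lim_{t ↓ 0} P_η[η^A_t = ξ] / t` of the trace of the process on `A`, for
`η ≠ ξ` in `A`. -/
def traceRate (A : Set E) (η ξ : E) : ℝ≥0∞ :=
  limUnder (𝓝[>] (0 : ℝ≥0)) fun t =>
    Q.law η {ω | tracePath A (Q.process ω) t = some ξ} / (t : ℝ≥0∞)

/-- The mean set rate: the average over `B`, with respect to `μ` conditioned on `B`, of the rate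
at which the trace of the process on `A` jumps to `C`; here `B` and `C` are disjoint subsets of
`A`. -/
def meanRate (μ : Measure E) (A B C : Set E) : ℝ≥0∞ :=
  (∑' η : B, (∑' ξ : C, Q.traceRate A η ξ) * μ {(η : E)}) / μ B

end RateMatrix

/-! ### Skorohod space over a discrete state space -/

/-- Right-continuity with left limits, for paths in a discrete space. -/
def IsCadlag {S : Type*} (f : ℝ≥0 → S) : Prop :=
  ∀ t, (∀ᶠ s in 𝓝[>] t, f s = f t) ∧ ∃ a, ∀ᶠ s in 𝓝[<] t, f s = a

/-- The space `D(ℝ₊, S)` for a discrete space `S`. -/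
structure SkorohodSpace (S : Type*) where
  toFun : ℝ≥0 → S
  isCadlag : IsCadlag toFun

namespace SkorohodSpace

variable {S : Type*}

/-- Basic neighbourhoods of `x`: the paths `y` which coincide on `[0, T]` with `x ∘ λ` for an
increasing bijection `λ` of `ℝ₊` such that `|λ(t) - t| < ε` on `[0, T]`. -/
def basicNhd (x : SkorohodSpace S) (T : ℝ≥0) (ε : ℝ) : Set (SkorohodSpace S) :=
  {y | ∃ l : ℝ≥0 ≃o ℝ≥0, ∀ t ≤ T, dist (l t) t < ε ∧ y.toFun t = x.toFun (l t)}

theorem basicNhd_mono (x : SkorohodSpace S) {T T' : ℝ≥0} {ε ε' : ℝ} (hT : T' ≤ T) (hε : ε ≤ ε') :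
    basicNhd x T ε ⊆ basicNhd x T' ε' := fun _ ⟨l, hl⟩ =>
  ⟨l, fun t ht => ⟨(hl t (ht.trans hT)).1.trans_le hε, (hl t (ht.trans hT)).2⟩⟩

/-- The Skorohod topology: `x_n → x` if and only if, for every `T`, there are increasing bijections
`λ_n` of `ℝ₊` with `sup_{t ≤ T} |λ_n(t) - t| → 0` and, for `n` large, `x_n = x ∘ λ_n` on `[0, T]`
(the state space being discrete). -/
instance : TopologicalSpace (SkorohodSpace S) where
  IsOpen U := ∀ x ∈ U, ∃ (T : ℝ≥0) (ε : ℝ), 0 < ε ∧ basicNhd x T ε ⊆ U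
  isOpen_univ := fun _ _ => ⟨0, 1, one_pos, subset_univ _⟩
  isOpen_inter := by
    rintro U V hU hV x ⟨hxU, hxV⟩
    obtain ⟨T, ε, hε, h⟩ := hU x hxU
    obtain ⟨T', ε', hε', h'⟩ := hV x hxV
    exact ⟨max T T', min ε ε', lt_min hε hε', subset_inter
      ((basicNhd_mono x (le_max_left _ _) (min_le_left _ _)).trans h)
      ((basicNhd_mono x (le_max_right _ _) (min_le_right _ _)).trans h')⟩
  isOpen_sUnion := by
    rintro s hs x ⟨U, hU, hx⟩
    obtain ⟨T, ε, hε, h⟩ := hs U hU x hx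
    exact ⟨T, ε, hε, h.trans (subset_sUnion_of_mem hU)⟩

instance : MeasurableSpace (SkorohodSpace S) := borel _

instance : BorelSpace (SkorohodSpace S) := ⟨rfl⟩

open Classical in
/-- A path, seen as an element of `D(ℝ₊, S)`. Paths which are not càdlàg (they form a null set for
the processes considered here) are sent to a constant path. -/
def ofPath (f : ℝ≥0 → S) : SkorohodSpace S :=
  if h : IsCadlag f then ⟨f, h⟩
  else ⟨fun _ => f 0, fun _ => ⟨Eventually.of_forall fun _ => rfl,
    f 0, Eventually.of_forall fun _ => rfl⟩⟩

end SkorohodSpace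

/-! ### Tunneling

Throughout, the sets `W x = 𝓔^x`, `x ∈ S`, are pairwise disjoint subsets of the state space. -/

section Tunneling

variable {E S : Type*}

/-- `𝓔`, the union of the sets `𝓔^x`. -/
def wells (W : S → Set E) : Set E := ⋃ x, W x

/-- The union of the sets `𝓔^y`, `y ≠ x`. -/
def otherWells (W : S → Set E) (x : S) : Set E := wells W \ W x

/-- `Δ`, the complement of `𝓔`. -/
def annulus (W : S → Set E) : Set E := (wells W)ᶜ

open Classical in
/-- The projection `Ψ : 𝓔 → S` (and `none` outside `𝓔`). -/
def wellIndex (W : S → Set E) (η : E) : Option S :=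
  if h : ∃ x, η ∈ W x then some h.choose else none

/-- The path `X_t = Ψ(η^𝓔_t)`, with values in `S ∪ {𝔡}`. -/
def projectedTrace (W : S → Set E) (e : ℝ≥0 → E) (t : ℝ≥0) : Option S :=
  (tracePath (wells W) e t).bind (wellIndex W)

end Tunneling

section TunnelingSequence

variable {S : Type*} {E : ℕ → Type*} [∀ N, Countable (E N)] [∀ N, MeasurableSpace (E N)]
  [∀ N, DiscreteMeasurableSpace (E N)]

/-- Condition (M1) at `x`: `inf_{η ∈ 𝓔^x} P_η[T_{ξ_x} < T_{∪_{y ≠ x} 𝓔^y}] → 1`. -/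
def AttractorCondition (Q : ∀ N, RateMatrix (E N)) (W : ∀ N, S → Set (E N)) (ξ : ∀ N, S → E N)
    (x : S) : Prop :=
  Tendsto (fun N => ⨅ η ∈ W N x, (Q N).law η {ω |
      hitTime {ξ N x} ((Q N).process ω) < hitTime (otherWells (W N) x) ((Q N).process ω)})
    atTop (𝓝 1)

/-- Condition (M2) at `x`: for every choice of `η^N ∈ 𝓔^x_N`, the law of `{X^N_{tθ_N} : t ≥ 0}`
under `P_{η^N}` converges weakly on `D(ℝ₊, S ∪ {𝔡})`, for the Skorohod topology, to the law of the
Markov chain on `S` with rate matrix `L` started from `x`. -/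
def ProjectionCondition [Countable S] [MeasurableSpace S] [DiscreteMeasurableSpace S]
    (Q : ∀ N, RateMatrix (E N)) (W : ∀ N, S → Set (E N)) (θ : ℕ → ℝ≥0) (L : RateMatrix S)
    (x : S) : Prop :=
  ∀ η : ∀ N, E N, (∀ N, η N ∈ W N x) →
    TendstoInDistribution
      (fun N ω => SkorohodSpace.ofPath fun t =>
        projectedTrace (W N) ((Q N).process ω) (t * θ N))
      atTop
      (fun ω => SkorohodSpace.ofPath fun t => some (L.process ω t))
      (fun N => (Q N).law (η N)) (L.law x)

/-- Condition (M3) at `x`: for every `t > 0`,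
`sup_{η ∈ 𝓔^x} E_η[∫_0^t 1{η_{sθ_N} ∈ Δ_N} ds] → 0`. -/
def NegligibleCondition (Q : ∀ N, RateMatrix (E N)) (W : ∀ N, S → Set (E N)) (θ : ℕ → ℝ≥0)
    (x : S) : Prop :=
  ∀ t : ℝ≥0, 0 < t →
    Tendsto (fun N => ⨆ η ∈ W N x,
        ∫⁻ ω, occupationTime (annulus (W N)) (fun s => (Q N).process ω (s * θ N)) t ∂(Q N).law η)
      atTop (𝓝 0)

/-- Tunneling behaviour on the time-scale `θ`, with metastates `W`, metapoints `ξ` and asymptotic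
dynamics the Markov chain on `S` with rate matrix `L`. -/
def Tunneling [Countable S] [MeasurableSpace S] [DiscreteMeasurableSpace S]
    (Q : ∀ N, RateMatrix (E N)) (W : ∀ N, S → Set (E N)) (ξ : ∀ N, S → E N) (θ : ℕ → ℝ≥0)
    (L : RateMatrix S) : Prop :=
  ∀ x, AttractorCondition Q W ξ x ∧ ProjectionCondition Q W θ L x ∧ NegligibleCondition Q W θ x

end TunnelingSequence

end

/-! The three conditions are reduced to linear equations for the jump chain, and paths are followed
only up to one change of well. Positive recurrence enters as a Liouville property
(`PositiveRecurrent.liouville`), which lets sub- and supersolutions be compared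
(`Liouville.le_of_subsolution`). Reversibility enters through minimizers of the Dirichlet form.

(M1). The potential equal to 1 on the other wells B and to 0 at a point ζ of the well A has energy
at most Cap(A, B). A cut-off argument then gives that B is reached before ζ from η with probability
at most 3 Cap(A, B) / Cap(η, ζ) (`exists_escape_potential`), which (H1) makes small when η or ζ is
the metapoint. So a [0, 1]-valued function which is harmonic, possibly with damping, off B is nearly
constant on A (`Liouville.le_add_escapeProb`).

(M2). If x_i are the successive wells and t_i the rescaled times of the changes, the path is encoded
by the numbers exp(-t_i) 1{x_i = y}, a point of a compact cube. By Stone–Weierstrass, the codes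
converge in law once the expectations of all monomials do. A monomial factorizes at the first change
of well, so its expectation is given by a function F which solves a resolvent equation on the well,
is harmonic off the wells and has on the other wells values φ of lower order. Averaging the equation
over the well, by symmetry of the trace operator (`Liouville.tsum_resolvent_eq`), and using that F
is nearly constant there, (H0) yields the limit Σ r φ / (b + Σ r)
(`MetastableSetting.uniformLimit`). The limiting chain obeys the same recursion. Since the path
depends continuously on its code for the Skorohod topology (`isContinuousCode_isStepCode`),
convergence of codes passes to paths, with no tightness argument in path space.

(M3). At a non-absorbing x, with a = 1/θ, the minimizer V of D(f) + a Σ μ (1_Δ - f)² dominates the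
discounted time spent in Δ. Both its energy and its penalty are at most a μ(Δ); hence V² is bounded
on the well by a multiple of μ(Δ)/μ(𝓔^x) + μ(Δ)/(θ Cap(ξ_x)). The total mean rate out of the well,
times μ(𝓔^x), is at most Cap(𝓔^x, B) (`tsum_escape_le_capacity`), and θ times this rate has a
positive limit. So the second term is at most a constant times the product of the ratios in (H1) and
(H2). -/

noncomputable section

/-! ### The Markov property of the jump chain -/

section ChainMeasures

variable {E : Type*} [Countable E] [MeasurableSpace E] [DiscreteMeasurableSpace E]

theorem measurableSet_prefix (n : ℕ) (a : ℕ → E) :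
    MeasurableSet {y : ℕ → E | ∀ i ≤ n, y i = a i} := by
  have : {y : ℕ → E | ∀ i ≤ n, y i = a i} = ⋂ i ∈ Iic n, (fun y : ℕ → E => y i) ⁻¹' {a i} := by
    ext y; simp
  rw [this]
  exact MeasurableSet.biInter (to_countable _) fun i _ =>
    measurable_pi_apply i (measurableSet_singleton _)

/-- Every finite set of indices lies in an initial segment, so the marginals on initial segments
determine all finite-dimensional marginals; on a countable space these are determined by points. -/
theorem measure_ext_of_prefix {μ ν : Measure (ℕ → E)} [IsFiniteMeasure μ]
    (h : ∀ (n : ℕ) (a : ℕ → E), μ {y | ∀ i ≤ n, y i = a i} = ν {y | ∀ i ≤ n, y i = a i}) :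
    μ = ν := by
  have hn : ∀ n : ℕ, μ.map (fun (y : ℕ → E) (i : Finset.Iic n) => y (i : ℕ))
      = ν.map (fun (y : ℕ → E) (i : Finset.Iic n) => y (i : ℕ)) := by
    intro n
    have hm : Measurable (fun (y : ℕ → E) (i : Finset.Iic n) => y (i : ℕ)) :=
      measurable_pi_lambda _ fun i => measurable_pi_apply _
    refine Measure.ext_of_singleton fun b => ?_
    -- The sequence `a₀` serves only to extend a finite prefix to a full sequence.
    rcases isEmpty_or_nonempty (ℕ → E) with he | ⟨⟨a₀⟩⟩
    · rw [Measure.eq_zero_of_isEmpty μ, Measure.eq_zero_of_isEmpty ν]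
    rw [Measure.map_apply hm (measurableSet_singleton _),
      Measure.map_apply hm (measurableSet_singleton _)]
    have : (fun (y : ℕ → E) (i : Finset.Iic n) => y (i : ℕ)) ⁻¹' {b}
        = {y | ∀ i ≤ n, y i = (fun k => if hk : k ≤ n then b ⟨k, Finset.mem_Iic.2 hk⟩
          else a₀ k) i} := by
      ext y
      simp only [mem_preimage, mem_singleton_iff, mem_ofPred_eq, funext_iff]
      constructor
      · intro hy i hi
        simpa [hi] using hy ⟨i, Finset.mem_Iic.2 hi⟩
      · rintro hy ⟨i, hi⟩
        have := hy i (Finset.mem_Iic.1 hi)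
        simpa [Finset.mem_Iic.1 hi] using this
    rw [this, h]
  have key : ∀ I : Finset ℕ, ν.map I.restrict = μ.map I.restrict := by
    intro I
    obtain ⟨n, hI⟩ : ∃ n, I ⊆ Finset.Iic n :=
      ⟨I.sup id, fun i hi => Finset.mem_Iic.2 (Finset.le_sup (f := id) hi)⟩
    have e : (I.restrict : (ℕ → E) → (I → E))
        = (fun (z : Finset.Iic n → E) (i : I) => z ⟨i, hI i.2⟩) ∘
          (fun (y : ℕ → E) (i : Finset.Iic n) => y (i : ℕ)) := rfl
    have m1 : Measurable (fun (z : Finset.Iic n → E) (i : I) => z ⟨i, hI i.2⟩) :=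
      measurable_pi_lambda _ fun i => measurable_pi_apply _
    have m2 : Measurable (fun (y : ℕ → E) (i : Finset.Iic n) => y (i : ℕ)) :=
      measurable_pi_lambda _ fun i => measurable_pi_apply _
    rw [e, ← Measure.map_map m1 m2, ← Measure.map_map m1 m2, hn]
  have h1 : IsProjectiveLimit μ (fun I : Finset ℕ => μ.map I.restrict) := fun I => rfl
  have h2 : IsProjectiveLimit ν (fun I : Finset ℕ => μ.map I.restrict) := key
  exact h1.unique h2

end ChainMeasures

/-- The shift of the pairs `(Y, e)`. -/
def shift {E : Type*} (ω : (ℕ → E) × (ℕ → ℝ)) : (ℕ → E) × (ℕ → ℝ) :=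
  (fun n => ω.1 (n + 1), fun n => ω.2 (n + 1))

theorem measurable_shift {E : Type*} [MeasurableSpace E] :
    Measurable (shift : (ℕ → E) × (ℕ → ℝ) → _) := by
  unfold shift; fun_prop

namespace RateMatrix

variable {E : Type*} (Q : RateMatrix E) [Countable E] [MeasurableSpace E]
  [DiscreteMeasurableSpace E]

theorem jumpChainLaw_zero (η : E) : ∀ᵐ y ∂Q.jumpChainLaw η, y 0 = η := by
  have h : (Q.jumpChainLaw η).map (fun y => y 0) = Measure.dirac η := by
    have e1 : (fun y : ℕ → E => y 0)
        = (fun z : (Finset.Iic 0 → E) => z ⟨0, Finset.mem_Iic.2 le_rfl⟩) ∘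
          (Preorder.frestrictLe (π := fun _ => E) 0) := rfl
    rw [e1, ← Measure.map_map (by fun_prop) (by fun_prop), jumpChainLaw, Kernel.trajMeasure,
      Measure.map_comp _ _ (by fun_prop), Kernel.traj_map_frestrictLe, Kernel.partialTraj_self,
      Measure.id_comp, Measure.map_map (by fun_prop) (by fun_prop)]
    exact Measure.map_id'
  have h' : ∀ᵐ x ∂(Q.jumpChainLaw η).map (fun y => y 0), x = η := by
    rw [h, ae_dirac_eq]; rfl
  exact ae_of_ae_map (measurable_pi_apply 0).aemeasurable h'

theorem jumpKernel_singleton (η ξ : E) : Q.jumpKernel η {ξ} = Q.jumpProb η ξ := by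
  change (Q.jumpPMF η).toMeasure {ξ} = _
  rw [PMF.toMeasure_apply_singleton _ _ (measurableSet_singleton _)]
  rfl

open Classical in
theorem jumpChainLaw_prefix (η : E) (n : ℕ) (a : ℕ → E) :
    Q.jumpChainLaw η {y | ∀ i ≤ n, y i = a i}
      = (if a 0 = η then 1 else 0) * ∏ i ∈ Finset.range n, Q.jumpProb (a i) (a (i + 1)) := by
  induction n with
  | zero =>
    simp only [nonpos_iff_eq_zero, forall_eq, Finset.range_zero, Finset.prod_empty, mul_one]
    split_ifs with h
    · have : {y : ℕ → E | y 0 = a 0} =ᵐ[Q.jumpChainLaw η] univ := by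
        filter_upwards [Q.jumpChainLaw_zero η] with y hy
        rw [eq_iff_iff]
        exact ⟨fun _ => trivial, fun _ => hy.trans h.symm⟩
      rw [measure_congr this, measure_univ]
    · rw [measure_eq_zero_iff_ae_notMem]
      filter_upwards [Q.jumpChainLaw_zero η] with y hy h'
      exact h (h'.symm.trans hy)
  | succ n ih =>
    have key := Kernel.map_frestrictLe_trajMeasure_compProd_eq_map_trajMeasure
      (X := fun _ => E) (μ₀ := Measure.dirac η) (κ := Q.stepKernel) (a := n)
    have hA : MeasurableSet {z : (Finset.Iic n → E) | ∀ i : Finset.Iic n, z i = a i} := by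
      have : {z : (Finset.Iic n → E) | ∀ i : Finset.Iic n, z i = a i}
        = {fun i : Finset.Iic n => a i} := by ext z; simp [funext_iff]
      rw [this]; exact measurableSet_singleton _
    have key2 := congrArg (fun ν => ν ({z : (Finset.Iic n → E) | ∀ i : Finset.Iic n, z i = a i}
      ×ˢ {a (n + 1)})) key
    rw [Measure.map_apply (by fun_prop) (hA.prod (measurableSet_singleton _)),
      Measure.compProd_apply_prod hA (measurableSet_singleton _)] at key2
    have e : (fun x : ℕ → E => (Preorder.frestrictLe (π := fun _ => E) n x, x (n + 1))) ⁻¹'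
        ({z : (Finset.Iic n → E) | ∀ i : Finset.Iic n, z i = a i} ×ˢ {a (n + 1)})
        = {y | ∀ i ≤ n + 1, y i = a i} := by
      ext y
      simp only [mem_preimage, mem_prod, mem_ofPred_eq, mem_singleton_iff, Subtype.forall,
        Finset.mem_Iic]
      constructor
      · rintro ⟨h1, h2⟩ i hi
        rcases Nat.le_succ_iff.1 hi with h | h
        · exact h1 i h
        · rw [h]; exact h2
      · exact fun h => ⟨fun i hi => h i (hi.trans n.le_succ), h _ le_rfl⟩
    rw [e] at key2
    refine key2.symm.trans ?_
    have e2 : ∀ z ∈ {z : (Finset.Iic n → E) | ∀ i : Finset.Iic n, z i = a i},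
        Q.stepKernel n z {a (n + 1)} = Q.jumpProb (a n) (a (n + 1)) := by
      intro z hz
      have hz' : z ⟨n, Finset.mem_Iic.2 le_rfl⟩ = a n := hz ⟨n, Finset.mem_Iic.2 le_rfl⟩
      change Q.jumpKernel (z ⟨n, Finset.mem_Iic.2 le_rfl⟩) {a (n + 1)} = _
      rw [hz', jumpKernel_singleton]
    rw [setLIntegral_congr_fun hA e2, setLIntegral_const, Measure.map_apply (by fun_prop) hA]
    have e3 : (Preorder.frestrictLe (π := fun _ => E) n) ⁻¹'
        {z : (Finset.Iic n → E) | ∀ i : Finset.Iic n, z i = a i} = {y | ∀ i ≤ n, y i = a i} := by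
      ext y
      simp [Preorder.frestrictLe]
    rw [e3]
    change _ * Q.jumpChainLaw η _ = _
    rw [ih, Finset.prod_range_succ]
    ring

/-- The law of the jump chain after one step. -/
theorem map_shift_jumpChainLaw (η : E) :
    (Q.jumpChainLaw η).map (fun y n => y (n + 1))
      = Measure.sum fun ξ => Q.jumpProb η ξ • Q.jumpChainLaw ξ := by
  classical
  have hm : Measurable (fun (y : ℕ → E) (n : ℕ) => y (n + 1)) := by fun_prop
  refine measure_ext_of_prefix fun n a => ?_
  rw [Measure.map_apply hm (measurableSet_prefix n a),
    Measure.sum_apply _ (measurableSet_prefix n a)]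
  have e : (fun (y : ℕ → E) (n : ℕ) => y (n + 1)) ⁻¹' {y | ∀ i ≤ n, y i = a i}
      =ᵐ[Q.jumpChainLaw η] {y | ∀ i ≤ n + 1, y i = (fun k => Nat.casesOn k η a : ℕ → E) i} := by
    filter_upwards [Q.jumpChainLaw_zero η] with y hy
    rw [eq_iff_iff]
    change (∀ i ≤ n, y (i + 1) = a i) ↔ ∀ i ≤ n + 1, y i = (fun k => Nat.casesOn k η a : ℕ → E) i
    constructor
    · rintro h (_ | i) hi
      · exact hy
      · exact h i (by omega)
    · intro h i hi
      exact h (i + 1) (by omega)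
  rw [measure_congr e, jumpChainLaw_prefix, Finset.prod_range_succ']
  simp only [Measure.smul_apply, smul_eq_mul, jumpChainLaw_prefix]
  rw [tsum_eq_single (a 0)]
  · simp; ring
  · intro ξ hξ
    simp [hξ.symm]

/-- The inverse map `c`, which prepends a number to a sequence, is the one pushed forward: its
preimages of boxes are boxes, and boxes characterize the infinite product. -/
theorem map_shift_infinitePi (ν : Measure ℝ) [IsProbabilityMeasure ν] :
    (Measure.infinitePi fun _ : ℕ => ν).map (fun e => (e 0, fun n => e (n + 1)))
      = ν.prod (Measure.infinitePi fun _ : ℕ => ν) := by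
  have hm : Measurable (fun e : ℕ → ℝ => (e 0, fun n => e (n + 1))) := by fun_prop
  let c : ℝ × (ℕ → ℝ) → (ℕ → ℝ) := fun p n => Nat.casesOn n p.1 p.2
  have hc : Measurable c := by
    refine measurable_pi_lambda _ fun n => ?_
    cases n with
    | zero => exact measurable_fst
    | succ n => exact (measurable_pi_apply n).comp measurable_snd
  have h : (ν.prod (Measure.infinitePi fun _ : ℕ => ν)).map c
      = Measure.infinitePi fun _ : ℕ => ν := by
    refine Measure.eq_infinitePi _ fun s t ht => ?_
    have hms : MeasurableSet (Set.pi (s : Set ℕ) t) :=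
      MeasurableSet.pi (to_countable _) fun i _ => ht i
    rw [Measure.map_apply hc hms]
    have e : c ⁻¹' (Set.pi (s : Set ℕ) t) = (if 0 ∈ s then t 0 else univ) ×ˢ
        (Set.pi ((s.preimage (· + 1) (add_left_injective 1).injOn : Finset ℕ) : Set ℕ)
          fun i => t (i + 1)) := by
      ext ⟨x, f⟩
      simp only [mem_preimage, Set.mem_pi, Finset.mem_coe, mem_prod, Finset.mem_preimage]
      constructor
      · intro h
        refine ⟨?_, fun i hi => h (i + 1) hi⟩
        split_ifs with h0
        · exact h 0 h0
        · trivial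
      · rintro ⟨h1, h2⟩ (_ | i) hi
        · rw [if_pos hi] at h1; exact h1
        · exact h2 i hi
    rw [e, Measure.prod_prod, Measure.infinitePi_pi _ (fun i _ => ht _)]
    have e2 : ∏ i ∈ s.preimage (· + 1) (add_left_injective 1).injOn, ν (t (i + 1))
        = ∏ i ∈ s.erase 0, ν (t i) := by
      rw [← Finset.prod_preimage (· + 1) (s.erase 0) (add_left_injective 1).injOn
        (fun i => ν (t i))]
      · refine Finset.prod_congr ?_ fun _ _ => rfl
        ext i; simp
      · intro x hx hx'
        exfalso
        apply hx'
        exact ⟨x - 1, by have := Finset.ne_of_mem_erase hx; simp only; omega⟩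
    rw [e2]
    split_ifs with h0
    · rw [Finset.mul_prod_erase s (fun i => ν (t i)) h0]
    · rw [measure_univ, one_mul, Finset.erase_eq_of_notMem h0]
  have h' := congrArg (fun ρ => ρ.map (fun e : ℕ → ℝ => (e 0, fun n => e (n + 1)))) h
  simp only at h'
  rw [Measure.map_map hm hc] at h'
  rw [← h']
  exact Measure.map_id'

theorem law_zero (η : E) : ∀ᵐ ω ∂Q.law η, ω.1 0 = η := by
  have : Measure.QuasiMeasurePreserving (Prod.fst) (Q.law η) (Q.jumpChainLaw η) :=
    Measure.quasiMeasurePreserving_fst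
  exact this.ae (Q.jumpChainLaw_zero η)

/-- The Markov property at the first jump. -/
theorem lintegral_law_shift (η : E) {F : ℝ × ((ℕ → E) × (ℕ → ℝ)) → ℝ≥0∞} (hF : Measurable F) :
    ∫⁻ ω, F (ω.2 0, shift ω) ∂Q.law η
      = ∫⁻ s, ∑' ξ, Q.jumpProb η ξ * ∫⁻ ω, F (s, ω) ∂Q.law ξ ∂expMeasure 1 := by
  set ε := Measure.infinitePi fun _ : ℕ => expMeasure 1 with hε
  have hs1 : Measurable (fun (y : ℕ → E) (n : ℕ) => y (n + 1)) := by fun_prop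
  have hs2 : Measurable (fun e : ℕ → ℝ => (e 0, fun n => e (n + 1))) := by fun_prop
  have hmF : Measurable fun z : (ℕ → E) × (ℝ × (ℕ → ℝ)) => F (z.2.1, (z.1, z.2.2)) := by fun_prop
  have h1 : ∀ y : ℕ → E, ∫⁻ e, F (e 0, (y, fun n => e (n + 1))) ∂ε
      = ∫⁻ s, ∫⁻ e, F (s, (y, e)) ∂ε ∂expMeasure 1 := by
    intro y
    have hmy : Measurable fun z : ℝ × (ℕ → ℝ) => F (z.1, (y, z.2)) := by fun_prop
    rw [← lintegral_prod _ hmy.aemeasurable, ← map_shift_infinitePi, lintegral_map hmy hs2]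
  have hmy : Measurable fun y : ℕ → E => ∫⁻ s, ∫⁻ e, F (s, (y, e)) ∂ε ∂expMeasure 1 := by
    refine Measurable.lintegral_prod_right' (f := fun z : (ℕ → E) × ℝ =>
      ∫⁻ e, F (z.2, (z.1, e)) ∂ε) ?_
    exact Measurable.lintegral_prod_right' (f := fun z : ((ℕ → E) × ℝ) × (ℕ → ℝ) =>
      F (z.1.2, (z.1.1, z.2))) (by fun_prop)
  have hma : Measurable fun ω : (ℕ → E) × (ℕ → ℝ) => F (ω.2 0, shift ω) :=
    hF.comp ((by fun_prop : Measurable fun ω : (ℕ → E) × (ℕ → ℝ) => ω.2 0).prodMk measurable_shift)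
  calc ∫⁻ ω, F (ω.2 0, shift ω) ∂Q.law η
      = ∫⁻ y, ∫⁻ e, F (e 0, ((fun n => y (n + 1)), fun n => e (n + 1))) ∂ε ∂Q.jumpChainLaw η := by
        rw [law, lintegral_prod _ hma.aemeasurable]; rfl
    _ = ∫⁻ y, (fun y => ∫⁻ s, ∫⁻ e, F (s, (y, e)) ∂ε ∂expMeasure 1) (fun n => y (n + 1))
          ∂Q.jumpChainLaw η := by
        refine lintegral_congr fun y => ?_
        rw [h1]
    _ = ∑' ξ, Q.jumpProb η ξ *
          ∫⁻ y, ∫⁻ s, ∫⁻ e, F (s, (y, e)) ∂ε ∂expMeasure 1 ∂Q.jumpChainLaw ξ := by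
        rw [← lintegral_map hmy hs1, map_shift_jumpChainLaw, lintegral_sum_measure]
        simp_rw [lintegral_smul_measure, smul_eq_mul]
    _ = ∑' ξ, ∫⁻ s, Q.jumpProb η ξ * ∫⁻ ω, F (s, ω) ∂Q.law ξ ∂expMeasure 1 := by
        refine tsum_congr fun ξ => ?_
        have hm3 : Measurable fun z : (ℕ → E) × ℝ => ∫⁻ e, F (z.2, (z.1, e)) ∂ε :=
          Measurable.lintegral_prod_right' (f := fun z : ((ℕ → E) × ℝ) × (ℕ → ℝ) =>
            F (z.1.2, (z.1.1, z.2))) (by fun_prop)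
        rw [lintegral_const_mul]
        · congr 1
          rw [lintegral_lintegral_swap hm3.aemeasurable]
          refine lintegral_congr fun s => ?_
          rw [law, lintegral_prod _ (by fun_prop)]
        · exact Measurable.lintegral_prod_right' (f := fun z : ℝ × ((ℕ → E) × (ℕ → ℝ)) => F z) hF
    _ = _ := by
        rw [lintegral_tsum]
        intro ξ
        exact ((Measurable.lintegral_prod_right'
          (f := fun z : ℝ × ((ℕ → E) × (ℕ → ℝ)) => F z) hF).const_mul _).aemeasurable

/-- The transition operator of the jump chain. -/
def jumpOp (f : E → ℝ≥0∞) (η : E) : ℝ≥0∞ := ∑' ξ, Q.jumpProb η ξ * f ξ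

/-- The first exponential variable is independent of the jump chain and of the later variables, so
the expectation factorizes. -/
theorem lintegral_law_mul_shift (η : E) {f : ℝ → ℝ≥0∞} (hf : Measurable f)
    {G : (ℕ → E) × (ℕ → ℝ) → ℝ≥0∞} (hG : Measurable G) :
    ∫⁻ ω, f (ω.2 0) * G (shift ω) ∂Q.law η
      = (∫⁻ s, f s ∂expMeasure 1) * Q.jumpOp (fun ξ => ∫⁻ ω, G ω ∂Q.law ξ) η := by
  rw [Q.lintegral_law_shift η (F := fun z => f z.1 * G z.2) (by fun_prop), jumpOp,
    ← lintegral_mul_const _ hf]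
  refine lintegral_congr fun s => ?_
  rw [← ENNReal.tsum_mul_left]
  refine tsum_congr fun ξ => ?_
  simp only
  rw [lintegral_const_mul _ hG]
  ring

theorem lintegral_law_comp_shift (η : E) {G : (ℕ → E) × (ℕ → ℝ) → ℝ≥0∞} (hG : Measurable G) :
    ∫⁻ ω, G (shift ω) ∂Q.law η = Q.jumpOp (fun ξ => ∫⁻ ω, G ω ∂Q.law ξ) η := by
  simpa using Q.lintegral_law_mul_shift η (f := fun _ => 1) measurable_const hG

/-- The shifted path has a mixture of the laws `Q.law ξ`, so an event null under all of them stays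
null after the shift. -/
theorem ae_law_shift {p : (ℕ → E) × (ℕ → ℝ) → Prop} (h : ∀ η, ∀ᵐ ω ∂Q.law η, p ω) (η : E) :
    ∀ᵐ ω ∂Q.law η, p (shift ω) := by
  have hmap : (Q.law η).map shift ≪ Measure.sum fun ξ => Q.law ξ := by
    refine Measure.AbsolutelyContinuous.mk fun s hs h0 => ?_
    rw [Measure.map_apply measurable_shift hs]
    rw [Measure.sum_apply _ hs, ENNReal.tsum_eq_zero] at h0
    have := Q.lintegral_law_comp_shift η (G := s.indicator 1) (measurable_one.indicator hs)
    simp only [lintegral_indicator_one hs, h0, jumpOp, mul_zero, tsum_zero] at this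
    have e : (fun ω => s.indicator (1 : (ℕ → E) × (ℕ → ℝ) → ℝ≥0∞) (shift ω))
        = (shift ⁻¹' s).indicator 1 := by
      ext ω; rfl
    rw [e, lintegral_indicator_one (measurable_shift hs)] at this
    exact this
  have h' : ∀ᵐ ω ∂Measure.sum fun ξ => Q.law ξ, p ω := by
    rw [Measure.ae_sum_iff]; exact h
  exact ae_of_ae_map measurable_shift.aemeasurable (hmap.ae_le h')

end RateMatrix

/-! ### The function `x ↦ e^{-x}` on `[0, ∞]` -/

/-- `e^{-x}` for `x ∈ [0, ∞]`. -/
def expNeg (x : ℝ≥0∞) : ℝ≥0∞ := if x = ∞ then 0 else ENNReal.ofReal (Real.exp (-x.toReal))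

@[simp] theorem expNeg_zero : expNeg 0 = 1 := by simp [expNeg]

@[simp] theorem expNeg_top : expNeg ∞ = 0 := by simp [expNeg]

theorem expNeg_of_ne_top {x : ℝ≥0∞} (h : x ≠ ∞) :
    expNeg x = ENNReal.ofReal (Real.exp (-x.toReal)) := by simp [expNeg, h]

theorem expNeg_eq_zero_iff {x : ℝ≥0∞} : expNeg x = 0 ↔ x = ∞ := by
  by_cases h : x = ∞
  · simp [h]
  · simp [expNeg_of_ne_top h, h, Real.exp_pos]

theorem expNeg_le_one (x : ℝ≥0∞) : expNeg x ≤ 1 := by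
  by_cases h : x = ∞
  · simp [h]
  · rw [expNeg_of_ne_top h]
    exact ENNReal.ofReal_le_one.2 (Real.exp_le_one_iff.2 (by simp))

theorem expNeg_ne_top (x : ℝ≥0∞) : expNeg x ≠ ∞ := ne_top_of_le_ne_top (by simp) (expNeg_le_one x)

theorem expNeg_add (x y : ℝ≥0∞) : expNeg (x + y) = expNeg x * expNeg y := by
  by_cases hx : x = ∞
  · simp [hx]
  by_cases hy : y = ∞
  · simp [hy]
  rw [expNeg_of_ne_top hx, expNeg_of_ne_top hy, expNeg_of_ne_top (ENNReal.add_ne_top.2 ⟨hx, hy⟩),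
    ← ENNReal.ofReal_mul (Real.exp_pos _).le, ← Real.exp_add, ENNReal.toReal_add hx hy, neg_add]

theorem expNeg_lt_expNeg {x y : ℝ≥0∞} (h : x < y) : expNeg y < expNeg x := by
  by_cases hy : y = ∞
  · rw [hy, expNeg_top, pos_iff_ne_zero]
    exact fun h' => h.ne_top (expNeg_eq_zero_iff.1 h')
  · rw [expNeg_of_ne_top hy, expNeg_of_ne_top h.ne_top, ENNReal.ofReal_lt_ofReal_iff
      (Real.exp_pos _), Real.exp_lt_exp, neg_lt_neg_iff]
    exact (ENNReal.toReal_lt_toReal h.ne_top hy).2 h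

theorem strictAnti_expNeg : StrictAnti expNeg := fun _ _ => expNeg_lt_expNeg

@[fun_prop]
theorem measurable_expNeg : Measurable expNeg := by
  unfold expNeg
  exact Measurable.ite (measurableSet_singleton _) measurable_const (by fun_prop)

theorem expNeg_coe (x : ℝ≥0) : expNeg x = ENNReal.ofReal (Real.exp (-x)) := by
  rw [expNeg_of_ne_top ENNReal.coe_ne_top]; simp

theorem ae_expMeasure_pos : ∀ᵐ s ∂expMeasure 1, 0 < s := by
  rw [ae_iff]
  have : {a : ℝ | ¬0 < a} = Iic 0 := by ext; simp
  rw [this]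
  have h := cdf_expMeasure_eq one_pos 0
  rw [cdf_eq_real] at h
  simpa [measureReal_def, ENNReal.toReal_eq_zero_iff] using h

theorem lintegral_expMeasure_exp {c : ℝ} (hc : 0 ≤ c) :
    ∫⁻ s, ENNReal.ofReal (Real.exp (-(c * s))) ∂expMeasure 1 = ENNReal.ofReal (1 + c)⁻¹ := by
  have hc1 : 0 < 1 + c := by linarith
  have e : expMeasure 1 = volume.withDensity (exponentialPDF 1) := rfl
  have hm : Measurable (exponentialPDF 1) := (measurable_exponentialPDFReal 1).ennreal_ofReal
  rw [e, lintegral_withDensity_eq_lintegral_mul _ hm (by fun_prop)]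
  have h := lintegral_exponentialPDF_eq_one hc1
  -- Tilting the density of rate 1 by exp(-c s) gives, up to the factor 1 + c, the density of rate 1
  -- + c.
  have h2 : ∀ s, exponentialPDF (1 + c) s = ENNReal.ofReal (1 + c) *
      (exponentialPDF 1 * fun s => ENNReal.ofReal (Real.exp (-(c * s)))) s := by
    intro s
    rw [Pi.mul_apply, exponentialPDF_eq, exponentialPDF_eq, ← ENNReal.ofReal_mul' (Real.exp_pos _).le,
      ← ENNReal.ofReal_mul hc1.le]
    congr 1
    split_ifs
    · rw [one_mul, one_mul, ← Real.exp_add]; congr 2; ring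
    · simp
  simp_rw [h2] at h
  rw [lintegral_const_mul _ (hm.mul (by fun_prop))] at h
  rw [ENNReal.ofReal_inv_of_pos hc1]
  exact ENNReal.eq_inv_of_mul_eq_one_left (by rw [mul_comm]; exact h)

/-- The Laplace transform at `a > 0` of an exponential variable of rate `l`. -/
theorem lintegral_expNeg_holding {a : ℝ≥0∞} (ha : a ≠ 0) (ha' : a ≠ ∞) {l : ℝ} (hl : 0 ≤ l) :
    ∫⁻ s, expNeg (a * (ENNReal.ofReal s / ENNReal.ofReal l)) ∂expMeasure 1
      = ENNReal.ofReal l / (ENNReal.ofReal l + a) := by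
  rcases hl.eq_or_lt with rfl | hl
  -- At an absorbing state the holding time is infinite, so the transform vanishes, in agreement
  -- with 0 / (0 + a).
  · rw [ENNReal.ofReal_zero, ENNReal.zero_div, lintegral_eq_zero_iff (by fun_prop)]
    filter_upwards [ae_expMeasure_pos] with s hs
    have : ENNReal.ofReal s / 0 = ∞ := ENNReal.div_zero (by simpa using hs)
    simp [this, ENNReal.mul_top ha]
  · lift a to ℝ≥0 using ha'
    have h : ∀ᵐ s ∂expMeasure 1, expNeg (a * (ENNReal.ofReal s / ENNReal.ofReal l))
        = ENNReal.ofReal (Real.exp (-((a / l) * s))) := by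
      filter_upwards [ae_expMeasure_pos] with s hs
      rw [← ENNReal.ofReal_div_of_pos hl, expNeg_of_ne_top]
      · rw [ENNReal.toReal_mul, ENNReal.toReal_ofReal (by positivity), ENNReal.coe_toReal]
        congr 3; ring
      · exact ENNReal.mul_ne_top ENNReal.coe_ne_top ENNReal.ofReal_ne_top
    rw [lintegral_congr_ae h, lintegral_expMeasure_exp (by positivity),
      ← ENNReal.ofReal_coe_nnreal, ← ENNReal.ofReal_add hl.le a.coe_nonneg,
      ← ENNReal.ofReal_div_of_pos (by positivity)]
    congr 1
    field_simp

namespace RateMatrix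

variable {E : Type*} (Q : RateMatrix E)

/-! ### Rates -/

theorem holdingRate_nonneg (η : E) : 0 ≤ Q.holdingRate η := by
  simpa [holdingRate] using Q.rate_diag_nonpos η

theorem rate_le_holdingRate {η ξ : E} (h : η ≠ ξ) : Q.rate η ξ ≤ Q.holdingRate η := by
  classical
  have hs := (Q.hasSum_rate η).update η 0
  have h2 := le_hasSum hs ξ fun ζ hζ => by
    by_cases hz : ζ = η
    · simp [hz]
    · simpa [Function.update_of_ne hz] using Q.rate_nonneg η ζ (Ne.symm hz)
  simpa [Function.update_of_ne h.symm, holdingRate] using h2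

theorem Irreducible.holdingRate_pos {Q : RateMatrix E} [Nontrivial E] (h : Q.Irreducible) (η : E) :
    0 < Q.holdingRate η := by
  obtain ⟨ξ, hξ⟩ := exists_ne η
  rcases Relation.ReflTransGen.cases_head (h η ξ) with h1 | ⟨b, ⟨h1, h2⟩, -⟩
  · exact absurd h1.symm hξ
  · exact h2.trans_le (Q.rate_le_holdingRate h1)

/-- The holding rate, as an element of `[0, ∞]`. -/
def exitRate (η : E) : ℝ≥0∞ := ENNReal.ofReal (Q.holdingRate η)

theorem exitRate_ne_top (η : E) : Q.exitRate η ≠ ∞ := ENNReal.ofReal_ne_top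

theorem exitRate_mul_jumpProb {η ξ : E} (h : η ≠ ξ) :
    Q.exitRate η * Q.jumpProb η ξ = ENNReal.ofReal (Q.rate η ξ) := by
  rw [jumpProb, if_neg h.symm, exitRate, ← ENNReal.ofReal_mul (Q.holdingRate_nonneg η)]
  rcases (Q.holdingRate_nonneg η).eq_or_lt with h0 | h0
  · have h1 := Q.rate_le_holdingRate h
    have h2 := Q.rate_nonneg η ξ h
    simp [← h0, le_antisymm (h1.trans h0.symm.le) h2]
  · rw [mul_div_cancel₀ _ h0.ne']

theorem jumpProb_self {η : E} (h : 0 < Q.holdingRate η) : Q.jumpProb η η = 0 := by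
  simp [jumpProb, h.ne']

/-! ### The transition operator -/

section Operator

variable {Q}

theorem jumpOp_const (c : ℝ≥0∞) (η : E) : Q.jumpOp (fun _ => c) η = c := by
  rw [jumpOp, ENNReal.tsum_mul_right, tsum_jumpProb, one_mul]

theorem jumpOp_mono {f g : E → ℝ≥0∞} (h : ∀ ξ, f ξ ≤ g ξ) (η : E) : Q.jumpOp f η ≤ Q.jumpOp g η :=
  ENNReal.tsum_le_tsum fun ξ => mul_le_mul_right (h ξ) _

theorem jumpOp_le_one {f : E → ℝ≥0∞} (h : ∀ ξ, f ξ ≤ 1) (η : E) : Q.jumpOp f η ≤ 1 :=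
  (jumpOp_mono h η).trans_eq (jumpOp_const 1 η)

theorem jumpOp_add (f g : E → ℝ≥0∞) (η : E) :
    Q.jumpOp (fun ξ => f ξ + g ξ) η = Q.jumpOp f η + Q.jumpOp g η := by
  simp only [jumpOp, mul_add, ENNReal.tsum_add]

end Operator

/-- Liouville property: bounded subharmonic functions of the jump chain are constant. -/
def Liouville : Prop :=
  ∀ d : E → ℝ≥0∞, (∀ η, d η ≤ 1) → (∀ η, d η ≤ Q.jumpOp d η) → ∀ η ζ, d η = d ζ

variable {Q}

/-- Comparison of sub- and supersolutions. -/
theorem Liouville.le_of_subsolution (hL : Q.Liouville) {f g b w : E → ℝ≥0∞} (A : Set E)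
    (hf1 : ∀ η, f η ≤ 1) (hw : ∀ η, w η ≤ 1) (hA : ∀ η ∈ A, f η ≤ g η)
    (hf : ∀ η ∉ A, f η ≤ w η * Q.jumpOp f η + b η)
    (hg : ∀ η ∉ A, w η * Q.jumpOp g η + b η ≤ g η)
    (hne : A.Nonempty ∨ ∃ η ∉ A, w η < 1) (η : E) : f η ≤ g η := by
  -- Truncated subtraction makes `f - g` the positive part of the difference. It is subharmonic and
  -- bounded, hence constant; the constant is 0 because it vanishes on A, or because a factor `w <
  -- 1` occurs off A.
  have key : ∀ ζ ∉ A, f ζ - g ζ ≤ w ζ * Q.jumpOp (fun ξ => f ξ - g ξ) ζ := by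
    intro ζ hζ
    rw [tsub_le_iff_left]
    calc f ζ ≤ w ζ * Q.jumpOp f ζ + b ζ := hf ζ hζ
      _ ≤ w ζ * Q.jumpOp (fun ξ => g ξ + (f ξ - g ξ)) ζ + b ζ := by
          gcongr; exact jumpOp_mono (fun ξ => le_add_tsub) ζ
      _ = (w ζ * Q.jumpOp g ζ + b ζ) + w ζ * Q.jumpOp (fun ξ => f ξ - g ξ) ζ := by
          rw [jumpOp_add]; ring
      _ ≤ _ := by gcongr; exact hg ζ hζ
  have hd1 : ∀ ζ, f ζ - g ζ ≤ 1 := fun ζ => tsub_le_self.trans (hf1 ζ)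
  have hc := hL (fun ξ => f ξ - g ξ) hd1 (fun ζ => by
    by_cases hζ : ζ ∈ A
    · simp [tsub_eq_zero_of_le (hA ζ hζ)]
    · refine (key ζ hζ).trans ?_
      exact (mul_le_mul_left (hw ζ) _).trans_eq (one_mul _))
  rw [← tsub_eq_zero_iff_le]
  rcases hne with ⟨ζ, hζ⟩ | ⟨ζ, hζ, hwζ⟩
  · rw [hc η ζ]; exact tsub_eq_zero_of_le (hA ζ hζ)
  · rw [hc η ζ]
    have h1 := key ζ hζ
    have h2 : Q.jumpOp (fun ξ => f ξ - g ξ) ζ = f ζ - g ζ := by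
      have : (fun ξ => f ξ - g ξ) = fun _ => f ζ - g ζ := funext fun ξ => hc ξ ζ
      rw [this, jumpOp_const]
    rw [h2] at h1
    by_contra h0
    refine absurd h1 (not_le.2 ?_)
    calc w ζ * (f ζ - g ζ) < 1 * (f ζ - g ζ) :=
          ENNReal.mul_lt_mul_left h0 (ne_top_of_le_ne_top (by simp) (hd1 ζ)) hwζ
      _ = _ := one_mul _

variable (Q)

/-! ### Jump times -/

/-- The time `T_0 + ⋯ + T_{n-1}` of the `n`-th jump. -/
def jumpTime (ω : (ℕ → E) × (ℕ → ℝ)) (n : ℕ) : ℝ≥0∞ := ∑ i ∈ Finset.range n, Q.holdingTime ω i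

theorem jumpTime_succ (ω : (ℕ → E) × (ℕ → ℝ)) (n : ℕ) :
    Q.jumpTime ω (n + 1) = Q.jumpTime ω n + Q.holdingTime ω n := Finset.sum_range_succ _ _

theorem jumpTime_zero (ω : (ℕ → E) × (ℕ → ℝ)) : Q.jumpTime ω 0 = 0 := rfl

theorem monotone_jumpTime (ω : (ℕ → E) × (ℕ → ℝ)) : Monotone (Q.jumpTime ω) :=
  monotone_nat_of_le_succ fun n => by rw [jumpTime_succ]; exact le_self_add

theorem process_eq {ω : (ℕ → E) × (ℕ → ℝ)} {t : ℝ≥0} {n : ℕ} (h1 : Q.jumpTime ω n ≤ t)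
    (h2 : t < Q.jumpTime ω (n + 1)) : Q.process ω t = ω.1 n := by
  have : sInf {n : ℕ | (t : ℝ≥0∞) < ∑ i ∈ Finset.range (n + 1), Q.holdingTime ω i} = n := by
    refine IsLeast.csInf_eq ⟨h2, fun k hk => ?_⟩
    by_contra hlt
    have h3 : Q.jumpTime ω (k + 1) ≤ Q.jumpTime ω n := Q.monotone_jumpTime ω (by omega)
    exact absurd (lt_of_lt_of_le hk (h3.trans h1)) (lt_irrefl _)
  rw [process, this]

theorem exists_jumpTime_le {ω : (ℕ → E) × (ℕ → ℝ)} (h : ∑' n, Q.holdingTime ω n = ∞) (t : ℝ≥0) :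
    ∃ n, Q.jumpTime ω n ≤ t ∧ t < Q.jumpTime ω (n + 1) := by
  have hex : ∃ n, (t : ℝ≥0∞) < Q.jumpTime ω n := by
    have h1 : Tendsto (Q.jumpTime ω) atTop (𝓝 ∞) := h ▸ ENNReal.tendsto_nat_tsum _
    exact (h1.eventually (lt_mem_nhds ENNReal.coe_lt_top)).exists
  classical
  obtain ⟨n, hn⟩ : ∃ n, Nat.find hex = n + 1 := by
    refine Nat.exists_eq_succ_of_ne_zero fun h0 => ?_
    have := Nat.find_spec hex
    rw [h0, jumpTime_zero] at this
    exact not_lt_bot this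
  exact ⟨n, not_lt.1 (Nat.find_min hex (by omega)), hn ▸ Nat.find_spec hex⟩

theorem holdingTime_shift (ω : (ℕ → E) × (ℕ → ℝ)) (n : ℕ) :
    Q.holdingTime (shift ω) n = Q.holdingTime ω (n + 1) := rfl

theorem holdingTime_pos {ω : (ℕ → E) × (ℕ → ℝ)} {n : ℕ} (h : 0 < ω.2 n) :
    0 < Q.holdingTime ω n :=
  ENNReal.div_pos (by simpa using h) ENNReal.ofReal_ne_top

theorem holdingTime_ne_top {ω : (ℕ → E) × (ℕ → ℝ)} {n : ℕ} (h : 0 < Q.holdingRate (ω.1 n)) :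
    Q.holdingTime ω n ≠ ∞ :=
  ENNReal.div_ne_top ENNReal.ofReal_ne_top (by simpa using h)

theorem measurable_holdingTime [MeasurableSpace E] [DiscreteMeasurableSpace E] (n : ℕ) : Measurable fun ω => Q.holdingTime ω n := by
  unfold holdingTime
  have h1 : Measurable fun ω : (ℕ → E) × (ℕ → ℝ) => ω.1 n := by fun_prop
  have h2 : Measurable fun η : E => ENNReal.ofReal (Q.holdingRate η) := .of_discrete
  exact Measurable.div (by fun_prop) (h2.comp h1)

section LawLemmas

variable [Countable E] [MeasurableSpace E] [DiscreteMeasurableSpace E]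

theorem ae_law_snd_pos (η : E) : ∀ᵐ ω ∂Q.law η, ∀ n, 0 < ω.2 n := by
  rw [ae_all_iff]
  intro n
  have h1 : Measure.QuasiMeasurePreserving (Prod.snd) (Q.law η)
    (Measure.infinitePi fun _ : ℕ => expMeasure 1) := Measure.quasiMeasurePreserving_snd
  have h2 := (measurePreserving_eval_infinitePi (fun _ : ℕ => expMeasure 1) n).quasiMeasurePreserving
  exact (h2.comp h1).ae ae_expMeasure_pos

/-- Laplace transform of the first holding time, combined with the Markov property. -/
theorem lintegral_expNeg_mul_shift (η : E) {a : ℝ≥0∞} (ha : a ≠ 0) (ha' : a ≠ ∞)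
    {G : (ℕ → E) × (ℕ → ℝ) → ℝ≥0∞} (hG : Measurable G) :
    ∫⁻ ω, expNeg (a * Q.holdingTime ω 0) * G (shift ω) ∂Q.law η
      = Q.exitRate η / (Q.exitRate η + a) * Q.jumpOp (fun ξ => ∫⁻ ω, G ω ∂Q.law ξ) η := by
  rw [exitRate, ← lintegral_expNeg_holding ha ha' (Q.holdingRate_nonneg η),
    ← Q.lintegral_law_mul_shift η (by fun_prop) hG]
  refine lintegral_congr_ae ?_
  filter_upwards [Q.law_zero η] with ω h0
  rw [holdingTime, h0]

end LawLemmas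

/-! ### Recurrence -/

/-- Positive recurrence concerns the return time of the process. This transfers it to the jump
chain: a chain which does not return with positive probability would have an infinite mean return
time. -/
theorem returnTime_eq_top {ω : (ℕ → E) × (ℕ → ℝ)} (hex : ∑' n, Q.holdingTime ω n = ∞)
    (hpos : 0 < ω.2 0) (hret : ∀ n, ω.1 (n + 1) ≠ ω.1 0) :
    returnTime {ω.1 0} (Q.process ω) = ∞ := by
  simp only [returnTime, iInf_eq_top]
  rintro t ⟨-, ht, s, -, hst, hs⟩
  exfalso
  have hp0 : Q.process ω 0 = ω.1 0 := by
    refine Q.process_eq ?_ ?_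
    · simp [jumpTime]
    · simpa [jumpTime] using Q.holdingTime_pos hpos
  obtain ⟨n, hn1, hn2⟩ := Q.exists_jumpTime_le hex t
  obtain ⟨k, hk1, hk2⟩ := Q.exists_jumpTime_le hex s
  rw [Q.process_eq hn1 hn2, mem_singleton_iff] at ht
  rw [Q.process_eq hk1 hk2, hp0] at hs
  have hkn : k < n + 1 := by
    by_contra hlt
    have := Q.monotone_jumpTime ω (not_lt.1 hlt)
    have h5 : (t : ℝ≥0∞) < s := hn2.trans_le (this.trans hk1)
    exact absurd (ENNReal.coe_lt_coe.1 h5) (not_lt.2 hst.le)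
  -- Having left its starting point before time t, the path is at time t past its first jump, so the
  -- index n is at least 1.
  have hk0 : k ≠ 0 := fun h => hs (by rw [h])
  exact hret (n - 1) (by rw [Nat.sub_add_cancel (by omega)]; exact ht)

theorem measurableSet_avoid [MeasurableSpace E] [DiscreteMeasurableSpace E] (A : Set E) :
    MeasurableSet {ω : (ℕ → E) × (ℕ → ℝ) | ∀ n, ω.1 n ∉ A} := by
  rw [ofPred_forall]
  refine MeasurableSet.iInter fun n => ?_
  exact (by fun_prop : Measurable fun ω : (ℕ → E) × (ℕ → ℝ) => ω.1 n)
    (MeasurableSet.of_discrete (s := Aᶜ))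

variable [Countable E] [MeasurableSpace E] [DiscreteMeasurableSpace E]

theorem PositiveRecurrent.ae_return {Q : RateMatrix E} (hrec : Q.PositiveRecurrent)
    (hexp : Q.NoExplosion) (η : E) : ∀ᵐ ω ∂Q.law η, ∃ n, ω.1 (n + 1) = η := by
  have hm : MeasurableSet {ω : (ℕ → E) × (ℕ → ℝ) | ∀ n, ω.1 (n + 1) ≠ η} := by
    rw [ofPred_forall]
    refine MeasurableSet.iInter fun n => ?_
    exact (by fun_prop : Measurable fun ω : (ℕ → E) × (ℕ → ℝ) => ω.1 (n + 1))
      (MeasurableSet.of_discrete (s := {η}ᶜ))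
  have h1 : ∫⁻ ω, {ω : (ℕ → E) × (ℕ → ℝ) | ∀ n, ω.1 (n + 1) ≠ η}.indicator (fun _ => ∞) ω ∂Q.law η
      ≤ ∫⁻ ω, returnTime {η} (Q.process ω) ∂Q.law η := by
    refine lintegral_mono_ae ?_
    filter_upwards [hexp η, Q.law_zero η, Q.ae_law_snd_pos η] with ω hex h0 hpos
    by_cases h : ω ∈ {ω : (ℕ → E) × (ℕ → ℝ) | ∀ n, ω.1 (n + 1) ≠ η}
    · have := Q.returnTime_eq_top hex (hpos 0) (by rw [h0]; exact h)
      rw [h0] at this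
      rw [this]; exact le_top
    · rw [indicator_of_notMem h]; exact zero_le
  rw [lintegral_indicator_const hm] at h1
  have h2 : Q.law η {ω : (ℕ → E) × (ℕ → ℝ) | ∀ n, ω.1 (n + 1) ≠ η} = 0 := by
    by_contra h
    rw [ENNReal.top_mul h] at h1
    exact absurd (h1.trans_lt (hrec η)) (lt_irrefl _)
  rw [ae_iff]
  simpa using h2

theorem law_comp_shift (η : E) {s : Set ((ℕ → E) × (ℕ → ℝ))} (hs : MeasurableSet s) :
    Q.law η (shift ⁻¹' s) = Q.jumpOp (fun ξ => Q.law ξ s) η := by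
  have h := Q.lintegral_law_comp_shift η (G := s.indicator 1) (measurable_one.indicator hs)
  have e : (fun ω => s.indicator (1 : (ℕ → E) × (ℕ → ℝ) → ℝ≥0∞) (shift ω))
      = (shift ⁻¹' s).indicator 1 := by
    ext ω; rfl
  simpa only [e, lintegral_indicator_one hs, lintegral_indicator_one (measurable_shift hs)] using h

/-- Every state is visited almost surely. -/
theorem PositiveRecurrent.ae_hit {Q : RateMatrix E} (hrec : Q.PositiveRecurrent)
    (hexp : Q.NoExplosion) (hirr : Q.Irreducible) (ζ η : E) :
    ∀ᵐ ω ∂Q.law ζ, ∃ n, ω.1 n = η := by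
  set s : Set ((ℕ → E) × (ℕ → ℝ)) := {ω | ∀ n, ω.1 n ∉ ({η} : Set E)} with hs
  have hms : MeasurableSet s := measurableSet_avoid {η}
  have hη : Q.law η s = 0 := by
    rw [measure_eq_zero_iff_ae_notMem]
    filter_upwards [Q.law_zero η] with ω h0 h
    exact h 0 h0
  -- The probability of never visiting η is harmonic even at η itself: both sides vanish there,
  -- because the chain returns almost surely.
  have hharm : ∀ ζ, Q.jumpOp (fun ξ => Q.law ξ s) ζ = Q.law ζ s := by
    intro ζ
    rw [← Q.law_comp_shift ζ hms]
    by_cases hζ : ζ = η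
    · rw [hζ, hη, measure_eq_zero_iff_ae_notMem]
      filter_upwards [hrec.ae_return hexp η] with ω ⟨n, hn⟩ h
      exact h n hn
    · refine measure_congr ?_
      filter_upwards [Q.law_zero ζ] with ω h0
      rw [eq_iff_iff]
      change (∀ n, ω.1 (n + 1) ∉ ({η} : Set E)) ↔ ∀ n, ω.1 n ∉ ({η} : Set E)
      constructor
      · rintro h (_ | n)
        · rw [h0]; exact hζ
        · exact h n
      · exact fun h n => h (n + 1)
  -- By harmonicity and nonnegativity, the zero at η propagates along jumps of positive rate.
  have hzero : ∀ ζ, Q.law ζ s = 0 := by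
    intro ζ
    induction hirr η ζ with
    | refl => exact hη
    | @tail b c _ hbc ih =>
      have h1 := hharm b
      rw [ih, jumpOp, ENNReal.tsum_eq_zero] at h1
      rcases mul_eq_zero.1 (h1 c) with h2 | h2
      · exfalso
        have h3 := Q.exitRate_mul_jumpProb hbc.1
        rw [h2, mul_zero] at h3
        exact absurd h3.symm (by simpa using hbc.2)
      · exact h2
  rw [ae_iff]
  have := hzero ζ
  simpa [hs] using this

/-- Subharmonicity is iterated up to the visit of η: d ζ is at most d η plus the probability that η
is not visited during the first n steps, which tends to 0 by recurrence. Exchanging the two points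
gives equality. -/
theorem PositiveRecurrent.liouville {Q : RateMatrix E} (hrec : Q.PositiveRecurrent)
    (hexp : Q.NoExplosion) (hirr : Q.Irreducible) : Q.Liouville := by
  intro d hd1 hd
  suffices h : ∀ η ζ, d ζ ≤ d η from fun η ζ => le_antisymm (h ζ η) (h η ζ)
  intro η ζ
  set s : ℕ → Set ((ℕ → E) × (ℕ → ℝ)) := fun n => {ω | ∀ i < n, ω.1 i ≠ η} with hs
  have hms : ∀ n, MeasurableSet (s n) := by
    intro n
    have : s n = ⋂ i ∈ Iio n, (fun ω : (ℕ → E) × (ℕ → ℝ) => ω.1 i) ⁻¹' {η}ᶜ := by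
      ext ω; simp [hs]
    rw [this]
    refine MeasurableSet.biInter (to_countable _) fun i _ => ?_
    exact (by fun_prop : Measurable fun ω : (ℕ → E) × (ℕ → ℝ) => ω.1 i) MeasurableSet.of_discrete
  have hbound : ∀ n ζ, d ζ ≤ d η + Q.law ζ (s n) := by
    intro n
    induction n with
    | zero =>
      intro ζ
      have : s 0 = univ := by ext; simp [hs]
      rw [this, measure_univ]
      exact (hd1 ζ).trans le_add_self
    | succ n ih =>
      intro ζ
      by_cases hζ : ζ = η
      · rw [hζ]; exact le_self_add
      · calc d ζ ≤ Q.jumpOp d ζ := hd ζ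
          _ ≤ Q.jumpOp (fun ξ => d η + Q.law ξ (s n)) ζ := jumpOp_mono ih ζ
          _ = d η + Q.law ζ (shift ⁻¹' s n) := by
              rw [jumpOp_add, jumpOp_const, Q.law_comp_shift ζ (hms n)]
          _ = d η + Q.law ζ (s (n + 1)) := by
              congr 1
              refine measure_congr ?_
              filter_upwards [Q.law_zero ζ] with ω h0
              rw [eq_iff_iff]
              change (∀ i < n, ω.1 (i + 1) ≠ η) ↔ ∀ i < n + 1, ω.1 i ≠ η
              constructor
              · rintro h (_ | i) hi
                · rw [h0]; exact hζ
                · exact h i (by omega)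
              · exact fun h i hi => h (i + 1) (by omega)
  have hlim : Tendsto (fun n => Q.law ζ (s n)) atTop (𝓝 0) := by
    have h1 : Antitone s := fun m n hmn ω hω i hi => hω i (hi.trans_le hmn)
    have h2 := tendsto_measure_iInter_atTop (μ := Q.law ζ)
      (fun n => (hms n).nullMeasurableSet) h1 ⟨0, measure_ne_top _ _⟩
    have h3 : Q.law ζ (⋂ n, s n) = 0 := by
      rw [measure_eq_zero_iff_ae_notMem]
      filter_upwards [hrec.ae_hit hexp hirr ζ η] with ω ⟨n, hn⟩ h
      exact mem_iInter.1 h (n + 1) n n.lt_succ_self hn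
    rwa [h3] at h2
  have := (tendsto_const_nhds (x := d η)).add hlim
  rw [add_zero] at this
  exact ge_of_tendsto' this fun n => hbound n ζ

end RateMatrix

/-! ### Variational problems for the Dirichlet form -/

/-- A quadratic Σ c (f - t)² + q (g - t)² is minimal only at the weighted mean, which belongs to [0,
1] and is thus an allowed competitor. The conclusion is multiplied by the total weight so that it
also covers weight zero. -/
theorem eq_weighted_mean_of_forall_le {ι : Type*} {c : ι → ℝ≥0∞} (hc : ∑' i, c i ≠ ∞) {q : ℝ≥0∞}
    (hq : q ≠ ∞) {f : ι → ℝ} (hf : ∀ i, f i ∈ Icc (0 : ℝ) 1) {g t₀ : ℝ} (hg : g ∈ Icc (0 : ℝ) 1)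
    (ht₀ : t₀ ∈ Icc (0 : ℝ) 1)
    (hmin : ∀ t ∈ Icc (0 : ℝ) 1,
      ∑' i, c i * ENNReal.ofReal ((f i - t₀) ^ 2) + q * ENNReal.ofReal ((g - t₀) ^ 2)
        ≤ ∑' i, c i * ENNReal.ofReal ((f i - t) ^ 2) + q * ENNReal.ofReal ((g - t) ^ 2)) :
    (∑' i, c i + q) * ENNReal.ofReal t₀
      = ∑' i, c i * ENNReal.ofReal (f i) + q * ENNReal.ofReal g := by
  have hci : ∀ i, c i ≠ ∞ := ENNReal.ne_top_of_tsum_ne_top hc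
  lift q to ℝ≥0 using hq
  lift c to ι → ℝ≥0 using hci
  have hs : Summable fun i => (c i : ℝ) := by
    have := ENNReal.tsum_coe_ne_top_iff_summable.1 hc
    exact_mod_cast this
  have hsum : ∀ h : ι → ℝ, (∀ i, h i ∈ Icc (0 : ℝ) 1) →
      Summable (fun i => (c i : ℝ) * h i) ∧
      ∑' i, (c i : ℝ≥0∞) * ENNReal.ofReal (h i) = ENNReal.ofReal (∑' i, (c i : ℝ) * h i) := by
    intro h hh
    have h1 : Summable (fun i => (c i : ℝ) * h i) :=
      Summable.of_nonneg_of_le (fun i => mul_nonneg (c i).coe_nonneg (hh i).1)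
        (fun i => mul_le_of_le_one_right (c i).coe_nonneg (hh i).2) hs
    refine ⟨h1, ?_⟩
    rw [ENNReal.ofReal_tsum_of_nonneg (fun i => mul_nonneg (c i).coe_nonneg (hh i).1) h1]
    refine tsum_congr fun i => ?_
    rw [ENNReal.ofReal_mul (c i).coe_nonneg, ENNReal.ofReal_coe_nnreal]
  set M : ℝ := ∑' i, (c i : ℝ) with hM
  set A : ℝ := ∑' i, (c i : ℝ) * f i with hA
  have hM0 : 0 ≤ M := tsum_nonneg fun i => (c i).coe_nonneg
  have hA0 : 0 ≤ A := tsum_nonneg fun i => mul_nonneg (c i).coe_nonneg (hf i).1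
  have hAM : A ≤ M := (hsum f hf).1.tsum_le_tsum
    (fun i => mul_le_of_le_one_right (c i).coe_nonneg (hf i).2) hs
  have hsq : ∀ t ∈ Icc (0 : ℝ) 1, ∀ i, (f i - t) ^ 2 ∈ Icc (0 : ℝ) 1 := by
    intro t ht i
    refine ⟨sq_nonneg _, ?_⟩
    rw [sq_le_one_iff_abs_le_one, abs_le]
    constructor <;> linarith [(hf i).1, (hf i).2, ht.1, ht.2]
  have hexp : ∀ t ∈ Icc (0 : ℝ) 1, ∑' i, (c i : ℝ) * (f i - t) ^ 2
      = ∑' i, (c i : ℝ) * f i ^ 2 - 2 * t * A + t ^ 2 * M := by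
    intro t ht
    have h2 : Summable (fun i => (c i : ℝ) * f i ^ 2) :=
      (hsum (fun i => f i ^ 2) (fun i => by simpa using hsq 0 (by simp) i)).1
    have h3 := ((h2.sub ((hsum f hf).1.mul_left (2 * t))).add (hs.mul_left (t ^ 2)))
    rw [hA, hM, ← tsum_mul_left, ← tsum_mul_left,
      ← h2.tsum_sub ((hsum f hf).1.mul_left (2 * t)),
      ← (h2.sub ((hsum f hf).1.mul_left (2 * t))).tsum_add (hs.mul_left (t ^ 2))]
    exact tsum_congr fun i => by ring
  have hreal : ∀ t ∈ Icc (0 : ℝ) 1,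
      - 2 * t₀ * A + t₀ ^ 2 * M + q * (g - t₀) ^ 2 ≤ - 2 * t * A + t ^ 2 * M + q * (g - t) ^ 2 := by
    intro t ht
    have h := hmin t ht
    rw [(hsum _ (hsq t₀ ht₀)).2, (hsum _ (hsq t ht)).2, hexp t₀ ht₀, hexp t ht,
      ← ENNReal.ofReal_coe_nnreal, ← ENNReal.ofReal_mul q.coe_nonneg,
      ← ENNReal.ofReal_mul q.coe_nonneg, ← ENNReal.ofReal_add, ← ENNReal.ofReal_add,
      ENNReal.ofReal_le_ofReal_iff] at h
    · linarith
    · rw [← hexp t ht]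
      exact add_nonneg (tsum_nonneg fun i => mul_nonneg (c i).coe_nonneg (sq_nonneg _))
        (by positivity)
    · rw [← hexp t ht]
      exact tsum_nonneg fun i => mul_nonneg (c i).coe_nonneg (sq_nonneg _)
    · positivity
    · rw [← hexp t₀ ht₀]
      exact tsum_nonneg fun i => mul_nonneg (c i).coe_nonneg (sq_nonneg _)
    · positivity
  have hMt : ∑' i, (c i : ℝ≥0∞) = ENNReal.ofReal M := by
    have := (hsum (fun _ => 1) (fun _ => by simp)).2
    simpa using this
  rw [hMt, (hsum f hf).2, ← ENNReal.ofReal_coe_nnreal, ← ENNReal.ofReal_mul q.coe_nonneg,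
    ← ENNReal.ofReal_add hM0 q.coe_nonneg, ← ENNReal.ofReal_add hA0 (by positivity [hg.1]),
    ← ENNReal.ofReal_mul (by positivity)]
  congr 1
  rcases (add_nonneg hM0 q.coe_nonneg).eq_or_lt with h0 | h0
  · have hM' : M = 0 := by linarith [q.coe_nonneg]
    have hq' : (q : ℝ) = 0 := by linarith
    have : A = 0 := le_antisymm (hM' ▸ hAM) hA0
    simp [hM', hq', this]
  -- Comparison of `t₀` with the weighted mean t leaves (M + q)(t₀ - t)² ≤ 0.
  · have hts : (A + q * g) / (M + q) ∈ Icc (0 : ℝ) 1 := by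
      refine ⟨div_nonneg (add_nonneg hA0 (mul_nonneg q.coe_nonneg hg.1)) h0.le, ?_⟩
      rw [div_le_one h0]
      linarith [mul_le_of_le_one_right q.coe_nonneg hg.2]
    have h := hreal _ hts
    set t := (A + q * g) / (M + q) with ht
    have hAt : A + q * g = t * (M + q) := by rw [ht]; field_simp
    have : (M + q) * (t₀ - t) ^ 2 ≤ 0 := by
      have e : A = t * (M + q) - q * g := by linarith
      rw [e] at h
      nlinarith
    have h4 : (t₀ - t) ^ 2 = 0 := by
      refine le_antisymm ?_ (sq_nonneg _)
      by_contra hcon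
      exact absurd this (not_le.2 (mul_pos h0 (not_le.1 hcon)))
    have h5 : t₀ = t := by
      have := pow_eq_zero_iff (two_ne_zero) |>.1 h4
      linarith
    rw [hAt, h5]; ring

/-- The functions with values in `[0, 1]` and prescribed values on `A`. -/
def admissible {E : Type*} (A : Set E) (b : E → ℝ) : Set (E → ℝ) :=
  {f | (∀ η, f η ∈ Icc (0 : ℝ) 1) ∧ ∀ η ∈ A, f η = b η}

theorem isCompact_admissible {E : Type*} (A : Set E) (b : E → ℝ) : IsCompact (admissible A b) := by
  have h1 : IsCompact (Set.pi univ fun _ : E => Icc (0 : ℝ) 1) :=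
    isCompact_univ_pi fun _ => isCompact_Icc
  have h2 : IsClosed {f : E → ℝ | ∀ η ∈ A, f η = b η} := by
    have : {f : E → ℝ | ∀ η ∈ A, f η = b η} = ⋂ η ∈ A, {f | f η = b η} := by ext; simp
    rw [this]
    exact isClosed_biInter fun η _ => isClosed_eq (continuous_apply η) continuous_const
  have : admissible A b = (Set.pi univ fun _ : E => Icc (0 : ℝ) 1) ∩
      {f : E → ℝ | ∀ η ∈ A, f η = b η} := by
    ext f; simp only [admissible, mem_inter_iff, mem_univ_pi, mem_ofPred_eq]
  rw [this]
  exact h1.inter_right h2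

namespace RateMatrix

variable {E : Type*} (Q : RateMatrix E) [MeasurableSpace E] (μ : Measure E)

/-- The conductance `μ(η) R(η, ξ)` of a pair. -/
def conductance (η ξ : E) : ℝ≥0∞ := μ {η} * ENNReal.ofReal (Q.rate η ξ)

theorem dirichletForm_eq (f : E → ℝ) : Q.dirichletForm μ f
    = 2⁻¹ * ∑' (η) (ξ), Q.conductance μ η ξ * ENNReal.ofReal ((f ξ - f η) ^ 2) := rfl

theorem conductance_self (η : E) : Q.conductance μ η η = 0 := by
  rw [conductance, ENNReal.ofReal_of_nonpos (Q.rate_diag_nonpos η), mul_zero]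

variable {Q μ}

theorem Reversible.conductance_comm (h : Q.Reversible μ) (η ξ : E) :
    Q.conductance μ η ξ = Q.conductance μ ξ η := by
  by_cases hηξ : η = ξ
  · rw [hηξ]
  · exact h η ξ hηξ

theorem conductance_eq (hpos : ∀ η, 0 < Q.holdingRate η) (η ξ : E) :
    Q.conductance μ η ξ = μ {η} * Q.exitRate η * Q.jumpProb η ξ := by
  by_cases hηξ : η = ξ
  · rw [← hηξ, conductance_self, jumpProb_self _ (hpos η), mul_zero]
  · rw [mul_assoc, Q.exitRate_mul_jumpProb hηξ, conductance]

theorem tsum_conductance_mul (hpos : ∀ η, 0 < Q.holdingRate η) (f : E → ℝ≥0∞) (η : E) :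
    ∑' ξ, Q.conductance μ η ξ * f ξ = μ {η} * Q.exitRate η * Q.jumpOp f η := by
  simp only [conductance_eq hpos, jumpOp, ← ENNReal.tsum_mul_left, mul_assoc]

theorem tsum_conductance (hpos : ∀ η, 0 < Q.holdingRate η) (η : E) :
    ∑' ξ, Q.conductance μ η ξ = μ {η} * Q.exitRate η := by
  have := tsum_conductance_mul (μ := μ) hpos (fun _ => 1) η
  simpa [jumpOp_const] using this

/-- Pointwise quadratic inequalities integrate. -/
theorem dirichletForm_add_le {f g h : E → ℝ} {k l : ℝ} (hk : 0 ≤ k) (hl : 0 ≤ l)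
    (H : ∀ η ξ, (f ξ - f η) ^ 2 + k * (g ξ - g η) ^ 2 ≤ l * (h ξ - h η) ^ 2) :
    Q.dirichletForm μ f + ENNReal.ofReal k * Q.dirichletForm μ g
      ≤ ENNReal.ofReal l * Q.dirichletForm μ h := by
  simp only [dirichletForm_eq]
  rw [mul_left_comm (ENNReal.ofReal k), mul_left_comm (ENNReal.ofReal l), ← mul_add]
  gcongr
  simp only [← ENNReal.tsum_mul_left, ← ENNReal.tsum_add]
  refine ENNReal.tsum_le_tsum fun η => ENNReal.tsum_le_tsum fun ξ => ?_
  rw [mul_left_comm (ENNReal.ofReal k), mul_left_comm (ENNReal.ofReal l), ← mul_add,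
    ← ENNReal.ofReal_mul hk, ← ENNReal.ofReal_mul hl, ← ENNReal.ofReal_add (by positivity)
    (by positivity)]
  gcongr
  exact H η ξ

theorem dirichletForm_mono {f g : E → ℝ} (H : ∀ η ξ, (f ξ - f η) ^ 2 ≤ (g ξ - g η) ^ 2) :
    Q.dirichletForm μ f ≤ Q.dirichletForm μ g := by
  have := dirichletForm_add_le (Q := Q) (μ := μ) (f := f) (g := f) (h := g) (k := 0) (l := 1)
    le_rfl zero_le_one (by simpa using H)
  simpa using this

theorem dirichletForm_clamp (f : E → ℝ) :
    Q.dirichletForm μ (fun η => max 0 (min 1 (f η))) ≤ Q.dirichletForm μ f := by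
  refine dirichletForm_mono fun η ξ => ?_
  rw [sq_le_sq]
  have h1 := abs_max_sub_max_le_abs (min 1 (f ξ)) (min 1 (f η)) 0
  have h2 := abs_min_sub_min_le_max 1 (f ξ) 1 (f η)
  rw [max_comm 0, max_comm 0]
  refine h1.trans (h2.trans ?_)
  simp

variable (Q μ)

/-- The penalized Dirichlet form. -/
def penalizedForm (q : E → ℝ≥0∞) (g f : E → ℝ) : ℝ≥0∞ :=
  Q.dirichletForm μ f + ∑' η, q η * ENNReal.ofReal ((g η - f η) ^ 2)

/-- For pointwise convergence this is a sum of nonnegative continuous functions. Together with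
Tychonoff's theorem for `admissible`, it provides minimizers without any Hilbert space argument. -/
theorem lowerSemicontinuous_penalizedForm [IsFiniteMeasure μ] {q : E → ℝ≥0∞} (hq : ∀ η, q η ≠ ∞)
    (g : E → ℝ) : LowerSemicontinuous (Q.penalizedForm μ q g) := by
  unfold penalizedForm
  have hc : ∀ η ξ, Q.conductance μ η ξ ≠ ∞ := fun η ξ =>
    ENNReal.mul_ne_top (measure_ne_top _ _) ENNReal.ofReal_ne_top
  refine LowerSemicontinuous.add ?_ ?_
  · have e : Q.dirichletForm μ = fun f : E → ℝ => ∑' (η) (ξ),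
        2⁻¹ * (Q.conductance μ η ξ * ENNReal.ofReal ((f ξ - f η) ^ 2)) := by
      ext f
      simp only [dirichletForm_eq, ← ENNReal.tsum_mul_left]
    rw [e]
    refine lowerSemicontinuous_tsum fun η => lowerSemicontinuous_tsum fun ξ => ?_
    refine Continuous.lowerSemicontinuous ?_
    refine (ENNReal.continuous_const_mul (by simp)).comp ?_
    exact (ENNReal.continuous_const_mul (hc η ξ)).comp (ENNReal.continuous_ofReal.comp (by fun_prop))
  · refine lowerSemicontinuous_tsum fun η => ?_
    exact ((ENNReal.continuous_const_mul (hq η)).comp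
      (ENNReal.continuous_ofReal.comp (by fun_prop))).lowerSemicontinuous

theorem exists_minimizer [IsFiniteMeasure μ] {q : E → ℝ≥0∞} (hq : ∀ η, q η ≠ ∞) (g : E → ℝ)
    {A : Set E} {b : E → ℝ} (hb : ∀ η, b η ∈ Icc (0 : ℝ) 1) :
    ∃ f ∈ admissible A b, ∀ f' ∈ admissible A b, Q.penalizedForm μ q g f ≤ Q.penalizedForm μ q g f' :=
  ((Q.lowerSemicontinuous_penalizedForm μ hq g).lowerSemicontinuousOn _).exists_isMinOn
    (s := admissible A b) ⟨b, hb, fun _ _ => rfl⟩ (isCompact_admissible A b)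

variable {Q μ}

-- Only the conductances at η see the value at η. The row and the column of η contribute equally by
-- reversibility, which cancels the factor ½; `R` collects the other terms and may be infinite.
open Classical in
theorem dirichletForm_update (hrev : Q.Reversible μ) (f : E → ℝ) (η : E) :
    ∃ R : ℝ≥0∞, ∀ t, Q.dirichletForm μ (Function.update f η t)
      = R + ∑' ξ, Q.conductance μ η ξ * ENNReal.ofReal ((f ξ - t) ^ 2) := by
  refine ⟨2⁻¹ * ∑' a, (if a = η then 0 else ∑' ξ, if ξ = η then 0 else
    Q.conductance μ a ξ * ENNReal.ofReal ((f ξ - f a) ^ 2)), fun t => ?_⟩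
  set f' := Function.update f η t with hf'
  have h0 : f' η = t := by simp [hf']
  have hne : ∀ ξ, ξ ≠ η → f' ξ = f ξ := fun ξ hξ => by simp [hf', hξ]
  have hrow : ∑' ξ, Q.conductance μ η ξ * ENNReal.ofReal ((f' ξ - f' η) ^ 2)
      = ∑' ξ, Q.conductance μ η ξ * ENNReal.ofReal ((f ξ - t) ^ 2) := by
    refine tsum_congr fun ξ => ?_
    by_cases hξ : ξ = η
    · rw [hξ, conductance_self, zero_mul, zero_mul]
    · rw [h0, hne ξ hξ]
  have hcol : ∑' a, (if a = η then 0 else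
        Q.conductance μ a η * ENNReal.ofReal ((f' η - f' a) ^ 2))
      = ∑' ξ, Q.conductance μ η ξ * ENNReal.ofReal ((f ξ - t) ^ 2) := by
    refine tsum_congr fun ξ => ?_
    by_cases hξ : ξ = η
    · rw [if_pos hξ, hξ, conductance_self, zero_mul]
    · rw [if_neg hξ, h0, hne ξ hξ, hrev.conductance_comm ξ η, ← neg_sub, neg_sq]
  rw [dirichletForm_eq, ENNReal.tsum_eq_add_tsum_ite η, hrow]
  have hrest : ∀ a, (if a = η then 0 else
        ∑' ξ, Q.conductance μ a ξ * ENNReal.ofReal ((f' ξ - f' a) ^ 2))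
      = (if a = η then 0 else Q.conductance μ a η * ENNReal.ofReal ((f' η - f' a) ^ 2))
        + (if a = η then 0 else ∑' ξ, if ξ = η then 0 else
          Q.conductance μ a ξ * ENNReal.ofReal ((f ξ - f a) ^ 2)) := by
    intro a
    by_cases ha : a = η
    · simp [ha]
    · rw [if_neg ha, if_neg ha, if_neg ha, ENNReal.tsum_eq_add_tsum_ite η]
      congr 1
      refine tsum_congr fun ξ => ?_
      by_cases hξ : ξ = η
      · simp [hξ]
      · rw [if_neg hξ, if_neg hξ, hne ξ hξ, hne a ha]
  simp_rw [hrest]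
  rw [ENNReal.tsum_add, hcol, ← add_assoc, mul_add, ← two_mul, ← mul_assoc,
    ENNReal.inv_mul_cancel (by simp) (by simp), one_mul, add_comm]

open Classical in
/-- The Euler–Lagrange equation of a minimizer. -/
theorem eulerLagrange [IsFiniteMeasure μ] (hrev : Q.Reversible μ)
    (hpos : ∀ η, 0 < Q.holdingRate η) {q : E → ℝ≥0∞} (hq : ∀ η, q η ≠ ∞) {g : E → ℝ}
    (hg : ∀ η, g η ∈ Icc (0 : ℝ) 1) {A : Set E} {b f : E → ℝ} (hf : f ∈ admissible A b)
    (hmin : ∀ f' ∈ admissible A b, Q.penalizedForm μ q g f ≤ Q.penalizedForm μ q g f')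
    (hfin : Q.penalizedForm μ q g f ≠ ∞) {η : E} (hη : η ∉ A) :
    (μ {η} * Q.exitRate η + q η) * ENNReal.ofReal (f η)
      = μ {η} * Q.exitRate η * Q.jumpOp (fun ξ => ENNReal.ofReal (f ξ)) η
        + q η * ENNReal.ofReal (g η) := by
  obtain ⟨R, hR⟩ := dirichletForm_update hrev f η
  rw [← tsum_conductance_mul hpos, ← tsum_conductance hpos]
  set R' := ∑' a, if a = η then 0 else q a * ENNReal.ofReal ((g a - f a) ^ 2) with hR'
  -- As a function of the value at η alone, the functional is a constant plus a quadratic of the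
  -- type of `eq_weighted_mean_of_forall_le`.
  have hJ : ∀ t, Q.penalizedForm μ q g (Function.update f η t) = (R + R') +
      (∑' ξ, Q.conductance μ η ξ * ENNReal.ofReal ((f ξ - t) ^ 2)
        + q η * ENNReal.ofReal ((g η - t) ^ 2)) := by
    intro t
    rw [penalizedForm, hR, ENNReal.tsum_eq_add_tsum_ite (f := fun a =>
      q a * ENNReal.ofReal ((g a - Function.update f η t a) ^ 2)) η]
    have : ∑' a, (if a = η then 0 else
        q a * ENNReal.ofReal ((g a - Function.update f η t a) ^ 2)) = R' := by
      refine tsum_congr fun a => ?_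
      by_cases ha : a = η
      · simp [ha]
      · simp [ha]
    rw [this, Function.update_self]
    ring
  have hself : Q.penalizedForm μ q g f = Q.penalizedForm μ q g (Function.update f η (f η)) := by
    rw [Function.update_eq_self]
  -- The constant can be cancelled only if it is finite, hence the assumption that the minimum is
  -- finite.
  have hRfin : R + R' ≠ ∞ := by
    rw [hself, hJ] at hfin
    exact (ENNReal.add_ne_top.1 hfin).1
  refine eq_weighted_mean_of_forall_le ?_ (hq η) hf.1 (hg η) (hf.1 η) fun t ht => ?_
  · rw [tsum_conductance hpos]
    exact ENNReal.mul_ne_top (measure_ne_top _ _) (Q.exitRate_ne_top η)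
  · have h := hmin (Function.update f η t) ⟨fun ξ => by
      by_cases hξ : ξ = η
      · rw [hξ, Function.update_self]; exact ht
      · rw [Function.update_of_ne hξ]; exact hf.1 ξ, fun ξ hξ => by
      have hne : ξ ≠ η := fun h => hη (h ▸ hξ)
      rw [Function.update_of_ne hne]; exact hf.2 ξ hξ⟩
    rw [hself, hJ, hJ] at h
    exact (ENNReal.add_le_add_iff_left hRfin).1 h

end RateMatrix

/-! ### Capacity estimates -/

namespace RateMatrix

variable {E : Type*} {Q : RateMatrix E} [MeasurableSpace E] {μ : Measure E}

theorem memLp_two_of_bounded [IsFiniteMeasure μ] {f : E → ℝ} {C : ℝ}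
    (hf : ∀ η, |f η| ≤ C) (hm : AEStronglyMeasurable f μ) : MemLp f 2 μ :=
  MemLp.of_bound hm C (Eventually.of_forall hf)

/-- Some point has positive mass since the total mass is 1, and detailed balance carries positivity
along jumps of positive rate. -/
theorem measure_singleton_ne_zero [Countable E] [DiscreteMeasurableSpace E]
    [IsProbabilityMeasure μ] (hrev : Q.Reversible μ) (hirr : Q.Irreducible) (η : E) :
    μ {η} ≠ 0 := by
  obtain ⟨ζ, hζ⟩ : ∃ ζ, μ {ζ} ≠ 0 := by
    by_contra! h
    have : μ univ = 0 := by
      rw [← iUnion_of_singleton E]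
      exact measure_iUnion_null h
    simp at this
  induction hirr ζ η with
  | refl => exact hζ
  | @tail b c _ hbc ih =>
    intro h0
    have h1 := hrev b c hbc.1
    rw [h0, zero_mul, mul_eq_zero] at h1
    rcases h1 with h1 | h1
    · exact ih h1
    · exact absurd h1 (by simpa using hbc.2)

/-- This is the case of zero penalty. Harmonicity is claimed only when the energy is finite, since
otherwise minimality carries no information. -/
theorem exists_equilibrium [IsFiniteMeasure μ] (hrev : Q.Reversible μ)
    (hpos : ∀ η, 0 < Q.holdingRate η) (hμ : ∀ η, μ {η} ≠ 0) {A : Set E} {b : E → ℝ}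
    (hb : ∀ η, b η ∈ Icc (0 : ℝ) 1) :
    ∃ f ∈ admissible A b, (∀ f' ∈ admissible A b, Q.dirichletForm μ f ≤ Q.dirichletForm μ f') ∧
      (Q.dirichletForm μ f ≠ ∞ → ∀ η ∉ A,
        ENNReal.ofReal (f η) = Q.jumpOp (fun ξ => ENNReal.ofReal (f ξ)) η) := by
  have hpen : ∀ f, Q.penalizedForm μ (fun _ => 0) (fun _ => 0) f = Q.dirichletForm μ f := by
    intro f; simp [penalizedForm]
  obtain ⟨f, hf, hmin⟩ := Q.exists_minimizer μ (q := fun _ => 0) (by simp) (fun _ => 0)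
    (A := A) hb
  refine ⟨f, hf, fun f' hf' => by simpa only [hpen] using hmin f' hf', fun hfin η hη => ?_⟩
  have h := eulerLagrange hrev hpos (q := fun _ => 0) (by simp) (g := fun _ => 0) (by simp) hf hmin
    (by rwa [hpen]) hη
  simp only [add_zero, zero_mul] at h
  refine (ENNReal.mul_right_inj ?_ ?_).1 h
  · exact mul_ne_zero (hμ η) (by simpa [exitRate] using hpos η)
  · exact ENNReal.mul_ne_top (measure_ne_top _ _) (Q.exitRate_ne_top η)

theorem dirichletForm_one_sub (f : E → ℝ) :
    Q.dirichletForm μ (fun η => 1 - f η) = Q.dirichletForm μ f := by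
  refine le_antisymm ?_ ?_ <;>
  · refine dirichletForm_mono fun η ξ => le_of_eq ?_
    ring

/-- Truncating a competitor for the capacity to [0, 1] does not raise its energy. The values may be
prescribed on only a part C of A ∪ B: fewer constraints lower the minimum. -/
theorem dirichletForm_le_of_admissible {A B C : Set E} (hCB : ∀ η ∈ C, η ∈ A ∨ η ∈ B)
    {b f : E → ℝ} (hbA : ∀ η ∈ C, η ∈ A → b η = 1) (hbB : ∀ η ∈ C, η ∈ B → b η = 0)
    (hmin : ∀ f' ∈ admissible C b, Q.dirichletForm μ f ≤ Q.dirichletForm μ f') :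
    Q.dirichletForm μ f ≤ Q.capacity μ A B := by
  refine le_iInf fun g => le_iInf fun hg => ?_
  refine (hmin (fun η => max 0 (min 1 (g η))) ⟨fun η => ⟨le_max_left _ _, by simp⟩, ?_⟩).trans
    (dirichletForm_clamp g)
  intro η hη
  rcases hCB η hη with h | h
  · simp [hg.2.1 η h, hbA η hη h]
  · simp [hg.2.2 η h, hbB η hη h]

theorem capacity_comm [IsFiniteMeasure μ] (A B : Set E) :
    Q.capacity μ A B = Q.capacity μ B A := by
  suffices h : ∀ A B, Q.capacity μ A B ≤ Q.capacity μ B A from le_antisymm (h A B) (h B A)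
  intro A B
  refine le_iInf fun f => le_iInf fun hf => ?_
  rw [← dirichletForm_one_sub f]
  refine iInf_le_of_le (fun η => 1 - f η) (iInf_le_of_le ⟨?_, ?_, ?_⟩ le_rfl)
  · exact (memLp_const 1).sub hf.1
  · intro η h; simp [hf.2.2 η h]
  · intro η h; simp [hf.2.1 η h]

/-- The capacity between two points controls the oscillation of functions of finite energy. -/
theorem capacity_mul_sq_le [Countable E] [DiscreteMeasurableSpace E] [IsFiniteMeasure μ]
    {f : E → ℝ} {C : ℝ} (hf : ∀ η, |f η| ≤ C) (η ζ : E) :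
    Q.capacity μ {η} {ζ} * ENNReal.ofReal ((f η - f ζ) ^ 2) ≤ Q.dirichletForm μ f := by
  by_cases h0 : f η - f ζ = 0
  · simp [h0]
  have hd : 0 < (f η - f ζ) ^ 2 := by positivity
  set g : E → ℝ := fun ξ => (f ξ - f ζ) / (f η - f ζ) with hg
  have h1 : Q.capacity μ {η} {ζ} ≤ Q.dirichletForm μ g := by
    refine iInf_le_of_le g (iInf_le_of_le ⟨?_, ?_, ?_⟩ le_rfl)
    · refine memLp_two_of_bounded (C := (C + C) / |f η - f ζ|) (fun ξ => ?_)
        (Measurable.of_discrete.aestronglyMeasurable)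
      rw [hg]
      simp only [abs_div]
      gcongr
      exact (abs_sub _ _).trans (add_le_add (hf ξ) (hf ζ))
    · rintro ξ rfl; exact div_self h0
    · rintro ξ rfl; simp [hg]
  have h2 := dirichletForm_add_le (Q := Q) (μ := μ) (f := g) (g := g) (h := f) (k := 0)
    (l := ((f η - f ζ) ^ 2)⁻¹) le_rfl (by positivity) (fun a b => le_of_eq (by
      simp only [hg]; field_simp; ring))
  simp only [ENNReal.ofReal_zero, zero_mul, add_zero] at h2
  calc Q.capacity μ {η} {ζ} * ENNReal.ofReal ((f η - f ζ) ^ 2)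
      ≤ ENNReal.ofReal ((f η - f ζ) ^ 2)⁻¹ * Q.dirichletForm μ f
          * ENNReal.ofReal ((f η - f ζ) ^ 2) := by gcongr; exact h1.trans h2
    _ = Q.dirichletForm μ f := by
        rw [ENNReal.ofReal_inv_of_pos hd, mul_right_comm, ENNReal.inv_mul_cancel, one_mul]
        · exact (ENNReal.ofReal_pos.2 hd).ne'
        · exact ENNReal.ofReal_ne_top

theorem eq_of_dirichletForm_eq_zero (hirr : Q.Irreducible) (hμ : ∀ η, μ {η} ≠ 0) {f : E → ℝ}
    (h : Q.dirichletForm μ f = 0) (η ζ : E) : f η = f ζ := by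
  rw [dirichletForm_eq, mul_eq_zero, or_iff_right (by simp), ENNReal.tsum_eq_zero] at h
  induction hirr η ζ with
  | refl => rfl
  | @tail b c _ hbc ih =>
    have h1 := ENNReal.tsum_eq_zero.1 (h b) c
    rcases mul_eq_zero.1 h1 with h2 | h2
    · rcases mul_eq_zero.1 h2 with h3 | h3
      · exact absurd h3 (hμ b)
      · exact absurd h3 (by simpa using hbc.2)
    · rw [ENNReal.ofReal_eq_zero] at h2
      have h3 : f c - f b = 0 := by
        have := le_antisymm h2 (sq_nonneg _)
        exact pow_eq_zero_iff (two_ne_zero) |>.1 this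
      rw [ih]; linarith

/-- The bound is by an attained minimum, and a minimizer of zero energy would be constant by
irreducibility, which its boundary values 1 and 0 exclude. -/
theorem capacity_singleton_ne_zero [IsFiniteMeasure μ] (hrev : Q.Reversible μ)
    (hirr : Q.Irreducible) (hpos : ∀ η, 0 < Q.holdingRate η) (hμ : ∀ η, μ {η} ≠ 0) {A B : Set E}
    (hAB : Disjoint A B) (hA : A.Nonempty) (hB : B.Nonempty) : Q.capacity μ A B ≠ 0 := by
  classical
  intro h
  obtain ⟨f, hf, hmin, -⟩ := exists_equilibrium hrev hpos hμ (A := A ∪ B)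
    (b := A.indicator 1) (fun η => by by_cases hη : η ∈ A <;> simp [hη])
  have h1 := dirichletForm_le_of_admissible (A := A) (B := B) (C := A ∪ B) (fun η hη => hη)
    (fun η _ hA => by simp [hA])
    (fun η _ hB => by simp [disjoint_right.1 hAB hB]) hmin
  rw [h, nonpos_iff_eq_zero] at h1
  obtain ⟨η, hη⟩ := hA
  obtain ⟨ζ, hζ⟩ := hB
  have h2 := eq_of_dirichletForm_eq_zero hirr hμ h1 η ζ
  rw [hf.2 η (Or.inl hη), hf.2 ζ (Or.inr hζ), indicator_of_mem hη,
    indicator_of_notMem (disjoint_right.1 hAB hζ)] at h2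
  exact one_ne_zero h2

/-- The probability of reaching `B` before `ζ`, from a point `η`, is at most
`3 Cap(A, B) / Cap(η, ζ)`, if `η, ζ ∈ A`. -/
theorem exists_escape_potential [Countable E] [DiscreteMeasurableSpace E] [IsFiniteMeasure μ]
    (hrev : Q.Reversible μ) (hpos : ∀ η, 0 < Q.holdingRate η) (hμ : ∀ η, μ {η} ≠ 0)
    {A B : Set E} (hAB : Disjoint A B) (hC : Q.capacity μ A B ≠ ∞) {η ζ : E} (hζ : ζ ∈ A) :
    ∃ v : E → ℝ≥0∞, (∀ ξ, v ξ ≤ 1) ∧ (∀ ξ ∈ B, v ξ = 1) ∧ v ζ = 0 ∧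
      (∀ ξ ∉ B, ξ ≠ ζ → v ξ = Q.jumpOp v ξ) ∧
      v η * Q.capacity μ {η} {ζ} ≤ 3 * Q.capacity μ A B := by
  classical
  have hζB : ζ ∉ B := disjoint_left.1 hAB hζ
  -- Vanishing is imposed only at ζ and not on all of A, so the energy of v is at most Cap(A, B).
  obtain ⟨v, hv, hmin, hharm⟩ := exists_equilibrium hrev hpos hμ (A := B ∪ {ζ})
    (b := B.indicator 1) (fun η => by by_cases hη : η ∈ B <;> simp [hη])
  have hvB : ∀ ξ ∈ B, v ξ = 1 := fun ξ hξ => by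
    rw [hv.2 ξ (Or.inl hξ), indicator_of_mem hξ]; rfl
  have hvζ : v ζ = 0 := by rw [hv.2 ζ (Or.inr rfl), indicator_of_notMem hζB]
  have hD : Q.dirichletForm μ v ≤ Q.capacity μ A B := by
    rw [capacity_comm]
    refine dirichletForm_le_of_admissible (C := B ∪ {ζ}) ?_ ?_ ?_ hmin
    · rintro ξ (h | h)
      · exact Or.inl h
      · exact Or.inr (by rw [mem_singleton_iff.1 h]; exact hζ)
    · intro ξ _ h; simp [h]
    · intro ξ _ h; simp [disjoint_left.1 hAB h]
  have hfin : Q.dirichletForm μ v ≠ ∞ := ne_top_of_le_ne_top hC hD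
  refine ⟨fun ξ => ENNReal.ofReal (v ξ), fun ξ => ENNReal.ofReal_le_one.2 (hv.1 ξ).2,
    fun ξ hξ => by simp [hvB ξ hξ], by simp [hvζ], fun ξ h1 h2 => hharm hfin ξ ?_, ?_⟩
  · rintro (h | h)
    · exact h1 h
    · exact h2 h
  set c := v η with hc
  have hc0 : 0 ≤ c := (hv.1 η).1
  have hc1 : c ≤ 1 := (hv.1 η).2
  rcases hc0.eq_or_lt with h0 | h0
  · simp only [← hc, ← h0, ENNReal.ofReal_zero, zero_mul, zero_le]
  -- Applied to v itself, the capacity bound would give only c² Cap ≤ D(v). The cut-off min(v, c) at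
  -- the level c = v η has energy at most 3 c D(v), which gains the missing factor c.
  have hcap := capacity_mul_sq_le (Q := Q) (μ := μ) (f := fun ξ => min (v ξ) c) (C := 1)
    (fun ξ => by
      rw [abs_of_nonneg (le_min (hv.1 ξ).1 hc0)]
      exact (min_le_left _ _).trans (hv.1 ξ).2) η ζ
  simp only [← hc, min_self, hvζ, min_eq_left hc0, sub_zero] at hcap
  -- The competitor has the boundary values of v: (1 + c) - c = 1 on B and 0 at ζ. The minimality of
  -- v then limits the energy of the cut-off.
  have hcomp : Q.dirichletForm μ v ≤
      Q.dirichletForm μ (fun ξ => (1 + c) * v ξ - min (v ξ) c) := by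
    refine hmin _ ⟨fun ξ => ?_, ?_⟩
    · simp only
      have h1 := (hv.1 ξ).1
      have h2 := (hv.1 ξ).2
      rcases le_total (v ξ) c with h | h
      · rw [min_eq_left h]; constructor <;> nlinarith
      · rw [min_eq_right h]; constructor <;> nlinarith
    · rintro ξ (h | h)
      · simp [hvB ξ h, min_eq_right hc1, h]
      · rw [mem_singleton_iff.1 h]; simp [hvζ, min_eq_left hc0, hζB]
  -- For increments X of v and Y of min(v, c) one has Y² ≤ X Y, whence ((1 + c) X - Y)² + (1 + 2c)
  -- Y² ≤ (1 + c)² X². The constant 3 comes from (1 + c)² - 1 = 2c + c² ≤ 3c.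
  have hquad := dirichletForm_add_le (Q := Q) (μ := μ)
    (f := fun ξ => (1 + c) * v ξ - min (v ξ) c) (g := fun ξ => min (v ξ) c) (h := v)
    (k := 1 + 2 * c) (l := (1 + c) ^ 2) (by positivity) (by positivity) (fun a b => by
      have hXY : (min (v b) c - min (v a) c) ^ 2
          ≤ (v b - v a) * (min (v b) c - min (v a) c) := by
        rcases le_total (v a) c with h1 | h1 <;> rcases le_total (v b) c with h2 | h2
        · rw [min_eq_left h1, min_eq_left h2]; nlinarith
        · rw [min_eq_left h1, min_eq_right h2]; nlinarith
        · rw [min_eq_right h1, min_eq_left h2]; nlinarith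
        · rw [min_eq_right h1, min_eq_right h2]; simp
      nlinarith)
  have h3 : ENNReal.ofReal (1 + 2 * c) * Q.dirichletForm μ (fun ξ => min (v ξ) c)
      ≤ ENNReal.ofReal (2 * c + c ^ 2) * Q.dirichletForm μ v := by
    have h4 := (add_le_add_left hcomp _).trans hquad
    have h5 : ENNReal.ofReal ((1 + c) ^ 2) = 1 + ENNReal.ofReal (2 * c + c ^ 2) := by
      rw [← ENNReal.ofReal_one, ← ENNReal.ofReal_add (by norm_num) (by positivity)]
      congr 1; ring
    rw [h5, add_mul, one_mul] at h4
    exact (ENNReal.add_le_add_iff_left hfin).1 h4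
  have h6 : ENNReal.ofReal c * (ENNReal.ofReal c * Q.capacity μ {η} {ζ})
      ≤ ENNReal.ofReal c * (3 * Q.dirichletForm μ v) := by
    calc ENNReal.ofReal c * (ENNReal.ofReal c * Q.capacity μ {η} {ζ})
        = Q.capacity μ {η} {ζ} * ENNReal.ofReal (c ^ 2) := by
          rw [ENNReal.ofReal_pow hc0]; ring
      _ ≤ 1 * Q.dirichletForm μ (fun ξ => min (v ξ) c) := by rw [one_mul]; exact hcap
      _ ≤ ENNReal.ofReal (1 + 2 * c) * Q.dirichletForm μ (fun ξ => min (v ξ) c) := by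
          gcongr
          rw [← ENNReal.ofReal_one]
          exact ENNReal.ofReal_le_ofReal (by linarith)
      _ ≤ ENNReal.ofReal (2 * c + c ^ 2) * Q.dirichletForm μ v := h3
      _ ≤ ENNReal.ofReal (3 * c) * Q.dirichletForm μ v := by
          gcongr; nlinarith
      _ = _ := by
          rw [ENNReal.ofReal_mul (by norm_num), ENNReal.ofReal_ofNat]; ring
  have h7 := (ENNReal.mul_le_mul_iff_right (by simpa using h0) ENNReal.ofReal_ne_top).1 h6
  exact h7.trans (by gcongr)

theorem tsum_tsum_conductance_symm (hrev : Q.Reversible μ) (hpos : ∀ η, 0 < Q.holdingRate η)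
    (f g : E → ℝ≥0∞) :
    2⁻¹ * ∑' (η) (ξ), Q.conductance μ η ξ * (f η * g ξ + f ξ * g η)
      = ∑' η, f η * (μ {η} * Q.exitRate η * Q.jumpOp g η) := by
  have h1 : ∑' (η) (ξ), Q.conductance μ η ξ * (f η * g ξ)
      = ∑' η, f η * (μ {η} * Q.exitRate η * Q.jumpOp g η) := by
    refine tsum_congr fun η => ?_
    rw [← tsum_conductance_mul hpos, ← ENNReal.tsum_mul_left]
    exact tsum_congr fun ξ => by ring
  have h2 : ∑' (η) (ξ), Q.conductance μ η ξ * (f ξ * g η)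
      = ∑' (η) (ξ), Q.conductance μ η ξ * (f η * g ξ) := by
    rw [ENNReal.tsum_comm]
    exact tsum_congr fun η => tsum_congr fun ξ => by rw [hrev.conductance_comm ξ η]
  simp only [mul_add, ENNReal.tsum_add]
  rw [h2, h1, ← mul_add, ← two_mul, ← mul_assoc, ENNReal.inv_mul_cancel (by simp) (by simp),
    one_mul]

theorem dirichletForm_indicator_le (hrev : Q.Reversible μ) (hpos : ∀ η, 0 < Q.holdingRate η)
    (F : Set E) : Q.dirichletForm μ (F.indicator 1)
      ≤ ∑' η, F.indicator (fun η => μ {η} * Q.exitRate η) η := by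
  have h := tsum_tsum_conductance_symm hrev hpos (F.indicator 1) (fun _ => 1)
  have e : ∑' η, F.indicator 1 η * (μ {η} * Q.exitRate η * Q.jumpOp (fun _ => 1) η)
      = ∑' η, F.indicator (fun η => μ {η} * Q.exitRate η) η := by
    refine tsum_congr fun η => ?_
    rw [jumpOp_const]
    by_cases hη : η ∈ F <;> simp [hη]
  rw [← e, ← h, dirichletForm_eq]
  gcongr with η ξ
  by_cases hη : η ∈ F <;> by_cases hξ : ξ ∈ F <;> simp [hη, hξ]

/-- The total rate at which the set `A` is left towards `B` is bounded by the capacity. -/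
theorem tsum_escape_le_capacity [Countable E] [DiscreteMeasurableSpace E] [IsFiniteMeasure μ]
    (hL : Q.Liouville) (hrev : Q.Reversible μ) (hpos : ∀ η, 0 < Q.holdingRate η)
    (hμ : ∀ η, μ {η} ≠ 0) {A B : Set E} (hAB : Disjoint A B) (hB : B.Nonempty)
    {u : E → ℝ≥0∞} (hu1 : ∀ ξ, u ξ ≤ 1) (huA : ∀ ξ ∈ A, u ξ = 0) (huB : ∀ ξ ∈ B, u ξ = 1)
    (hu : ∀ ξ ∉ A, ξ ∉ B → u ξ = Q.jumpOp u ξ) :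
    ∑' η, A.indicator (fun η => μ {η} * Q.exitRate η * Q.jumpOp u η) η ≤ Q.capacity μ A B := by
  classical
  by_cases hC : Q.capacity μ A B = ∞
  · rw [hC]; exact le_top
  obtain ⟨v, hv, hmin, hharm⟩ := exists_equilibrium hrev hpos hμ (A := A ∪ B)
    (b := B.indicator 1) (fun η => by by_cases hη : η ∈ B <;> simp [hη])
  have hvB : ∀ ξ ∈ B, v ξ = 1 := fun ξ hξ => by
    rw [hv.2 ξ (Or.inr hξ), indicator_of_mem hξ]; rfl
  have hvA : ∀ ξ ∈ A, v ξ = 0 := fun ξ hξ => by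
    rw [hv.2 ξ (Or.inl hξ), indicator_of_notMem (disjoint_left.1 hAB hξ)]
  have hD : Q.dirichletForm μ v ≤ Q.capacity μ A B := by
    rw [capacity_comm]
    refine dirichletForm_le_of_admissible (C := A ∪ B) (fun ξ h => h.symm) ?_ ?_ hmin
    · intro ξ _ h; simp [h]
    · intro ξ _ h; simp [disjoint_left.1 hAB h]
  have hfin : Q.dirichletForm μ v ≠ ∞ := ne_top_of_le_ne_top hC hD
  have huv : ∀ ξ, u ξ ≤ ENNReal.ofReal (v ξ) := by
    refine hL.le_of_subsolution (w := fun _ => 1) (b := fun _ => 0) (A ∪ B) hu1 (fun _ => le_rfl)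
      ?_ ?_ ?_ (Or.inl (hB.mono subset_union_right))
    · rintro ξ (h | h)
      · rw [huA ξ h]; exact zero_le
      · rw [huB ξ h, hvB ξ h]; simp
    · intro ξ h
      rw [one_mul, add_zero]
      exact (hu ξ (fun h' => h (Or.inl h')) (fun h' => h (Or.inr h'))).le
    · intro ξ h
      rw [one_mul, add_zero]
      exact (hharm hfin ξ h).ge
  refine le_trans ?_ hD
  rw [ENNReal.tsum_eq_iSup_sum]
  refine iSup_le fun s => ?_
  -- The exit rates need not be summable over A. A finite part of A has an indicator of finite
  -- energy `D1`, which is what the variation below needs.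
  set F : Set E := {η | η ∈ s ∧ η ∈ A} with hF
  set N : ℝ≥0∞ := ∑' η, F.indicator 1 η *
    (μ {η} * Q.exitRate η * Q.jumpOp (fun ξ => ENNReal.ofReal (v ξ)) η) with hN
  have hsN : ∑ η ∈ s, A.indicator (fun η => μ {η} * Q.exitRate η * Q.jumpOp u η) η ≤ N := by
    refine le_trans ?_ (ENNReal.sum_le_tsum s)
    refine Finset.sum_le_sum fun η hη => ?_
    by_cases hA : η ∈ A
    · rw [indicator_of_mem hA, indicator_of_mem (show η ∈ F from ⟨hη, hA⟩), Pi.one_apply, one_mul]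
      gcongr
      exact jumpOp_mono huv η
    · rw [indicator_of_notMem hA]; exact zero_le
  refine hsN.trans ?_
  set D1 := Q.dirichletForm μ (F.indicator 1) with hD1
  have hD1fin : D1 ≠ ∞ := by
    refine ne_top_of_le_ne_top ?_ (dirichletForm_indicator_le hrev hpos F)
    rw [tsum_eq_sum (s := s)]
    · refine (ENNReal.sum_lt_top.2 fun η _ => ?_).ne
      by_cases h : η ∈ F
      · rw [indicator_of_mem h]
        exact (ENNReal.mul_ne_top (measure_ne_top _ _) (Q.exitRate_ne_top η)).lt_top
      · rw [indicator_of_notMem h]; simp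
    · intro η hη
      exact indicator_of_notMem (fun h => hη h.1) _
  have hFA : ∀ η ∈ F, η ∈ A := fun η hη => hη.2
  have key : ∀ t : ℝ, 0 < t → 2 * N ≤ 2 * Q.dirichletForm μ v
      + ENNReal.ofReal t * (Q.dirichletForm μ v + D1) := by
    intro t ht
    -- First variation of the equilibrium potential in the direction v + 1_F. Cutting off at 0 keeps
    -- the boundary values: t - t = 0 on F, max(0, -t) = 0 on the rest of A, and (1 + t) - t = 1 on
    -- B. The mixed term of v and 1_F produces -N, as v vanishes on F.
    have hcomp : Q.dirichletForm μ v ≤ Q.dirichletForm μ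
        (fun ξ => max 0 ((1 + t) * v ξ + t * F.indicator 1 ξ - t)) := by
      refine hmin _ ⟨fun ξ => ⟨le_max_left _ _, max_le zero_le_one ?_⟩, ?_⟩
      · by_cases h : ξ ∈ F
        · rw [hvA ξ (hFA ξ h)]; simp [h]
        · simp only [indicator_of_notMem h]
          nlinarith [(hv.1 ξ).2]
      · rintro ξ (h | h)
        · simp only
          rw [hvA ξ h, indicator_of_notMem (disjoint_left.1 hAB h)]
          by_cases h' : ξ ∈ F
          · simp [h']
          · simp [h', ht.le]
        · have h' : ξ ∉ F := fun h' => disjoint_left.1 hAB (hFA ξ h') h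
          simp [hvB ξ h, h, h']
    have hN' : N = 2⁻¹ * ∑' (η) (ξ), Q.conductance μ η ξ *
        (F.indicator 1 η * ENNReal.ofReal (v ξ) + F.indicator 1 ξ * ENNReal.ofReal (v η)) :=
      (tsum_tsum_conductance_symm hrev hpos (F.indicator 1) (fun ξ => ENNReal.ofReal (v ξ))).symm
    have hsum : Q.dirichletForm μ v + ENNReal.ofReal (2 * t) * N ≤
        (Q.dirichletForm μ v + ENNReal.ofReal (2 * t) * Q.dirichletForm μ v)
          + ENNReal.ofReal (t ^ 2) * (Q.dirichletForm μ v + D1) := by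
      refine (add_le_add_left hcomp _).trans ?_
      rw [hN', hD1, mul_left_comm]
      simp only [dirichletForm_eq]
      rw [← mul_add, ← mul_add, mul_left_comm (ENNReal.ofReal (t ^ 2)),
        mul_left_comm (ENNReal.ofReal (2 * t)), ← mul_add, ← mul_add]
      refine mul_le_mul_right ?_ _
      simp only [← ENNReal.tsum_mul_left, ← ENNReal.tsum_add]
      refine ENNReal.tsum_le_tsum fun η => ENNReal.tsum_le_tsum fun ξ => ?_
      have e : ∀ (c k x y : ℝ≥0∞), c * x + k * (c * y) = c * (x + k * y) := fun _ _ _ _ => by ring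
      have e' : ∀ (c k l x y : ℝ≥0∞), c * x + k * (c * x) + l * (c * x + c * y)
        = c * (x + k * x + l * (x + y)) := fun _ _ _ _ _ => by ring
      rw [e, e']
      refine mul_le_mul_right ?_ _
      have hi : ∀ ζ, F.indicator (1 : E → ℝ≥0∞) ζ = ENNReal.ofReal (F.indicator (1 : E → ℝ) ζ) := by
        intro ζ
        by_cases h : ζ ∈ F <;> simp [h]
      have hi0 : ∀ ζ, 0 ≤ F.indicator (1 : E → ℝ) ζ := fun ζ => by
        by_cases h : ζ ∈ F <;> simp [h]
      have hv0 := fun ζ => (hv.1 ζ).1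
      rw [hi, hi, ← ENNReal.ofReal_mul (hi0 η), ← ENNReal.ofReal_mul (hi0 ξ),
        ← ENNReal.ofReal_add (mul_nonneg (hi0 η) (hv0 ξ)) (mul_nonneg (hi0 ξ) (hv0 η)),
        ← ENNReal.ofReal_mul (by positivity), ← ENNReal.ofReal_mul (by positivity),
        ← ENNReal.ofReal_add (by positivity) (mul_nonneg (by positivity)
          (add_nonneg (mul_nonneg (hi0 η) (hv0 ξ)) (mul_nonneg (hi0 ξ) (hv0 η)))),
        ← ENNReal.ofReal_add (by positivity) (by positivity),
        ← ENNReal.ofReal_add (by positivity) (by positivity),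
        ← ENNReal.ofReal_mul (by positivity),
        ← ENNReal.ofReal_add (by positivity) (by positivity)]
      refine ENNReal.ofReal_le_ofReal ?_
      have hclip : (max 0 ((1 + t) * v ξ + t * F.indicator (1 : E → ℝ) ξ - t)
            - max 0 ((1 + t) * v η + t * F.indicator (1 : E → ℝ) η - t)) ^ 2
          ≤ ((1 + t) * (v ξ - v η)
            + t * (F.indicator (1 : E → ℝ) ξ - F.indicator (1 : E → ℝ) η)) ^ 2 := by
        rw [sq_le_sq, max_comm 0, max_comm 0]
        refine (abs_max_sub_max_le_abs _ _ _).trans (le_of_eq ?_)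
        congr 1; ring
      refine (add_le_add_left hclip _).trans ?_
      by_cases h1 : η ∈ F <;> by_cases h2 : ξ ∈ F
      · simp [h1, h2, hvA η (hFA η h1), hvA ξ (hFA ξ h2)]
      · simp only [h1, h2, hvA η (hFA η h1), indicator_of_mem, indicator_of_notMem,
          not_false_eq_true, Pi.one_apply]
        nlinarith [hv0 ξ, mul_nonneg ht.le (hv0 ξ), mul_nonneg (mul_nonneg ht.le ht.le) (hv0 ξ)]
      · simp only [h1, h2, hvA ξ (hFA ξ h2), indicator_of_mem, indicator_of_notMem,
          not_false_eq_true, Pi.one_apply]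
        nlinarith [hv0 η, mul_nonneg ht.le (hv0 η), mul_nonneg (mul_nonneg ht.le ht.le) (hv0 η)]
      · simp only [h1, h2, indicator_of_notMem, not_false_eq_true]
        nlinarith
    rw [add_assoc] at hsum
    have h3 := (ENNReal.add_le_add_iff_left hfin).1 hsum
    have h4 : ENNReal.ofReal (2 * t) = ENNReal.ofReal t * 2 := by
      rw [mul_comm, ENNReal.ofReal_mul ht.le, ENNReal.ofReal_ofNat]
    rw [h4, sq, ENNReal.ofReal_mul ht.le, mul_assoc, mul_assoc, mul_assoc, ← mul_add] at h3
    exact (ENNReal.mul_le_mul_iff_right (by simpa using ht) ENNReal.ofReal_ne_top).1 h3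
  have hK : Q.dirichletForm μ v + D1 ≠ ∞ := ENNReal.add_ne_top.2 ⟨hfin, hD1fin⟩
  -- Let t tend to 0 in `key`.
  have h2N : 2 * N ≤ 2 * Q.dirichletForm μ v := by
    refine ENNReal.le_of_forall_pos_le_add fun ε hε _ => ?_
    set K : ℝ≥0∞ := Q.dirichletForm μ v + D1 with hKdef
    have hpos' : 0 < (ε : ℝ) / (K.toReal + 1) := by positivity
    refine (key _ hpos').trans ?_
    refine add_le_add_right ?_ _
    rw [← ENNReal.ofReal_coe_nnreal]
    nth_rewrite 2 [← ENNReal.ofReal_toReal hK]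
    rw [← ENNReal.ofReal_mul hpos'.le]
    refine ENNReal.ofReal_le_ofReal ?_
    rw [div_mul_eq_mul_div, div_le_iff₀ (by positivity)]
    nlinarith [ε.coe_nonneg, K.toReal_nonneg]
  exact (ENNReal.mul_le_mul_iff_right (by simp) (by simp)).1 h2N

/-- A function of small energy solving the resolvent equation with right-hand side `1_D`. -/
theorem exists_resolvent [Countable E] [DiscreteMeasurableSpace E] [IsFiniteMeasure μ]
    (hrev : Q.Reversible μ) (hpos : ∀ η, 0 < Q.holdingRate η) (hμ : ∀ η, μ {η} ≠ 0)
    {a : ℝ≥0∞} (ha' : a ≠ ∞) (D : Set E) :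
    ∃ V : E → ℝ, (∀ η, V η ∈ Icc (0 : ℝ) 1) ∧
      (∀ η, ENNReal.ofReal (V η) = Q.exitRate η / (Q.exitRate η + a) *
        Q.jumpOp (fun ξ => ENNReal.ofReal (V ξ)) η + a / (Q.exitRate η + a) * D.indicator 1 η) ∧
      Q.dirichletForm μ V ≤ a * μ D ∧
      a * ∑' η, Dᶜ.indicator (fun η => μ {η} * ENNReal.ofReal (V η ^ 2)) η ≤ a * μ D := by
  classical
  have hg : ∀ η, (D.indicator 1 : E → ℝ) η ∈ Icc (0 : ℝ) 1 := fun η => by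
    by_cases h : η ∈ D <;> simp [h]
  have hq : ∀ η, a * μ {η} ≠ ∞ := fun η => ENNReal.mul_ne_top ha' (measure_ne_top _ _)
  obtain ⟨V, hV, hmin⟩ := Q.exists_minimizer μ (q := fun η => a * μ {η}) hq
    (D.indicator 1) (A := ∅) (b := fun _ => 0) (by simp)
  have h0 : Q.penalizedForm μ (fun η => a * μ {η}) (D.indicator 1) (fun _ => 0) = a * μ D := by
    have hD : μ D = ∑' η, D.indicator (fun η => μ {η}) η :=
      (Measure.tsum_indicator_apply_singleton μ D MeasurableSet.of_discrete).symm
    have h1 : Q.dirichletForm μ (fun _ => 0) = 0 := by simp [dirichletForm_eq]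
    have h2 : ∑' η, a * μ {η} * ENNReal.ofReal (((D.indicator 1 : E → ℝ) η - 0) ^ 2) = a * μ D := by
      rw [hD, ← ENNReal.tsum_mul_left]
      refine tsum_congr fun η => ?_
      by_cases h : η ∈ D <;> simp [h]
    rw [penalizedForm, h1, zero_add, h2]
  -- The zero function has penalized energy a μ(D). This bounds at once the energy of V and its
  -- penalty, which off D is a Σ μ V².
  have hle := hmin (fun _ => 0) ⟨by simp, by simp⟩
  rw [h0] at hle
  have hfin : Q.penalizedForm μ (fun η => a * μ {η}) (D.indicator 1) V ≠ ∞ :=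
    ne_top_of_le_ne_top (ENNReal.mul_ne_top ha' (measure_ne_top _ _)) hle
  refine ⟨V, hV.1, fun η => ?_, le_self_add.trans hle, ?_⟩
  · have h := eulerLagrange hrev hpos hq hg hV hmin hfin (notMem_empty η)
    have hl : Q.exitRate η + a ≠ 0 := by
      have : Q.exitRate η ≠ 0 := by simpa [exitRate] using hpos η
      simp [this]
    have hl' : Q.exitRate η + a ≠ ∞ := ENNReal.add_ne_top.2 ⟨Q.exitRate_ne_top η, ha'⟩
    have hi : ENNReal.ofReal ((D.indicator 1 : E → ℝ) η) = D.indicator 1 η := by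
      by_cases h : η ∈ D <;> simp [h]
    rw [hi] at h
    have h1 : μ {η} * ((Q.exitRate η + a) * ENNReal.ofReal (V η))
        = μ {η} * (Q.exitRate η * Q.jumpOp (fun ξ => ENNReal.ofReal (V ξ)) η
          + a * D.indicator 1 η) := by
      calc _ = (μ {η} * Q.exitRate η + a * μ {η}) * ENNReal.ofReal (V η) := by ring
        _ = _ := by rw [h]; ring
    have h2 := (ENNReal.mul_right_inj (hμ η) (measure_ne_top _ _)).1 h1
    have e : ∀ l y z : ℝ≥0∞, l / (Q.exitRate η + a) * y + a / (Q.exitRate η + a) * z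
        = (l * y + a * z) / (Q.exitRate η + a) := fun l y z => by
      simp only [div_eq_mul_inv]; ring
    rw [e, ← h2, mul_comm (Q.exitRate η + a), ENNReal.mul_div_cancel_right hl hl']
  · refine le_trans ?_ (le_add_self.trans hle)
    rw [← ENNReal.tsum_mul_left]
    refine ENNReal.tsum_le_tsum fun η => ?_
    by_cases h : η ∈ D
    · simp [h]
    · simp [h, mul_assoc]

end RateMatrix

/-! ### Operators given by nonnegative kernels -/

section KernelOp

variable {E : Type*}

/-- Operators on `[0, ∞]`-valued functions which are given by a nonnegative matrix. -/
def IsKernelOp (K : (E → ℝ≥0∞) → E → ℝ≥0∞) : Prop :=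
  ∃ k : E → E → ℝ≥0∞, ∀ f η, K f η = ∑' ξ, k η ξ * f ξ

namespace IsKernelOp

variable {K L : (E → ℝ≥0∞) → E → ℝ≥0∞}

theorem mono (hK : IsKernelOp K) {f g : E → ℝ≥0∞} (h : ∀ ξ, f ξ ≤ g ξ) (η : E) :
    K f η ≤ K g η := by
  obtain ⟨k, hk⟩ := hK
  rw [hk, hk]
  exact ENNReal.tsum_le_tsum fun ξ => mul_le_mul_right (h ξ) _

theorem map_add (hK : IsKernelOp K) (f g : E → ℝ≥0∞) (η : E) :
    K (fun ξ => f ξ + g ξ) η = K f η + K g η := by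
  obtain ⟨k, hk⟩ := hK
  simp only [hk, mul_add, ENNReal.tsum_add]

theorem map_tsum (hK : IsKernelOp K) {ι : Type*} (f : ι → E → ℝ≥0∞) (η : E) :
    K (fun ξ => ∑' i, f i ξ) η = ∑' i, K (f i) η := by
  obtain ⟨k, hk⟩ := hK
  simp only [hk, ← ENNReal.tsum_mul_left]
  exact ENNReal.tsum_comm

theorem diag (a : E → ℝ≥0∞) : IsKernelOp fun f η => a η * f η := by
  classical
  refine ⟨fun η ξ => if ξ = η then a η else 0, fun f η => ?_⟩
  rw [tsum_eq_single η (fun ξ hξ => by simp [hξ])]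
  simp

theorem indicator (S : Set E) : IsKernelOp fun f => S.indicator f := by
  classical
  obtain ⟨k, hk⟩ := diag (S.indicator (1 : E → ℝ≥0∞))
  refine ⟨k, fun f η => ?_⟩
  rw [← hk f η]
  by_cases h : η ∈ S <;> simp [h]

theorem comp (hK : IsKernelOp K) (hL : IsKernelOp L) : IsKernelOp fun f => K (L f) := by
  obtain ⟨k, hk⟩ := hK
  obtain ⟨l, hl⟩ := hL
  refine ⟨fun η ζ => ∑' ξ, k η ξ * l ξ ζ, fun f η => ?_⟩
  simp only [hk, hl, ← ENNReal.tsum_mul_left, ← ENNReal.tsum_mul_right]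
  rw [ENNReal.tsum_comm]
  exact tsum_congr fun ζ => tsum_congr fun ξ => by ring

theorem add (hK : IsKernelOp K) (hL : IsKernelOp L) : IsKernelOp fun f η => K f η + L f η := by
  obtain ⟨k, hk⟩ := hK
  obtain ⟨l, hl⟩ := hL
  exact ⟨fun η ξ => k η ξ + l η ξ, fun f η => by simp only [hk, hl, add_mul, ENNReal.tsum_add]⟩

theorem iterate (hK : IsKernelOp K) (n : ℕ) : IsKernelOp K^[n] := by
  induction n with
  | zero =>
    have h := diag (fun _ : E => (1 : ℝ≥0∞))
    simp only [one_mul] at h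
    exact h
  | succ n ih =>
    have := ih.comp hK
    exact this

theorem tsum {ι : Type*} {K : ι → (E → ℝ≥0∞) → E → ℝ≥0∞} (hK : ∀ i, IsKernelOp (K i)) :
    IsKernelOp fun f η => ∑' i, K i f η := by
  choose k hk using hK
  refine ⟨fun η ξ => ∑' i, k i η ξ, fun f η => ?_⟩
  simp only [hk, ← ENNReal.tsum_mul_right]
  exact ENNReal.tsum_comm

end IsKernelOp

/-- The potential `∑ₙ Kⁿ f`. -/
def green (K : (E → ℝ≥0∞) → E → ℝ≥0∞) (f : E → ℝ≥0∞) (η : E) : ℝ≥0∞ := ∑' n, K^[n] f η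

variable {K : (E → ℝ≥0∞) → E → ℝ≥0∞}

theorem IsKernelOp.green (hK : IsKernelOp K) : IsKernelOp (green K) :=
  IsKernelOp.tsum fun n => hK.iterate n

theorem green_eq (hK : IsKernelOp K) (f : E → ℝ≥0∞) (η : E) :
    green K f η = f η + K (green K f) η := by
  have h : K (green K f) η = ∑' n, K^[n + 1] f η := by
    simp only [Function.iterate_succ_apply']
    exact hK.map_tsum (fun n => K^[n] f) η
  rw [h, green, tsum_eq_zero_add' ENNReal.summable]
  rfl

/-- The potential is the least supersolution: iterating the inequality n times leaves partial sum
plus Kⁿ ψ ≤ ψ. -/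
theorem green_le (hK : IsKernelOp K) {h ψ : E → ℝ≥0∞} (hψ : ∀ η, h η + K ψ η ≤ ψ η) (η : E) :
    green K h η ≤ ψ η := by
  have key : ∀ n, ∑ k ∈ Finset.range n, K^[k] h η + K^[n] ψ η ≤ ψ η := by
    intro n
    induction n with
    | zero => simp
    | succ n ih =>
      refine le_trans ?_ ih
      rw [Finset.sum_range_succ, add_assoc]
      gcongr
      rw [Function.iterate_succ_apply, ← (hK.iterate n).map_add]
      exact (hK.iterate n).mono hψ η
  exact ENNReal.tsum_le_of_sum_range_le fun n => le_self_add.trans (key n)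

/-- Symmetry of an operator with respect to the weights `m`. -/
def IsReversibleOp (m : E → ℝ≥0∞) (K : (E → ℝ≥0∞) → E → ℝ≥0∞) : Prop :=
  ∀ f g, ∑' η, m η * (f η * K g η) = ∑' η, m η * (K f η * g η)

theorem IsReversibleOp.green {m : E → ℝ≥0∞} (hm : IsReversibleOp m K) : IsReversibleOp m (green K) := by
  have key : ∀ n f g, ∑' η, m η * (f η * K^[n] g η) = ∑' η, m η * (K^[n] f η * g η) := by
    intro n
    induction n with
    | zero => exact fun f g => rfl
    | succ n ih =>
      intro f g
      rw [Function.iterate_succ_apply, ih, hm, Function.iterate_succ_apply']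
  intro f g
  simp only [_root_.green, ← ENNReal.tsum_mul_left, ← ENNReal.tsum_mul_right]
  rw [ENNReal.tsum_comm]
  simp only [key]
  exact ENNReal.tsum_comm

end KernelOp

/-! ### The trace operator -/

namespace RateMatrix

variable {E : Type*} (Q : RateMatrix E)

theorem isKernelOp_jumpOp : IsKernelOp Q.jumpOp := ⟨Q.jumpProb, fun _ _ => rfl⟩

/-- The transition operator killed on `S`. -/
def killedOp (S : Set E) (f : E → ℝ≥0∞) : E → ℝ≥0∞ :=
  Sᶜ.indicator (Q.jumpOp (Sᶜ.indicator f))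

theorem isKernelOp_killedOp (S : Set E) : IsKernelOp (Q.killedOp S) :=
  (IsKernelOp.indicator Sᶜ).comp (Q.isKernelOp_jumpOp.comp (IsKernelOp.indicator Sᶜ))

/-- The harmonic extension of `g` from `S`. -/
def harmExt (S : Set E) (g : E → ℝ≥0∞) (η : E) : ℝ≥0∞ :=
  S.indicator g η + green (Q.killedOp S) (Sᶜ.indicator (Q.jumpOp (S.indicator g))) η

theorem isKernelOp_harmExt (S : Set E) : IsKernelOp (Q.harmExt S) :=
  (IsKernelOp.indicator S).add ((Q.isKernelOp_killedOp S).green.comp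
    ((IsKernelOp.indicator Sᶜ).comp (Q.isKernelOp_jumpOp.comp (IsKernelOp.indicator S))))

/-- The transition operator of the trace on `S` of the jump chain. -/
def traceOp (S : Set E) (g : E → ℝ≥0∞) : E → ℝ≥0∞ := Q.jumpOp (Q.harmExt S g)

theorem isKernelOp_traceOp (S : Set E) : IsKernelOp (Q.traceOp S) :=
  Q.isKernelOp_jumpOp.comp (Q.isKernelOp_harmExt S)

variable {Q}

theorem green_killedOp_of_mem {S : Set E} (g : E → ℝ≥0∞) {η : E} (hη : η ∈ S) :
    green (Q.killedOp S) (Sᶜ.indicator g) η = 0 := by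
  rw [green_eq (Q.isKernelOp_killedOp S)]
  simp [killedOp, hη]

theorem harmExt_of_mem {S : Set E} (g : E → ℝ≥0∞) {η : E} (hη : η ∈ S) :
    Q.harmExt S g η = g η := by
  rw [harmExt, green_killedOp_of_mem _ hη, indicator_of_mem hη, add_zero]

theorem harmExt_of_notMem {S : Set E} (g : E → ℝ≥0∞) {η : E} (hη : η ∉ S) :
    Q.harmExt S g η = Q.jumpOp (Q.harmExt S g) η := by
  have h1 : ∀ f : E → ℝ≥0∞, (Sᶜ.indicator (green (Q.killedOp S) (Sᶜ.indicator f)))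
      = green (Q.killedOp S) (Sᶜ.indicator f) := by
    intro f
    ext ξ
    by_cases h : ξ ∈ S
    · rw [green_killedOp_of_mem _ h]; simp [h]
    · simp [h]
  have h2 : Q.jumpOp (Q.harmExt S g) η = Q.jumpOp (S.indicator g) η
      + Q.jumpOp (green (Q.killedOp S) (Sᶜ.indicator (Q.jumpOp (S.indicator g)))) η :=
    jumpOp_add _ _ η
  have hη' : η ∈ Sᶜ := hη
  rw [h2, harmExt, indicator_of_notMem hη, zero_add, green_eq (Q.isKernelOp_killedOp S),
    indicator_of_mem hη', killedOp, indicator_of_mem hη', h1]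

theorem harmExt_congr {S : Set E} {f g : E → ℝ≥0∞} (h : ∀ η ∈ S, f η = g η) :
    Q.harmExt S f = Q.harmExt S g := by
  have : S.indicator f = S.indicator g := indicator_congr h
  ext η
  rw [harmExt, harmExt, this]

theorem traceOp_congr {S : Set E} {f g : E → ℝ≥0∞} (h : ∀ η ∈ S, f η = g η) :
    Q.traceOp S f = Q.traceOp S g := by rw [traceOp, traceOp, harmExt_congr h]

/-- The extension sums over the number of steps made outside S, so it is a potential and lies below
every supersolution with the same values on S. -/
theorem harmExt_le {S : Set E} {F : E → ℝ≥0∞} (hF : ∀ η ∉ S, Q.jumpOp F η ≤ F η) (η : E) :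
    Q.harmExt S F η ≤ F η := by
  by_cases h : η ∈ S
  · rw [harmExt_of_mem _ h]
  · rw [harmExt, indicator_of_notMem h, zero_add]
    refine green_le (Q.isKernelOp_killedOp S) (fun ξ => ?_) η
    by_cases hξ : ξ ∈ Sᶜ
    · rw [killedOp, indicator_of_mem hξ, indicator_of_mem hξ, ← jumpOp_add]
      have : (fun ζ => S.indicator F ζ + Sᶜ.indicator F ζ) = F := by
        ext ζ; by_cases hζ : ζ ∈ S <;> simp [hζ]
      rw [this]
      exact hF ξ hξ
    · simp only [killedOp, indicator_of_notMem hξ, add_zero, zero_le]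

/-- Minimality gives one inequality. The other is uniqueness for the bounded Dirichlet problem, that
is, recurrence: the chain does enter S. -/
theorem Liouville.harmExt_eq (hL : Q.Liouville) {S : Set E} (hS : S.Nonempty) {F : E → ℝ≥0∞}
    (hF1 : ∀ η, F η ≤ 1) (hF : ∀ η ∉ S, F η = Q.jumpOp F η) (η : E) : Q.harmExt S F η = F η := by
  refine le_antisymm (harmExt_le (fun η hη => (hF η hη).ge) η) ?_
  refine hL.le_of_subsolution (w := fun _ => 1) (b := fun _ => 0) S hF1 (fun _ => le_rfl)
    (fun η hη => (harmExt_of_mem F hη).ge) (fun η hη => ?_) (fun η hη => ?_) (Or.inl hS) η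
  · rw [one_mul, add_zero]; exact (hF η hη).le
  · rw [one_mul, add_zero]; exact (harmExt_of_notMem F hη).ge

theorem Liouville.traceOp_eq (hL : Q.Liouville) {S : Set E} (hS : S.Nonempty) {F : E → ℝ≥0∞}
    (hF1 : ∀ η, F η ≤ 1) (hF : ∀ η ∉ S, F η = Q.jumpOp F η) (η : E) :
    Q.traceOp S F η = Q.jumpOp F η := by
  have : Q.harmExt S F = F := funext fun η => hL.harmExt_eq hS hF1 hF η
  rw [traceOp, this]

theorem Liouville.traceOp_one (hL : Q.Liouville) {S : Set E} (hS : S.Nonempty) (η : E) :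
    Q.traceOp S (fun _ => 1) η = 1 := by
  rw [hL.traceOp_eq hS (fun _ => le_rfl) (fun η _ => (jumpOp_const 1 η).symm), jumpOp_const]

theorem isReversibleOp_jumpOp [MeasurableSpace E] {μ : Measure E} (hrev : Q.Reversible μ)
    (hpos : ∀ η, 0 < Q.holdingRate η) : IsReversibleOp (fun η => μ {η} * Q.exitRate η) Q.jumpOp := by
  intro f g
  have h1 : ∀ f g : E → ℝ≥0∞, ∑' η, μ {η} * Q.exitRate η * (f η * Q.jumpOp g η)
      = ∑' (η) (ξ), f η * (Q.conductance μ η ξ * g ξ) := by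
    intro f g
    refine tsum_congr fun η => ?_
    rw [ENNReal.tsum_mul_left, tsum_conductance_mul hpos]
    ring
  have h2 : ∀ η, μ {η} * Q.exitRate η * (Q.jumpOp f η * g η)
      = μ {η} * Q.exitRate η * (g η * Q.jumpOp f η) := fun η => by ring
  simp only [h2]
  rw [h1, h1, ENNReal.tsum_comm]
  refine tsum_congr fun η => tsum_congr fun ξ => ?_
  rw [hrev.conductance_comm ξ η]; ring

theorem tsum_indicator_mul {m f g : E → ℝ≥0∞} (S : Set E) :
    ∑' η, m η * (S.indicator f η * g η) = ∑' η, m η * (f η * S.indicator g η) := by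
  refine tsum_congr fun η => ?_
  by_cases h : η ∈ S <;> simp [h]

/-- A step of the trace is either a direct step within S or an excursion outside it. The first part
is symmetric because the jump chain is, the second because the potential of the killed chain is. -/
theorem isReversibleOp_traceOp [MeasurableSpace E] {μ : Measure E} (hrev : Q.Reversible μ)
    (hpos : ∀ η, 0 < Q.holdingRate η) (S : Set E) :
    IsReversibleOp (fun η => μ {η} * Q.exitRate η) (fun f => S.indicator (Q.traceOp S f)) := by
  set m : E → ℝ≥0∞ := fun η => μ {η} * Q.exitRate η with hm
  have hP : IsReversibleOp m Q.jumpOp := isReversibleOp_jumpOp hrev hpos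
  have hK : IsReversibleOp m (Q.killedOp S) := by
    intro f g
    rw [killedOp, killedOp, ← tsum_indicator_mul, hP, tsum_indicator_mul]
  have hG := hK.green
  -- The excursion term is written with the potential in the middle, between the functions P(1_S f)
  -- and P(1_S g) outside S, so that its symmetry is visible.
  have hexp : ∀ f g : E → ℝ≥0∞, ∑' η, m η * (f η * S.indicator (Q.traceOp S g) η)
      = ∑' η, m η * (S.indicator f η * Q.jumpOp (S.indicator g) η)
        + ∑' η, m η * (Sᶜ.indicator (Q.jumpOp (S.indicator f)) η *
          green (Q.killedOp S) (Sᶜ.indicator (Q.jumpOp (S.indicator g))) η) := by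
    intro f g
    have h0 : ∀ ξ, green (Q.killedOp S) (Sᶜ.indicator (Q.jumpOp (S.indicator g))) ξ
        = Sᶜ.indicator (green (Q.killedOp S) (Sᶜ.indicator (Q.jumpOp (S.indicator g)))) ξ := by
      intro ξ
      by_cases h : ξ ∈ S
      · rw [green_killedOp_of_mem _ h]; simp [h]
      · simp [h]
    have h1 : ∑' η, m η * (Sᶜ.indicator (Q.jumpOp (S.indicator f)) η *
          green (Q.killedOp S) (Sᶜ.indicator (Q.jumpOp (S.indicator g))) η)
        = ∑' η, m η * (S.indicator f η *
          Q.jumpOp (green (Q.killedOp S) (Sᶜ.indicator (Q.jumpOp (S.indicator g)))) η) := by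
      rw [hP, tsum_indicator_mul]
      exact tsum_congr fun η => by rw [← h0]
    rw [← tsum_indicator_mul, h1, ← ENNReal.tsum_add]
    refine tsum_congr fun η => ?_
    rw [← mul_add, ← mul_add]
    congr 2
    exact jumpOp_add _ _ η
  intro f g
  have hc : ∀ η, m η * (S.indicator (Q.traceOp S f) η * g η)
      = m η * (g η * S.indicator (Q.traceOp S f) η) := fun η => by ring
  simp only [hc]
  rw [hexp, hexp, hP, hG]
  congr 1
  · exact tsum_congr fun η => by ring
  · exact tsum_congr fun η => by ring

/-- Averaged resolvent equation for the trace process killed when it leaves `A`. -/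
theorem Liouville.tsum_resolvent_eq [MeasurableSpace E] {μ : Measure E} (hL : Q.Liouville)
    (hrev : Q.Reversible μ) (hpos : ∀ η, 0 < Q.holdingRate η) {S A B : Set E}
    (hAB : Disjoint A B) (hS : S = A ∪ B) (hB : B.Nonempty) {a : ℝ≥0∞}
    (ha' : a ≠ ∞) {F : E → ℝ≥0∞} (hF1 : ∀ η, F η ≤ 1)
    (hFA : ∀ η ∈ A, F η = Q.exitRate η / (Q.exitRate η + a) * Q.jumpOp F η)
    (hFS : ∀ η ∉ S, F η = Q.jumpOp F η) :
    ∑' η, A.indicator (fun η => μ {η} *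
        ((a + Q.exitRate η * Q.traceOp S (B.indicator 1) η) * F η)) η
      = ∑' η, A.indicator (fun η => μ {η} *
        (Q.exitRate η * Q.traceOp S (B.indicator F) η)) η := by
  have hSB : B ⊆ S := hS ▸ subset_union_right
  have hSA : A ⊆ S := hS ▸ subset_union_left
  have hSne : S.Nonempty := hB.mono hSB
  set w : E → ℝ≥0∞ := fun η => Q.exitRate η / (Q.exitRate η + a) with hw
  have hl : ∀ η, Q.exitRate η + a ≠ 0 := fun η => by
    have : Q.exitRate η ≠ 0 := by simpa [exitRate] using hpos η
    simp [this]
  have hl' : ∀ η, Q.exitRate η + a ≠ ∞ := fun η =>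
    ENNReal.add_ne_top.2 ⟨Q.exitRate_ne_top η, ha'⟩
  have hw1 : ∀ η, w η ≤ 1 := fun η => ENNReal.div_le_of_le_mul (by rw [one_mul]; exact le_self_add)
  have hwm : ∀ η x, (Q.exitRate η + a) * (w η * x) = Q.exitRate η * x := fun η x => by
    rw [← mul_assoc, hw, ENNReal.mul_div_cancel (hl η) (hl' η)]
  have hT := Q.isKernelOp_traceOp S
  -- Summing the resolvent equation over A and cancelling the jumps inside A is not allowed, as Σ μ
  -- λ may be infinite. Instead both 1 and F on A are written as potentials of the damped trace
  -- operator M killed outside A, and the symmetry of the potential operator is used.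
  set M : (E → ℝ≥0∞) → E → ℝ≥0∞ := fun f => A.indicator fun η => w η * Q.traceOp S (A.indicator f) η
    with hM
  have hMk : IsKernelOp M :=
    (IsKernelOp.indicator A).comp ((IsKernelOp.diag w).comp (hT.comp (IsKernelOp.indicator A)))
  -- the killed trace operator has no bounded excessive fixed points
  have hzero : ∀ d : E → ℝ≥0∞, (∀ η, d η ≤ 1) → (∀ η ∉ A, d η = 0) → (∀ η, d η ≤ M d η) →
      ∀ η, d η = 0 := by
    intro d hd1 hdA hd
    obtain ⟨b, hb⟩ := hB
    have hdA' : A.indicator d = d := by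
      ext η; by_cases h : η ∈ A <;> simp [h, hdA]
    have h1 : ∀ η, Q.harmExt S d η ≤ 1 := fun η =>
      ((Q.isKernelOp_harmExt S).mono hd1 η).trans
        (harmExt_le (F := fun _ => 1) (fun η _ => (jumpOp_const 1 η).le) η)
    have h2 : ∀ η, Q.harmExt S d η ≤ Q.jumpOp (Q.harmExt S d) η := by
      intro η
      by_cases hηS : η ∈ S
      · rw [harmExt_of_mem _ hηS]
        by_cases hηA : η ∈ A
        · refine (hd η).trans ?_
          rw [hM]
          simp only [indicator_of_mem hηA, hdA']
          exact (mul_le_mul_left (hw1 η) _).trans_eq (one_mul _)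
        · rw [hdA η hηA]; exact zero_le
      · exact (harmExt_of_notMem d hηS).le
    have h3 := hL _ h1 h2
    intro η
    by_cases hηA : η ∈ A
    · rw [← harmExt_of_mem (Q := Q) d (hSA hηA), h3 η b, harmExt_of_mem d (hSB hb),
        hdA b (disjoint_right.1 hAB hb)]
    · exact hdA η hηA
  have hgreen : ∀ h X : E → ℝ≥0∞, (∀ η, X η ≤ 1) → (∀ η ∉ A, X η = 0) →
      (∀ η, X η = h η + M X η) → ∀ η, green M h η = X η := by
    intro h X hX1 hXA hX η
    refine le_antisymm (green_le hMk (fun η => (hX η).ge) η) ?_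
    rw [← tsub_eq_zero_iff_le]
    refine hzero (fun η => X η - green M h η) (fun η => tsub_le_self.trans (hX1 η))
      (fun η hη => by simp [hXA η hη]) (fun η => ?_) η
    rw [tsub_le_iff_left]
    calc X η = h η + M X η := hX η
      _ ≤ h η + M (fun ξ => green M h ξ + (X ξ - green M h ξ)) η := by
          gcongr; exact hMk.mono (fun ξ => le_add_tsub) η
      _ = green M h η + M (fun ξ => X ξ - green M h ξ) η := by
          rw [hMk.map_add, ← add_assoc, ← green_eq hMk]
  have hsplit : ∀ F : E → ℝ≥0∞, ∀ η, Q.traceOp S F η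
      = Q.traceOp S (A.indicator F) η + Q.traceOp S (B.indicator F) η := by
    intro F η
    rw [← hT.map_add]
    refine congrFun (traceOp_congr fun ξ hξ => ?_) η
    rw [hS] at hξ
    rcases hξ with h | h
    · simp [h, disjoint_left.1 hAB h]
    · simp [h, disjoint_right.1 hAB h]
  set c : E → ℝ≥0∞ := A.indicator fun η => a / (Q.exitRate η + a)
    + w η * Q.traceOp S (B.indicator 1) η with hc
  set b : E → ℝ≥0∞ := A.indicator fun η => w η * Q.traceOp S (B.indicator F) η with hb
  have hMA : ∀ f : E → ℝ≥0∞, M (A.indicator f) = M f := fun f => by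
    simp only [hM, indicator_indicator, inter_self]
  have hGc : ∀ η, green M c η = A.indicator 1 η := by
    refine hgreen c (A.indicator 1) (fun η => indicator_le_self' (by simp) η) (by simp) ?_
    intro η
    by_cases hη : η ∈ A
    · rw [hMA, indicator_of_mem hη, hc, hM]
      simp only [indicator_of_mem hη, Pi.one_apply]
      rw [add_assoc, ← mul_add, add_comm (Q.traceOp S _ η), ← hsplit]
      have : Q.traceOp S 1 η = 1 := hL.traceOp_one hSne η
      rw [this, mul_one, hw, ← ENNReal.add_div, add_comm, ENNReal.div_self (hl η) (hl' η)]
    · simp [hc, hM, hη]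
  have hGb : ∀ η, green M b η = A.indicator F η := by
    refine hgreen b (A.indicator F) (fun η => ?_) (fun η hη => by simp [hη]) ?_
    · by_cases h : η ∈ A <;> simp [h, hF1]
    intro η
    by_cases hη : η ∈ A
    · rw [hMA, indicator_of_mem hη, hb, hM]
      simp only [indicator_of_mem hη]
      rw [← mul_add, add_comm (Q.traceOp S _ η), ← hsplit, hL.traceOp_eq hSne hF1 hFS]
      exact hFA η hη
    · simp [hb, hM, hη]
  have hsymm : IsReversibleOp (fun η => μ {η} * (Q.exitRate η + a)) M := by
    intro f g
    have h1 : ∀ f g : E → ℝ≥0∞, ∑' η, μ {η} * (Q.exitRate η + a) * (f η * M g η)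
        = ∑' η, μ {η} * Q.exitRate η *
          (A.indicator f η * S.indicator (Q.traceOp S (A.indicator g)) η) := by
      intro f g
      refine tsum_congr fun η => ?_
      by_cases hη : η ∈ A
      · rw [hM]
        simp only [indicator_of_mem hη, indicator_of_mem (hSA hη)]
        calc _ = μ {η} * (f η * ((Q.exitRate η + a) * (w η * Q.traceOp S (A.indicator g) η))) := by
              ring
          _ = _ := by rw [hwm]; ring
      · simp [hM, hη]
    have h2 : ∀ η, μ {η} * (Q.exitRate η + a) * (M f η * g η)
        = μ {η} * (Q.exitRate η + a) * (g η * M f η) := fun η => by ring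
    simp only [h2]
    rw [h1, h1, isReversibleOp_traceOp hrev hpos S]
    exact tsum_congr fun η => by ring
  -- With `green M c = 1_A` and `green M b = 1_A F`, symmetry with weights μ (λ + a) turns Σ c F
  -- into Σ b; the weights cancel the denominators of c and b.
  have hfinal := hsymm.green c b
  simp only [hGc, hGb] at hfinal
  calc ∑' η, A.indicator (fun η => μ {η} *
        ((a + Q.exitRate η * Q.traceOp S (B.indicator 1) η) * F η)) η
      = ∑' η, μ {η} * (Q.exitRate η + a) * (c η * A.indicator F η) := by
        refine tsum_congr fun η => ?_
        by_cases hη : η ∈ A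
        · rw [hc]
          simp only [indicator_of_mem hη]
          rw [mul_assoc, ← mul_assoc (Q.exitRate η + a), mul_add (Q.exitRate η + a), hwm,
            ENNReal.mul_div_cancel (hl η) (hl' η)]
        · simp [hη]
    _ = _ := by
        rw [hfinal]
        refine tsum_congr fun η => ?_
        by_cases hη : η ∈ A
        · rw [hb]
          simp only [indicator_of_mem hη, Pi.one_apply, one_mul]
          rw [mul_assoc, hwm]
        · simp [hη]

end RateMatrix

/-! ### Occupation times and traces of jump paths -/

namespace RateMatrix

variable {E : Type*} (Q : RateMatrix E)

/-- Paths with positive and finite holding times, which do not explode. -/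
structure RegularPath (ω : (ℕ → E) × (ℕ → ℝ)) : Prop where
  pos : ∀ n, 0 < Q.holdingTime ω n
  ne_top : ∀ n, Q.holdingTime ω n ≠ ∞
  tsum_eq : ∑' n, Q.holdingTime ω n = ∞

/-- The time spent in `A` before the `n`-th jump. -/
def traceTime (A : Set E) (ω : (ℕ → E) × (ℕ → ℝ)) (n : ℕ) : ℝ≥0∞ :=
  ∑ i ∈ Finset.range n, A.indicator (fun _ => Q.holdingTime ω i) (ω.1 i)

theorem traceTime_succ (A : Set E) (ω : (ℕ → E) × (ℕ → ℝ)) (n : ℕ) :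
    Q.traceTime A ω (n + 1)
      = Q.traceTime A ω n + A.indicator (fun _ => Q.holdingTime ω n) (ω.1 n) :=
  Finset.sum_range_succ _ _

theorem traceTime_zero (A : Set E) (ω : (ℕ → E) × (ℕ → ℝ)) : Q.traceTime A ω 0 = 0 := rfl

theorem monotone_traceTime (A : Set E) (ω : (ℕ → E) × (ℕ → ℝ)) : Monotone (Q.traceTime A ω) :=
  monotone_nat_of_le_succ fun n => by rw [traceTime_succ]; exact le_self_add

variable {Q} {ω : (ℕ → E) × (ℕ → ℝ)}

theorem occupationTime_mono (A : Set E) (e : ℝ≥0 → E) : Monotone (occupationTime A e) :=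
  fun _ _ h => lintegral_mono_set (Icc_subset_Icc_right (NNReal.coe_le_coe.2 h))

namespace RegularPath

theorem jumpTime_ne_top (h : Q.RegularPath ω) (n : ℕ) : Q.jumpTime ω n ≠ ∞ :=
  (ENNReal.sum_lt_top.2 fun i _ => (h.ne_top i).lt_top).ne

theorem traceTime_ne_top (h : Q.RegularPath ω) (A : Set E) (n : ℕ) : Q.traceTime A ω n ≠ ∞ := by
  refine ne_top_of_le_ne_top (h.jumpTime_ne_top n) (Finset.sum_le_sum fun i _ => ?_)
  exact indicator_le_self' (by simp) _

theorem process_of_mem_Ico (h : Q.RegularPath ω) {n : ℕ} {s : ℝ} (hs : s ∈ Ico (Q.jumpTime ω n).toReal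
    (Q.jumpTime ω (n + 1)).toReal) : Q.process ω s.toNNReal = ω.1 n := by
  refine Q.process_eq ?_ ?_
  · change _ ≤ ENNReal.ofReal s
    rw [ENNReal.le_ofReal_iff_toReal_le (h.jumpTime_ne_top n) (ENNReal.toReal_nonneg.trans hs.1)]
    exact hs.1
  · change ENNReal.ofReal s < _
    rw [ENNReal.ofReal_lt_iff_lt_toReal (ENNReal.toReal_nonneg.trans hs.1)
      (h.jumpTime_ne_top (n + 1))]
    exact hs.2

theorem jumpTime_succ_toReal (h : Q.RegularPath ω) (n : ℕ) : (Q.jumpTime ω (n + 1)).toReal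
    = (Q.jumpTime ω n).toReal + (Q.holdingTime ω n).toReal := by
  rw [jumpTime_succ, ENNReal.toReal_add (h.jumpTime_ne_top n) (h.ne_top n)]

theorem lintegral_Ico (h : Q.RegularPath ω) (A : Set E) {n : ℕ} {r : ℝ}
    (hr : r ≤ (Q.holdingTime ω n).toReal) :
    ∫⁻ s in Ico (Q.jumpTime ω n).toReal ((Q.jumpTime ω n).toReal + r),
      A.indicator (fun _ => (1 : ℝ≥0∞)) (Q.process ω s.toNNReal)
      = A.indicator (fun _ => ENNReal.ofReal r) (ω.1 n) := by
  have h1 : ∀ s ∈ Ico (Q.jumpTime ω n).toReal ((Q.jumpTime ω n).toReal + r),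
      A.indicator (fun _ => (1 : ℝ≥0∞)) (Q.process ω s.toNNReal)
        = A.indicator (fun _ => (1 : ℝ≥0∞)) (ω.1 n) := by
    intro s hs
    rw [h.process_of_mem_Ico ⟨hs.1, hs.2.trans_le ?_⟩]
    rw [h.jumpTime_succ_toReal]; linarith
  rw [setLIntegral_congr_fun measurableSet_Ico h1, setLIntegral_const, Real.volume_Ico]
  by_cases hA : ω.1 n ∈ A <;> simp [hA]

theorem lintegral_Ico_zero (h : Q.RegularPath ω) (A : Set E) (n : ℕ) :
    ∫⁻ s in Ico 0 (Q.jumpTime ω n).toReal,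
      A.indicator (fun _ => (1 : ℝ≥0∞)) (Q.process ω s.toNNReal) = Q.traceTime A ω n := by
  induction n with
  | zero => simp [jumpTime, traceTime]
  | succ n ih =>
    rw [← Ico_union_Ico_eq_Ico ENNReal.toReal_nonneg
      (ENNReal.toReal_mono (h.jumpTime_ne_top (n + 1)) (Q.monotone_jumpTime ω n.le_succ)),
      lintegral_union measurableSet_Ico (Ico_disjoint_Ico_same), ih, traceTime_succ,
      h.jumpTime_succ_toReal, h.lintegral_Ico A le_rfl,
      ENNReal.ofReal_toReal (h.ne_top n)]

theorem occupationTime_eq (h : Q.RegularPath ω) (A : Set E) {n : ℕ} {r : ℝ} (hr0 : 0 ≤ r)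
    (hr : r ≤ (Q.holdingTime ω n).toReal) :
    occupationTime A (Q.process ω) ((Q.jumpTime ω n).toReal + r).toNNReal
      = Q.traceTime A ω n + A.indicator (fun _ => ENNReal.ofReal r) (ω.1 n) := by
  have hnn : 0 ≤ (Q.jumpTime ω n).toReal + r := add_nonneg ENNReal.toReal_nonneg hr0
  rw [occupationTime, Real.coe_toNNReal _ hnn, ← setLIntegral_congr Ico_ae_eq_Icc,
    ← Ico_union_Ico_eq_Ico (b := (Q.jumpTime ω n).toReal) ENNReal.toReal_nonneg (by linarith),
    lintegral_union measurableSet_Ico (Ico_disjoint_Ico_same), h.lintegral_Ico_zero,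
    h.lintegral_Ico A hr]

/-- The clock of the trace runs only while the path is in A, so the n-th holding interval occupies
the interval between consecutive values of `traceTime`. It is nonempty only if the state is in A. -/
theorem tracePath_eq (h : Q.RegularPath ω) {A : Set E} {n : ℕ} {t : ℝ≥0} (h1 : Q.traceTime A ω n ≤ t)
    (h2 : t < Q.traceTime A ω (n + 1)) : tracePath A (Q.process ω) t = some (ω.1 n) := by
  have hA : ω.1 n ∈ A := by
    by_contra hA
    rw [traceTime_succ, indicator_of_notMem hA, add_zero] at h2
    exact absurd (h1.trans_lt h2) (lt_irrefl _)
  rw [traceTime_succ, indicator_of_mem hA] at h2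
  set r : ℝ := t - (Q.traceTime A ω n).toReal with hr
  have hr0 : 0 ≤ r := sub_nonneg.2 (ENNReal.toReal_le_coe_of_le_coe h1)
  have hrt : r < (Q.holdingTime ω n).toReal := by
    have := (ENNReal.toReal_lt_toReal ENNReal.coe_ne_top
      (ENNReal.add_ne_top.2 ⟨h.traceTime_ne_top A n, h.ne_top n⟩)).2 h2
    rw [ENNReal.toReal_add (h.traceTime_ne_top A n) (h.ne_top n), ENNReal.coe_toReal] at this
    linarith
  set σ := (Q.jumpTime ω n).toReal with hσ
  have hσ0 : 0 ≤ σ := ENNReal.toReal_nonneg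
  have hocc : ∀ r' : ℝ, 0 ≤ r' → r' ≤ (Q.holdingTime ω n).toReal →
      occupationTime A (Q.process ω) (σ + r').toNNReal = Q.traceTime A ω n + ENNReal.ofReal r' := by
    intro r' h3 h4
    rw [h.occupationTime_eq A h3 h4, indicator_of_mem hA]
  have hinv : inverseOccupationTime A (Q.process ω) t = ((σ + r).toNNReal : ℝ≥0∞) := by
    refine le_antisymm (iSup₂_le fun s hs => ?_) ?_
    · by_contra hlt
      rw [not_le, ENNReal.coe_lt_coe, Real.toNNReal_lt_iff_lt_coe (by positivity)] at hlt
      -- A time s beyond σ + r is lowered to a point of the same holding interval which is still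
      -- beyond σ + r; there the clock already exceeds t.
      set r' : ℝ := min (s - σ) (Q.holdingTime ω n).toReal with hr'
      have hrr' : r < r' := lt_min (by linarith) hrt
      have h5 : (σ + r').toNNReal ≤ s := by
        rw [Real.toNNReal_le_iff_le_coe]
        linarith [min_le_left (s - σ) (Q.holdingTime ω n).toReal]
      have h6 := (occupationTime_mono A (Q.process ω) h5).trans hs
      rw [hocc r' (hr0.trans hrr'.le) (min_le_right _ _)] at h6
      have h7 := ENNReal.toReal_mono ENNReal.coe_ne_top h6
      rw [ENNReal.toReal_add (h.traceTime_ne_top A n) ENNReal.ofReal_ne_top,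
        ENNReal.toReal_ofReal (hr0.trans hrr'.le), ENNReal.coe_toReal] at h7
      linarith
    · refine le_iSup₂_of_le (σ + r).toNNReal ?_ le_rfl
      rw [hocc r hr0 hrt.le, ← ENNReal.ofReal_toReal (h.traceTime_ne_top A n),
        ← ENNReal.ofReal_add ENNReal.toReal_nonneg hr0, ← ENNReal.ofReal_coe_nnreal]
      exact ENNReal.ofReal_le_ofReal (by linarith)
  rw [tracePath, hinv, if_pos ENNReal.coe_lt_top, ENNReal.toNNReal_coe,
    h.process_of_mem_Ico ⟨by linarith, by rw [h.jumpTime_succ_toReal]; linarith⟩]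

theorem hitTime_lt_hitTime (h : Q.RegularPath ω) {ξ : E} {B : Set E} {n : ℕ} (hn : ω.1 n = ξ)
    (hB : ∀ k ≤ n, ω.1 k ∉ B) :
    hitTime {ξ} (Q.process ω) < hitTime B (Q.process ω) := by
  set x := (Q.jumpTime ω n).toReal with hx
  set y := (Q.jumpTime ω (n + 1)).toReal with hy
  have hx0 : 0 ≤ x := ENNReal.toReal_nonneg
  have hxy : x < y := by
    rw [hy, h.jumpTime_succ_toReal]
    linarith [ENNReal.toReal_pos (h.pos n).ne' (h.ne_top n)]
  -- Hitting times only count positive times, so the midpoint of the n-th holding interval is used;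
  -- its left end is 0 when n = 0.
  have h1 : hitTime {ξ} (Q.process ω) ≤ (((x + y) / 2).toNNReal : ℝ≥0∞) := by
    refine iInf₂_le _ ⟨?_, ?_⟩
    · rw [Real.toNNReal_pos]; linarith
    · rw [mem_singleton_iff, h.process_of_mem_Ico (n := n) ⟨by linarith, by linarith⟩, hn]
  have h2 : ENNReal.ofReal y ≤ hitTime B (Q.process ω) := by
    refine le_iInf₂ fun s hs => ?_
    obtain ⟨k, hk1, hk2⟩ := Q.exists_jumpTime_le h.tsum_eq s
    have hkB : ω.1 k ∈ B := by
      have := hs.2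
      rwa [Q.process_eq hk1 hk2] at this
    have hkn : n + 1 ≤ k := by
      by_contra hlt
      exact hB k (by omega) hkB
    rw [hy, ENNReal.ofReal_toReal (h.jumpTime_ne_top _)]
    exact (Q.monotone_jumpTime ω hkn).trans hk1
  refine h1.trans_lt (lt_of_lt_of_le ?_ h2)
  exact (ENNReal.ofReal_lt_ofReal_iff (by linarith)).2 (by linarith)

end RegularPath

theorem measurable_fst_apply [MeasurableSpace E] (n : ℕ) :
    Measurable fun ω : (ℕ → E) × (ℕ → ℝ) => ω.1 n := by
  fun_prop

/-- The event that the jump chain reaches `ξ` before `B`. -/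
def hitsBefore (ξ : E) (B : Set E) : Set ((ℕ → E) × (ℕ → ℝ)) :=
  {ω | ∃ n, ω.1 n = ξ ∧ ∀ k ≤ n, ω.1 k ∉ B}

theorem measurableSet_hitsBefore [MeasurableSpace E] [DiscreteMeasurableSpace E] (ξ : E) (B : Set E) : MeasurableSet (hitsBefore ξ B) := by
  have : hitsBefore ξ B = ⋃ n, ((fun ω : (ℕ → E) × (ℕ → ℝ) => ω.1 n) ⁻¹' {ξ} ∩
      ⋂ k ∈ Iic n, (fun ω : (ℕ → E) × (ℕ → ℝ) => ω.1 k) ⁻¹' Bᶜ) := by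
    ext ω; simp [hitsBefore]
  rw [this]
  refine MeasurableSet.iUnion fun n => MeasurableSet.inter
    (measurable_fst_apply n MeasurableSet.of_discrete)
    (MeasurableSet.biInter (to_countable _) fun k _ =>
      measurable_fst_apply k MeasurableSet.of_discrete)

variable [Countable E] [MeasurableSpace E] [DiscreteMeasurableSpace E]

theorem NoExplosion.ae_regularPath (hexp : Q.NoExplosion) (hpos : ∀ η, 0 < Q.holdingRate η)
    (η : E) : ∀ᵐ ω ∂Q.law η, Q.RegularPath ω := by
  filter_upwards [hexp η, Q.ae_law_snd_pos η] with ω h1 h2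
  exact ⟨fun n => Q.holdingTime_pos (h2 n), fun n => Q.holdingTime_ne_top (hpos _), h1⟩

/-- Lower bound for the probability of reaching `ξ` before `B`. -/
theorem Liouville.one_le_hitsBefore_add (hL : Q.Liouville) {ξ : E} {B : Set E} (hξ : ξ ∉ B)
    {v : E → ℝ≥0∞} (hvB : ∀ η ∈ B, v η = 1) (hv : ∀ η ∉ B, η ≠ ξ → v η = Q.jumpOp v η) (η : E) :
    1 ≤ Q.law η (hitsBefore ξ B) + v η := by
  refine hL.le_of_subsolution (f := fun _ => 1) (g := fun η => Q.law η (hitsBefore ξ B) + v η)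
    (w := fun _ => 1) (b := fun _ => 0) (insert ξ B) (fun _ => le_rfl) (fun _ => le_rfl) ?_ ?_ ?_
    (Or.inl ⟨ξ, mem_insert _ _⟩) η
  · rintro ζ (rfl | hζ)
    · have : Q.law ζ (hitsBefore ζ B) = 1 := by
        have h1 : hitsBefore ζ B =ᵐ[Q.law ζ] univ := by
          filter_upwards [Q.law_zero ζ] with ω h0
          rw [eq_iff_iff]
          refine ⟨fun _ => trivial, fun _ => ⟨0, h0, fun k hk => ?_⟩⟩
          rw [Nat.le_zero.1 hk, h0]; exact hξ
        rw [measure_congr h1, measure_univ]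
      rw [this]; exact le_self_add
    · rw [hvB ζ hζ]; exact le_add_self
  · intro ζ _
    rw [jumpOp_const]; simp
  · intro ζ hζ
    have h1 : ζ ≠ ξ := fun h => hζ (by rw [h]; exact mem_insert _ _)
    have h2 : ζ ∉ B := fun h => hζ (mem_insert_of_mem _ h)
    rw [one_mul, add_zero, jumpOp_add, ← hv ζ h2 h1,
      ← Q.law_comp_shift ζ (measurableSet_hitsBefore ξ B)]
    refine le_of_eq ?_
    congr 1
    refine measure_congr ?_
    filter_upwards [Q.law_zero ζ] with ω h0
    rw [eq_iff_iff]
    change (∃ n, ω.1 (n + 1) = ξ ∧ ∀ k ≤ n, ω.1 (k + 1) ∉ B) ↔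
      ∃ n, ω.1 n = ξ ∧ ∀ k ≤ n, ω.1 k ∉ B
    constructor
    · rintro ⟨n, hn, hk⟩
      refine ⟨n + 1, hn, ?_⟩
      rintro (_ | k) hk'
      · rw [h0]; exact h2
      · exact hk k (by omega)
    · rintro ⟨_ | n, hn, hk⟩
      · exact absurd (h0.symm.trans hn) h1
      · exact ⟨n, hn, fun k hk' => hk (k + 1) (by omega)⟩

end RateMatrix

/-! ### The jump rates of the trace process -/

/-- The event that the jump chain enters `S` at a point of `C`. -/
def entersIn {E : Type*} (S C : Set E) : Set ((ℕ → E) × (ℕ → ℝ)) :=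
  {ω | ∃ n, ω.1 n ∈ C ∧ ∀ k < n, ω.1 k ∉ S}

theorem measurableSet_entersIn {E : Type*} [MeasurableSpace E] [DiscreteMeasurableSpace E]
    (S C : Set E) : MeasurableSet (entersIn S C) := by
  have : entersIn S C = ⋃ n, ((fun ω : (ℕ → E) × (ℕ → ℝ) => ω.1 n) ⁻¹' C ∩
      ⋂ k ∈ Iio n, (fun ω : (ℕ → E) × (ℕ → ℝ) => ω.1 k) ⁻¹' Sᶜ) := by
    ext ω; simp [entersIn]
  rw [this]
  refine MeasurableSet.iUnion fun n => MeasurableSet.inter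
    (RateMatrix.measurable_fst_apply n MeasurableSet.of_discrete)
    (MeasurableSet.biInter (to_countable _) fun k _ =>
      RateMatrix.measurable_fst_apply k MeasurableSet.of_discrete)

theorem shift_mem_entersIn {E : Type*} {S C : Set E} {ω : (ℕ → E) × (ℕ → ℝ)}
    (hC : ω.1 0 ∉ C) (hS : ω.1 0 ∉ S) : shift ω ∈ entersIn S C ↔ ω ∈ entersIn S C := by
  change (∃ n, ω.1 (n + 1) ∈ C ∧ ∀ k < n, ω.1 (k + 1) ∉ S) ↔ ∃ n, ω.1 n ∈ C ∧ ∀ k < n, ω.1 k ∉ S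
  constructor
  · rintro ⟨n, hn, hk⟩
    refine ⟨n + 1, hn, ?_⟩
    rintro (_ | k) hk'
    · exact hS
    · exact hk k (by omega)
  · rintro ⟨_ | n, hn, hk⟩
    · exact absurd hn hC
    · exact ⟨n, hn, fun k hk' => hk (k + 1) (by omega)⟩

namespace RateMatrix

variable {E : Type*} (Q : RateMatrix E)

/-- The event that the jump chain enters `S` at a point where it stays for a time at most `t`. -/
def fastEntry (S : Set E) (t : ℝ≥0∞) : Set ((ℕ → E) × (ℕ → ℝ)) :=
  {ω | ∃ n, (ω.1 n ∈ S ∧ ∀ k < n, ω.1 k ∉ S) ∧ Q.holdingTime ω n ≤ t}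

theorem measurableSet_fastEntry [MeasurableSpace E] [DiscreteMeasurableSpace E]
    (S : Set E) (t : ℝ≥0∞) : MeasurableSet (Q.fastEntry S t) := by
  have : Q.fastEntry S t = ⋃ n, (((fun ω : (ℕ → E) × (ℕ → ℝ) => ω.1 n) ⁻¹' S ∩
      ⋂ k ∈ Iio n, (fun ω : (ℕ → E) × (ℕ → ℝ) => ω.1 k) ⁻¹' Sᶜ) ∩
        {ω | Q.holdingTime ω n ≤ t}) := by
    ext ω; simp [fastEntry]
  rw [this]
  refine MeasurableSet.iUnion fun n => MeasurableSet.inter (MeasurableSet.inter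
    (measurable_fst_apply n MeasurableSet.of_discrete)
    (MeasurableSet.biInter (to_countable _) fun k _ =>
      measurable_fst_apply k MeasurableSet.of_discrete))
    (measurableSet_le (Q.measurable_holdingTime n) measurable_const)

-- The clock of the trace stands still during the excursion outside S. At time t it is therefore
-- past the first holding time and still within the holding time at the entry point.
variable {Q} in
theorem RegularPath.tracePath_of_entry {ω : (ℕ → E) × (ℕ → ℝ)} (h : Q.RegularPath ω) {S : Set E}
    (h0 : ω.1 0 ∈ S) {t : ℝ≥0} (ht : Q.holdingTime ω 0 ≤ t) {n : ℕ} (hn : (shift ω).1 n ∈ S)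
    (hk : ∀ k < n, (shift ω).1 k ∉ S) (hT : t < Q.holdingTime (shift ω) n) :
    tracePath S (Q.process ω) t = some ((shift ω).1 n) := by
  have h1 : ∀ k ≤ n, Q.traceTime S ω (k + 1) = Q.holdingTime ω 0 := by
    intro k
    induction k with
    | zero => intro _; simp [traceTime_succ, traceTime_zero, h0]
    | succ k ih =>
      intro hk'
      rw [traceTime_succ, ih (by omega),
        indicator_of_notMem (show ω.1 (k + 1) ∉ S from hk k (by omega)), add_zero]
  refine h.tracePath_eq (n := n + 1) ((h1 n le_rfl).trans_le ht) ?_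
  rw [traceTime_succ, indicator_of_mem (show ω.1 (n + 1) ∈ S from hn), ← Q.holdingTime_shift]
  exact hT.trans_le le_add_self

variable [Countable E] [MeasurableSpace E] [DiscreteMeasurableSpace E]
variable {Q}

/-- As a function of the starting point, the entrance probability is harmonic off S with boundary
values 1_C, so `Liouville.harmExt_eq` identifies it. -/
theorem Liouville.law_entersIn (hL : Q.Liouville) {S C : Set E} (hS : S.Nonempty) (hC : C ⊆ S)
    (η : E) : Q.law η (entersIn S C) = Q.harmExt S (C.indicator 1) η := by
  have hS' : ∀ ζ ∈ S, Q.law ζ (entersIn S C) = C.indicator 1 ζ := by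
    intro ζ hζ
    by_cases hζC : ζ ∈ C
    · rw [indicator_of_mem hζC, Pi.one_apply, prob_compl_eq_zero_iff
        (measurableSet_entersIn S C) |>.1]
      change ∀ᵐ ω ∂Q.law ζ, ω ∈ entersIn S C
      filter_upwards [Q.law_zero ζ] with ω h0
      exact ⟨0, by rwa [h0], fun k hk => absurd hk (by omega)⟩
    · rw [indicator_of_notMem hζC, measure_eq_zero_iff_ae_notMem]
      filter_upwards [Q.law_zero ζ] with ω h0
      rintro ⟨n, hn, hk⟩
      rcases Nat.eq_zero_or_pos n with rfl | hn'
      · exact hζC (by rwa [← h0])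
      · exact hk 0 hn' (by rwa [h0])
  rw [Q.harmExt_congr (f := C.indicator 1) (g := fun ζ => Q.law ζ (entersIn S C))
    (fun ζ hζ => (hS' ζ hζ).symm), hL.harmExt_eq hS (fun _ => prob_le_one)]
  intro ζ hζ
  rw [← Q.law_comp_shift ζ (measurableSet_entersIn S C)]
  refine measure_congr ?_
  filter_upwards [Q.law_zero ζ] with ω h0
  rw [eq_iff_iff]
  exact (shift_mem_entersIn (by rw [h0]; exact fun h => hζ (hC h)) (by rwa [h0])).symm

theorem Liouville.jumpOp_law_entersIn (hL : Q.Liouville) {S C : Set E} (hS : S.Nonempty)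
    (hC : C ⊆ S) (η : E) :
    Q.jumpOp (fun ζ => Q.law ζ (entersIn S C)) η = Q.traceOp S (C.indicator 1) η := by
  rw [traceOp]
  congr 1
  exact funext fun ζ => hL.law_entersIn hS hC ζ

theorem law_holdingTime_inter_shift (hpos : ∀ η, 0 < Q.holdingRate η) (η : E) (t : ℝ≥0)
    {A : Set ((ℕ → E) × (ℕ → ℝ))} (hA : MeasurableSet A) :
    Q.law η ({ω | Q.holdingTime ω 0 ≤ t} ∩ shift ⁻¹' A)
      = ENNReal.ofReal (1 - Real.exp (-(Q.holdingRate η * t))) *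
        Q.jumpOp (fun ξ => Q.law ξ A) η := by
  have hm : MeasurableSet (Iic (Q.holdingRate η * t)) := measurableSet_Iic
  have h1 := Q.lintegral_law_mul_shift η (f := (Iic (Q.holdingRate η * t)).indicator 1)
    (measurable_one.indicator hm) (G := A.indicator 1) (measurable_one.indicator hA)
  simp only [lintegral_indicator_one hA, lintegral_indicator_one hm] at h1
  have h2 : expMeasure 1 (Iic (Q.holdingRate η * t))
      = ENNReal.ofReal (1 - Real.exp (-(Q.holdingRate η * t))) := by
    have := cdf_expMeasure_eq (r := 1) one_pos (Q.holdingRate η * t)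
    rw [cdf_eq_real, if_pos (mul_nonneg (hpos η).le t.coe_nonneg), one_mul] at this
    rw [← this, ofReal_measureReal]
  rw [← h2, ← h1, ← lintegral_indicator_one₀]
  · refine lintegral_congr_ae ?_
    filter_upwards [Q.law_zero η, Q.ae_law_snd_pos η] with ω h0 hp
    have h3 : Q.holdingTime ω 0 ≤ t ↔ ω.2 0 ∈ Iic (Q.holdingRate η * t) := by
      rw [holdingTime, h0, ENNReal.div_le_iff (by simpa using hpos η) ENNReal.ofReal_ne_top,
        mem_Iic, ← ENNReal.ofReal_coe_nnreal, ← ENNReal.ofReal_mul t.coe_nonneg,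
        ENNReal.ofReal_le_ofReal_iff (mul_nonneg t.coe_nonneg (hpos η).le), mul_comm]
    by_cases h4 : ω.2 0 ∈ Iic (Q.holdingRate η * t) <;> by_cases h5 : shift ω ∈ A <;>
      simp [h3, h4, h5, -mem_Iic]
  · exact ((measurableSet_le (Q.measurable_holdingTime 0) measurable_const).inter
      (measurable_shift hA)).nullMeasurableSet

/-- The events decrease with t. The first index of entry into S is unique and its holding time is
almost surely positive, so their intersection is null. -/
theorem tendsto_law_shift_fastEntry (S : Set E) (η : E) :
    Tendsto (fun t : ℝ≥0 => Q.jumpOp (fun ξ => Q.law ξ (Q.fastEntry S t)) η) (𝓝[>] 0) (𝓝 0) := by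
  have hmono : ∀ s t : ℝ≥0, s ≤ t → shift ⁻¹' Q.fastEntry S s ⊆ shift ⁻¹' Q.fastEntry S t :=
    fun s t hst ω ⟨n, hn, hT⟩ => ⟨n, hn, hT.trans (by exact_mod_cast hst)⟩
  have h1 := tendsto_measure_biInter_gt (μ := Q.law η) (a := (0 : ℝ≥0))
    (s := fun t : ℝ≥0 => shift ⁻¹' Q.fastEntry S t)
    (fun t _ => (measurable_shift (Q.measurableSet_fastEntry S t)).nullMeasurableSet)
    (fun s t _ hst => hmono s t hst) ⟨1, one_pos, measure_ne_top _ _⟩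
  have h2 : Q.law η (⋂ t > (0 : ℝ≥0), shift ⁻¹' Q.fastEntry S t) = 0 := by
    refine measure_mono_null (t := {ω | ¬ ∀ n, 0 < ω.2 n}) (fun ω hω hp => ?_)
      (Q.ae_law_snd_pos η)
    simp only [mem_iInter] at hω
    obtain ⟨n, hn, -⟩ := hω 1 one_pos
    have hT : 0 < Q.holdingTime (shift ω) n := by
      rw [holdingTime_shift]; exact Q.holdingTime_pos (hp _)
    obtain ⟨t, ht0, ht⟩ := ENNReal.lt_iff_exists_nnreal_btwn.1 hT
    obtain ⟨m, hm, hm'⟩ := hω t (by exact_mod_cast ht0)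
    have : m = n := by
      rcases lt_trichotomy m n with h | h | h
      · exact absurd hm.1 (hn.2 m h)
      · exact h
      · exact absurd hn.1 (hm.2 n h)
    subst this
    exact absurd (ht.trans_le hm') (lt_irrefl _)
  rw [h2] at h1
  refine h1.congr fun t => ?_
  exact Q.law_comp_shift η (Q.measurableSet_fastEntry S t)

theorem tendsto_one_sub_exp_div {l : ℝ} :
    Tendsto (fun t : ℝ≥0 => ENNReal.ofReal (1 - Real.exp (-(l * t))) / (t : ℝ≥0∞)) (𝓝[>] 0)
      (𝓝 (ENNReal.ofReal l)) := by
  have h1 : HasDerivAt (fun t : ℝ => 1 - Real.exp (-(l * t))) l 0 := by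
    have h := (((hasDerivAt_id (0 : ℝ)).const_mul l).neg.exp).const_sub 1
    simpa using h
  have h2 := h1.tendsto_slope_zero_right
  have h3 : Tendsto (fun t : ℝ≥0 => (t : ℝ)) (𝓝[>] 0) (𝓝[>] 0) := by
    refine tendsto_nhdsWithin_iff.2 ⟨?_, ?_⟩
    · exact (NNReal.continuous_coe.tendsto 0).mono_left nhdsWithin_le_nhds
    · filter_upwards [self_mem_nhdsWithin] with t ht
      exact_mod_cast ht
  have h4 := ENNReal.tendsto_ofReal (h2.comp h3)
  refine h4.congr' ?_
  filter_upwards [self_mem_nhdsWithin] with t ht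
  have ht' : (0 : ℝ) < t := by exact_mod_cast ht
  simp only [Function.comp_apply, zero_add, mul_zero, neg_zero, Real.exp_zero, sub_self, sub_zero,
    smul_eq_mul]
  rw [inv_mul_eq_div, ENNReal.ofReal_div_of_pos ht', ENNReal.ofReal_coe_nnreal]

/-- Up to an error p(t) F(t), the trace is at ξ at time t exactly when the first holding time is at
most t, which has probability p(t), and the chain then enters S at ξ, which independently has
probability q. As t tends to 0, p(t) / t tends to the exit rate and F(t) to 0. An excursion which
returns to η counts in the trace operator but yields no jump to ξ. -/
theorem traceRate_eq (hL : Q.Liouville) (hexp : Q.NoExplosion) (hpos : ∀ η, 0 < Q.holdingRate η)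
    (hhit : ∀ ζ η, ∀ᵐ ω ∂Q.law ζ, ∃ n, ω.1 n = η) {S : Set E} {η ξ : E} (hη : η ∈ S) (hξ : ξ ∈ S)
    (hne : η ≠ ξ) :
    Q.traceRate S η ξ = Q.exitRate η * Q.traceOp S (({ξ} : Set E).indicator 1) η := by
  have hS : S.Nonempty := ⟨η, hη⟩
  set q := Q.traceOp S (({ξ} : Set E).indicator 1) η with hq
  set p : ℝ≥0 → ℝ≥0∞ := fun t => ENNReal.ofReal (1 - Real.exp (-(Q.holdingRate η * t))) with hp
  set F : ℝ≥0 → ℝ≥0∞ := fun t => Q.jumpOp (fun ξ => Q.law ξ (Q.fastEntry S t)) η with hF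
  have hqe : Q.jumpOp (fun ζ => Q.law ζ (entersIn S {ξ})) η = q :=
    hL.jumpOp_law_entersIn hS (singleton_subset_iff.2 hξ) η
  have hq1 : q ≤ 1 := hqe ▸ jumpOp_le_one (fun _ => prob_le_one) η
  have hup : ∀ t : ℝ≥0, Q.law η {ω | tracePath S (Q.process ω) t = some ξ} ≤ p t * (q + F t) := by
    intro t
    have h1 : Q.law η {ω | tracePath S (Q.process ω) t = some ξ} ≤
        Q.law η ({ω | Q.holdingTime ω 0 ≤ t} ∩
          shift ⁻¹' (entersIn S {ξ} ∪ Q.fastEntry S t)) := by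
      refine measure_mono_ae ?_
      filter_upwards [hexp.ae_regularPath hpos η, Q.law_zero η,
        Q.ae_law_shift (fun ζ => hhit ζ η) η] with ω hr h0 hh htr
      -- Otherwise the trace would still be at η ≠ ξ at time t.
      have hT : Q.holdingTime ω 0 ≤ t := by
        by_contra hlt
        rw [not_le] at hlt
        have := hr.tracePath_eq (A := S) (n := 0) (t := t) (by simp [traceTime_zero])
          (by simpa [traceTime_succ, traceTime_zero, h0, hη] using hlt)
        rw [h0] at this
        exact hne (Option.some.inj (this.symm.trans htr))
      refine ⟨hT, ?_⟩
      classical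
      have hex : ∃ n, (shift ω).1 n ∈ S := hh.imp fun n hn => by rwa [hn]
      have hn := Nat.find_spec hex
      have hk : ∀ k < Nat.find hex, (shift ω).1 k ∉ S := fun k hk => Nat.find_min hex hk
      by_cases hfast : Q.holdingTime (shift ω) (Nat.find hex) ≤ t
      · exact Or.inr ⟨_, ⟨hn, hk⟩, hfast⟩
      · refine Or.inl ⟨Nat.find hex, ?_, hk⟩
        have := hr.tracePath_of_entry (by rwa [h0]) hT hn hk (not_le.1 hfast)
        exact Option.some.inj (this.symm.trans htr)
    refine h1.trans ?_
    rw [law_holdingTime_inter_shift hpos η t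
      ((measurableSet_entersIn S {ξ}).union (Q.measurableSet_fastEntry S t)), ← hqe, hF, ← jumpOp_add]
    exact mul_le_mul_right (jumpOp_mono (fun ζ => measure_union_le _ _) η) _
  have hlow : ∀ t : ℝ≥0, p t * q ≤
      Q.law η {ω | tracePath S (Q.process ω) t = some ξ} + p t * F t := by
    intro t
    rw [← hqe, hp, hF]
    simp only
    rw [← law_holdingTime_inter_shift hpos η t (measurableSet_entersIn S {ξ}),
      ← law_holdingTime_inter_shift hpos η t (Q.measurableSet_fastEntry S t)]
    refine le_trans (measure_mono_ae ?_) (measure_union_le _ _)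
    filter_upwards [hexp.ae_regularPath hpos η, Q.law_zero η] with ω hr h0 hω
    obtain ⟨hT, n, hn, hk⟩ := hω
    have hn' : (shift ω).1 n = ξ := hn
    by_cases hfast : Q.holdingTime (shift ω) n ≤ t
    · exact Or.inr ⟨hT, n, ⟨by rwa [hn'], hk⟩, hfast⟩
    · refine Or.inl ?_
      have := hr.tracePath_of_entry (by rwa [h0]) hT (by rwa [hn']) hk (not_le.1 hfast)
      rw [hn'] at this
      exact this
  have hpt : Tendsto (fun t : ℝ≥0 => p t / (t : ℝ≥0∞)) (𝓝[>] 0) (𝓝 (Q.exitRate η)) :=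
    tendsto_one_sub_exp_div
  have hFt : Tendsto F (𝓝[>] 0) (𝓝 0) := tendsto_law_shift_fastEntry S η
  have hqt : q ≠ ∞ := ne_top_of_le_ne_top ENNReal.one_ne_top hq1
  have hlt := Q.exitRate_ne_top η
  refine Tendsto.limUnder_eq ?_
  refine tendsto_of_tendsto_of_tendsto_of_le_of_le
    (g := fun t : ℝ≥0 => p t / (t : ℝ≥0∞) * q - p t / (t : ℝ≥0∞) * F t)
    (h := fun t : ℝ≥0 => p t / (t : ℝ≥0∞) * (q + F t)) ?_ ?_ ?_ ?_
  · have := ENNReal.Tendsto.sub (ENNReal.Tendsto.mul_const hpt (Or.inr hqt))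
      (ENNReal.Tendsto.mul hpt (Or.inr ENNReal.zero_ne_top) hFt (Or.inr hlt))
      (Or.inl (ENNReal.mul_ne_top hlt hqt))
    simpa using this
  · have := ENNReal.Tendsto.mul hpt (Or.inr (by simpa using hqt)) (tendsto_const_nhds.add hFt)
      (Or.inr hlt)
    simpa using this
  · intro t
    simp only
    rw [tsub_le_iff_right]
    calc p t / t * q = p t * q / t := by simp only [div_eq_mul_inv]; ring
      _ ≤ _ := ENNReal.div_le_div_right (hlow t) _
      _ = _ := by simp only [div_eq_mul_inv]; ring
  · intro t
    simp only
    calc _ ≤ p t * (q + F t) / t := ENNReal.div_le_div_right (hup t) _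
      _ = _ := by simp only [div_eq_mul_inv]; ring

theorem meanRate_eq (hL : Q.Liouville) (hexp : Q.NoExplosion) (hpos : ∀ η, 0 < Q.holdingRate η)
    (hhit : ∀ ζ η, ∀ᵐ ω ∂Q.law ζ, ∃ n, ω.1 n = η) (μ : Measure E) {S B C : Set E} (hB : B ⊆ S)
    (hC : C ⊆ S) (hBC : Disjoint B C) :
    Q.meanRate μ S B C
      = (∑' η, B.indicator (fun η => μ {η} * (Q.exitRate η * Q.traceOp S (C.indicator 1) η)) η)
        / μ B := by
  rw [meanRate, ← tsum_subtype B]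
  congr 1
  refine tsum_congr fun η => ?_
  rw [mul_comm]
  congr 1
  have h1 : ∀ ξ : C, Q.traceRate S η ξ
      = Q.exitRate η * Q.traceOp S (({(ξ : E)} : Set E).indicator 1) η := fun ξ =>
    traceRate_eq hL hexp hpos hhit (hB η.2) (hC ξ.2) fun h =>
      disjoint_left.1 hBC η.2 (h ▸ ξ.2)
  simp_rw [h1]
  rw [ENNReal.tsum_mul_left, ← (Q.isKernelOp_traceOp S).map_tsum]
  congr 2
  funext ζ
  classical
  by_cases hζ : ζ ∈ C
  · rw [indicator_of_mem hζ, tsum_eq_single ⟨ζ, hζ⟩]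
    · simp
    · intro ξ hξ
      rw [indicator_of_notMem]
      rintro rfl
      exact hξ rfl
  · rw [indicator_of_notMem hζ, ENNReal.tsum_eq_zero.2]
    intro ξ
    rw [indicator_of_notMem]
    rintro rfl
    exact hζ ξ.2

end RateMatrix

/-! ### Escape probabilities and near-constancy of resolvents on a well -/

namespace RateMatrix

variable {E : Type*} [Countable E] [MeasurableSpace E] [DiscreteMeasurableSpace E]

/-- The standing properties of an irreducible recurrent reversible chain. -/
structure RecurrentReversible (Q : RateMatrix E) (μ : Measure E) : Prop where
  noExplosion : Q.NoExplosion
  irreducible : Q.Irreducible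
  reversible : Q.Reversible μ
  liouville : Q.Liouville
  pos : ∀ η, 0 < Q.holdingRate η
  ae_hit : ∀ ζ η, ∀ᵐ ω ∂Q.law ζ, ∃ n, ω.1 n = η
  measure_ne_zero : ∀ η, μ {η} ≠ 0

theorem PositiveRecurrent.recurrentReversible [Nontrivial E] {Q : RateMatrix E} {μ : Measure E}
    [IsProbabilityMeasure μ] (hrec : Q.PositiveRecurrent) (hexp : Q.NoExplosion)
    (hirr : Q.Irreducible) (hrev : Q.Reversible μ) : Q.RecurrentReversible μ :=
  ⟨hexp, hirr, hrev, hrec.liouville hexp hirr, hirr.holdingRate_pos, hrec.ae_hit hexp hirr,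
    measure_singleton_ne_zero hrev hirr⟩

variable (Q : RateMatrix E)

/-- The probability that the jump chain does not reach `ζ` before `B`. -/
def escapeProb (ζ : E) (B : Set E) (η : E) : ℝ≥0∞ := Q.law η (hitsBefore ζ B)ᶜ

theorem law_hitsBefore_add_escapeProb (ζ : E) (B : Set E) (η : E) :
    Q.law η (hitsBefore ζ B) + Q.escapeProb ζ B η = 1 :=
  prob_add_prob_compl (measurableSet_hitsBefore ζ B)

theorem escapeProb_of_mem {ζ : E} {B : Set E} {η : E} (hη : η ∈ B) : Q.escapeProb ζ B η = 1 := by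
  rw [escapeProb, prob_compl_eq_one_iff (measurableSet_hitsBefore ζ B),
    measure_eq_zero_iff_ae_notMem]
  filter_upwards [Q.law_zero η] with ω h0
  rintro ⟨n, -, hk⟩
  exact hk 0 n.zero_le (by rwa [h0])

theorem escapeProb_self {ζ : E} {B : Set E} (hζ : ζ ∉ B) : Q.escapeProb ζ B ζ = 0 := by
  rw [escapeProb, measure_eq_zero_iff_ae_notMem]
  filter_upwards [Q.law_zero ζ] with ω h0
  rw [notMem_compl_iff]
  refine ⟨0, h0, fun k hk => ?_⟩
  rwa [Nat.le_zero.1 hk, h0]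

theorem escapeProb_eq {ζ : E} {B : Set E} {η : E} (hη : η ∉ B) (hne : η ≠ ζ) :
    Q.escapeProb ζ B η = Q.jumpOp (Q.escapeProb ζ B) η := by
  change _ = Q.jumpOp (fun η => Q.law η (hitsBefore ζ B)ᶜ) η
  rw [← Q.law_comp_shift η (measurableSet_hitsBefore ζ B).compl]
  refine measure_congr ?_
  filter_upwards [Q.law_zero η] with ω h0
  rw [eq_iff_iff]
  refine not_congr ?_
  change (∃ n, ω.1 n = ζ ∧ ∀ k ≤ n, ω.1 k ∉ B) ↔ ∃ n, ω.1 (n + 1) = ζ ∧ ∀ k ≤ n, ω.1 (k + 1) ∉ B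
  constructor
  · rintro ⟨_ | n, hn, hk⟩
    · exact absurd (h0.symm.trans hn) hne
    · exact ⟨n, hn, fun k hk' => hk (k + 1) (by omega)⟩
  · rintro ⟨n, hn, hk⟩
    refine ⟨n + 1, hn, ?_⟩
    rintro (_ | k) hk'
    · rwa [h0]
    · exact hk k (by omega)

variable {Q} {μ : Measure E} [IsFiniteMeasure μ]

theorem RecurrentReversible.escapeProb_mul_capacity_le (h : Q.RecurrentReversible μ) {A B : Set E}
    (hAB : Disjoint A B) {η ζ : E} (hζ : ζ ∈ A) :
    Q.escapeProb ζ B η * Q.capacity μ {η} {ζ} ≤ 3 * Q.capacity μ A B := by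
  by_cases hC : Q.capacity μ A B = ∞
  · rw [hC, ENNReal.mul_top (by norm_num)]; exact le_top
  obtain ⟨v, -, hvB, -, hv, hle⟩ := exists_escape_potential h.reversible h.pos h.measure_ne_zero
    hAB hC (η := η) hζ
  have hζB : ζ ∉ B := disjoint_left.1 hAB hζ
  have h1 := h.liouville.one_le_hitsBefore_add hζB hvB hv η
  rw [← Q.law_hitsBefore_add_escapeProb ζ B η, ENNReal.add_le_add_iff_left (measure_ne_top _ _)] at h1
  exact (mul_le_mul_left h1 _).trans hle

theorem RecurrentReversible.capacity_ne_top (h : Q.RecurrentReversible μ) {η ζ : E} (hne : η ≠ ζ) :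
    Q.capacity μ {η} {ζ} ≠ ∞ := by
  have h1 : Q.capacity μ {η} {ζ} ≤ Q.dirichletForm μ (({η} : Set E).indicator 1) := by
    refine iInf₂_le _ ⟨memLp_two_of_bounded (C := 1) (fun ξ => ?_)
      (measurable_of_countable _).aestronglyMeasurable, ?_, ?_⟩
    · by_cases hξ : ξ ∈ ({η} : Set E) <;> simp [hξ]
    · rintro _ rfl; simp
    · rintro _ rfl; simp [hne.symm]
  refine ne_top_of_le_ne_top ?_ (h1.trans (dirichletForm_indicator_le h.reversible h.pos _))
  rw [tsum_eq_single η]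
  · rw [indicator_of_mem (mem_singleton _)]
    exact ENNReal.mul_ne_top (measure_ne_top _ _) (Q.exitRate_ne_top η)
  · intro ξ hξ
    exact indicator_of_notMem (s := {η}) hξ _

/-- Capacity is symmetric in its two points, so the estimate holds from η to ζ and from ζ to η. Both
directions are needed to bound oscillations from above and from below. -/
theorem RecurrentReversible.escapeProb_le (h : Q.RecurrentReversible μ) {A B : Set E}
    (hAB : Disjoint A B) {η ζ : E} (hη : η ∈ A) (hζ : ζ ∈ A) :
    Q.escapeProb ζ B η ≤ 3 * (Q.capacity μ A B / Q.pointCapacity μ A ζ) ∧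
    Q.escapeProb η B ζ ≤ 3 * (Q.capacity μ A B / Q.pointCapacity μ A ζ) := by
  by_cases hne : η = ζ
  · subst hne
    rw [Q.escapeProb_self (disjoint_left.1 hAB hη)]
    simp
  have hc0 : Q.capacity μ {η} {ζ} ≠ 0 := capacity_singleton_ne_zero h.reversible h.irreducible h.pos
    h.measure_ne_zero (disjoint_singleton.2 hne) (singleton_nonempty _) (singleton_nonempty _)
  have hct := h.capacity_ne_top hne
  have hle : Q.capacity μ A B / Q.capacity μ {η} {ζ}
      ≤ Q.capacity μ A B / Q.pointCapacity μ A ζ :=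
    ENNReal.div_le_div_left (iInf₂_le η ⟨hη, hne⟩) _
  have key : ∀ e : ℝ≥0∞, e * Q.capacity μ {η} {ζ} ≤ 3 * Q.capacity μ A B →
      e ≤ 3 * (Q.capacity μ A B / Q.pointCapacity μ A ζ) := by
    intro e he
    refine le_trans ?_ (mul_le_mul_right hle 3)
    rw [← mul_div_assoc]
    exact (ENNReal.le_div_iff_mul_le (Or.inl hc0) (Or.inl hct)).2 he
  refine ⟨key _ (h.escapeProb_mul_capacity_le hAB hζ), key _ ?_⟩
  rw [capacity_comm]
  exact h.escapeProb_mul_capacity_le hAB hη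

theorem RecurrentReversible.one_le_law_hitTime_lt (h : Q.RecurrentReversible μ) {A B : Set E}
    (hAB : Disjoint A B) {η ζ : E} (hη : η ∈ A) (hζ : ζ ∈ A) :
    1 ≤ Q.law η {ω | hitTime {ζ} (Q.process ω) < hitTime B (Q.process ω)}
      + 3 * (Q.capacity μ A B / Q.pointCapacity μ A ζ) := by
  rw [← Q.law_hitsBefore_add_escapeProb ζ B η]
  refine add_le_add (measure_mono_ae ?_) (h.escapeProb_le hAB hη hζ).1
  filter_upwards [h.noExplosion.ae_regularPath h.pos η] with ω hr hω
  obtain ⟨n, hn, hk⟩ := hω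
  exact hr.hitTime_lt_hitTime hn hk

/-- Optional stopping at the first visit of ζ or B, in the form of a comparison: damping can only
lower the value, and on B the function is at most 1. -/
theorem Liouville.le_add_escapeProb (hL : Q.Liouville) {B : Set E} {F w : E → ℝ≥0∞}
    (hF1 : ∀ η, F η ≤ 1) (hw : ∀ η, w η ≤ 1) (hF : ∀ η ∉ B, F η = w η * Q.jumpOp F η) {ζ : E}
    (η : E) : F η ≤ F ζ + Q.escapeProb ζ B η := by
  refine hL.le_of_subsolution (f := F) (g := fun η => F ζ + Q.escapeProb ζ B η) (w := w)
    (b := fun _ => 0) (insert ζ B) hF1 hw ?_ ?_ ?_ (Or.inl ⟨ζ, mem_insert _ _⟩) η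
  · rintro ξ (rfl | hξ)
    · exact le_self_add
    · rw [Q.escapeProb_of_mem hξ]
      exact (hF1 ξ).trans le_add_self
  · intro ξ hξ
    rw [add_zero]
    exact (hF ξ fun h => hξ (mem_insert_of_mem _ h)).le
  · intro ξ hξ
    have h1 : ξ ≠ ζ := fun h => hξ (by rw [h]; exact mem_insert _ _)
    have h2 : ξ ∉ B := fun h => hξ (mem_insert_of_mem _ h)
    rw [add_zero, jumpOp_add, jumpOp_const, ← Q.escapeProb_eq h2 h1]
    exact mul_le_of_le_one_left zero_le (hw ξ)

end RateMatrix

/-! ### Condition (M1) -/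

section Attractor

variable {S : Type*} {E : ℕ → Type*} [∀ N, Countable (E N)] [∀ N, MeasurableSpace (E N)]
  [∀ N, DiscreteMeasurableSpace (E N)]

theorem attractorCondition_of_capacity {Q : ∀ N, RateMatrix (E N)} {μ : ∀ N, Measure (E N)}
    [∀ N, IsFiniteMeasure (μ N)] (h : ∀ N, (Q N).RecurrentReversible (μ N))
    {W : ∀ N, S → Set (E N)} {ξ : ∀ N, S → E N} {x : S} (hξ : ∀ N, ξ N x ∈ W N x)
    (H1 : Tendsto (fun N => (Q N).capacity (μ N) (W N x) (otherWells (W N) x) /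
        (Q N).pointCapacity (μ N) (W N x) (ξ N x)) atTop (𝓝 0)) :
    AttractorCondition Q W ξ x := by
  have h3 := ENNReal.Tendsto.const_mul H1 (a := 3) (Or.inr (by norm_num))
  have h4 := ENNReal.Tendsto.sub (tendsto_const_nhds (x := (1 : ℝ≥0∞))) h3
    (Or.inl ENNReal.one_ne_top)
  rw [mul_zero, tsub_zero] at h4
  refine tendsto_of_tendsto_of_tendsto_of_le_of_le h4 (tendsto_const_nhds (x := (1 : ℝ≥0∞)))
    (fun N => ?_) (fun N => ?_)
  · refine le_iInf₂ fun η hη => ?_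
    rw [tsub_le_iff_right]
    exact (h N).one_le_law_hitTime_lt disjoint_sdiff_right hη (hξ N)
  · exact iInf₂_le_of_le (ξ N x) (hξ N) prob_le_one

end Attractor

/-! ### Resolvent estimates on the wells -/

section Wells

variable {E S : Type*} {W : S → Set E}

theorem subset_wells (W : S → Set E) (x : S) : W x ⊆ wells W := subset_iUnion W x

theorem wells_eq_union (W : S → Set E) (x : S) : wells W = W x ∪ otherWells W x :=
  (union_sdiff_cancel (subset_wells W x)).symm

theorem subset_otherWells (hW : Pairwise fun x y => Disjoint (W x) (W y)) {x y : S} (h : y ≠ x) :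
    W y ⊆ otherWells W x := fun _ hη =>
  ⟨subset_wells W y hη, disjoint_left.1 (hW h) hη⟩

theorem mem_otherWells_iff (hW : Pairwise fun x y => Disjoint (W x) (W y)) {x : S} {η : E} :
    η ∈ otherWells W x ↔ ∃ y, y ≠ x ∧ η ∈ W y := by
  constructor
  · rintro ⟨h1, h2⟩
    obtain ⟨y, hy⟩ := mem_iUnion.1 h1
    exact ⟨y, fun h => h2 (h ▸ hy), hy⟩
  · rintro ⟨y, hy, hη⟩
    exact subset_otherWells hW hy hη

theorem sum_indicator_of_mem [Fintype S] (hW : Pairwise fun x y => Disjoint (W x) (W y)) {x : S}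
    [Fintype {y // y ≠ x}] (g : S → ℝ≥0∞) {y : S} (hy : y ≠ x) {η : E} (hη : η ∈ W y) :
    ∑ z : {y // y ≠ x}, (W z).indicator 1 η * g z = g y := by
  rw [Finset.sum_eq_single ⟨y, hy⟩]
  · simp [hη]
  · intro z _ hz
    rw [indicator_of_notMem, zero_mul]
    exact fun h => disjoint_left.1 (hW fun h' => hz (Subtype.ext h')) h hη
  · simp

theorem sum_indicator_of_notMem [Fintype S] (hW : Pairwise fun x y => Disjoint (W x) (W y)) {x : S}
    [Fintype {y // y ≠ x}] (g : S → ℝ≥0∞) {η : E} (hη : η ∉ otherWells W x) :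
    ∑ z : {y // y ≠ x}, (W z).indicator 1 η * g z = 0 := by
  refine Finset.sum_eq_zero fun z _ => ?_
  rw [indicator_of_notMem, zero_mul]
  exact fun h => hη (subset_otherWells hW z.2 h)

end Wells

namespace RateMatrix

theorem traceOp_sum_mul {E S : Type*} [Fintype S] [DecidableEq S] {Q : RateMatrix E}
    {W : S → Set E} (T : Set E) (x : S) (g : S → ℝ≥0∞) (η : E) :
    Q.traceOp T (fun ζ => ∑ z : {y // y ≠ x}, (W z).indicator 1 ζ * g z) η
      = ∑ z : {y // y ≠ x}, Q.traceOp T ((W z).indicator 1) η * g z := by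
  obtain ⟨k, hk⟩ := Q.isKernelOp_traceOp T
  simp only [hk, ← ENNReal.tsum_mul_right, Finset.mul_sum]
  rw [Summable.tsum_finsetSum fun _ _ => ENNReal.summable]
  simp only [mul_assoc]

variable {E S : Type*} [Countable E] [MeasurableSpace E] [DiscreteMeasurableSpace E]
  {Q : RateMatrix E} {μ : Measure E} {W : S → Set E}

theorem tsum_indicator_singleton (A : Set E) : ∑' η, A.indicator (fun η => μ {η}) η = μ A := by
  rw [← tsum_subtype A, ← measure_biUnion (to_countable A)]
  · simp
  · intro a _ b _ hab
    simpa using hab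
  · exact fun _ _ => MeasurableSet.of_discrete

theorem RecurrentReversible.meanRate_mul [IsFiniteMeasure μ]
    (h : Q.RecurrentReversible μ)
    (hW : Pairwise fun x y => Disjoint (W x) (W y)) {x y : S} (hxy : y ≠ x)
    (hx : (W x).Nonempty) :
    ∑' η, (W x).indicator (fun η => μ {η} *
        (Q.exitRate η * Q.traceOp (wells W) ((W y).indicator 1) η)) η
      = Q.meanRate μ (wells W) (W x) (W y) * μ (W x) := by
  obtain ⟨ξ, hξ⟩ := hx
  rw [meanRate_eq h.liouville h.noExplosion h.pos h.ae_hit μ (subset_wells W x) (subset_wells W y)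
    (hW hxy.symm), ENNReal.div_mul_cancel _ (measure_ne_top _ _)]
  exact fun h0 => h.measure_ne_zero ξ (measure_mono_null (singleton_subset_iff.2 hξ) h0)

variable [Fintype S] [DecidableEq S]

variable [IsFiniteMeasure μ]

theorem RecurrentReversible.tsum_traceOp_sum (h : Q.RecurrentReversible μ)
    (hW : Pairwise fun x y => Disjoint (W x) (W y)) {x : S} (hx : (W x).Nonempty)
    (g : S → ℝ≥0∞) :
    ∑' η, (W x).indicator (fun η => μ {η} * (Q.exitRate η * Q.traceOp (wells W)
        (fun ζ => ∑ z : {y // y ≠ x}, (W z).indicator 1 ζ * g z) η)) η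
      = (∑ z : {y // y ≠ x}, Q.meanRate μ (wells W) (W x) (W z) * g z) * μ (W x) := by
  simp only [traceOp_sum_mul]
  rw [Finset.sum_mul]
  have h1 : ∀ z : {y // y ≠ x}, Q.meanRate μ (wells W) (W x) (W z) * g z * μ (W x)
      = ∑' η, (W x).indicator (fun η => μ {η} *
        (Q.exitRate η * Q.traceOp (wells W) ((W z).indicator 1) η)) η * g z := by
    intro z
    rw [ENNReal.tsum_mul_right, h.meanRate_mul hW z.2 hx]
    ring
  simp only [h1]
  rw [← Summable.tsum_finsetSum fun _ _ => ENNReal.summable]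
  refine tsum_congr fun η => ?_
  by_cases hη : η ∈ W x
  · simp only [indicator_of_mem hη]
    rw [Finset.mul_sum, Finset.mul_sum]
    exact Finset.sum_congr rfl fun z _ => by ring
  · simp only [indicator_of_notMem hη, zero_mul, Finset.sum_const_zero]

/-- Two-sided bounds for the value at a point of a well of a function which solves the resolvent
equation on that well, is harmonic off the wells, and is nearly constant on the wells. -/
theorem RecurrentReversible.resolvent_bounds (h : Q.RecurrentReversible μ)
    (hW : Pairwise fun x y => Disjoint (W x) (W y)) {x : S} {ξ : E} (hξ : ξ ∈ W x)
    (hne : (otherWells W x).Nonempty) {a : ℝ≥0∞} (ha' : a ≠ ∞) {F : E → ℝ≥0∞}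
    (hF1 : ∀ η, F η ≤ 1)
    (hFA : ∀ η ∈ W x, F η = Q.exitRate η / (Q.exitRate η + a) * Q.jumpOp F η)
    (hFS : ∀ η ∉ wells W, F η = Q.jumpOp F η) {φ : S → ℝ≥0∞} {ε ρ : ℝ≥0∞}
    (hρ : ∀ η ∈ W x, F η ≤ F ξ + ρ ∧ F ξ ≤ F η + ρ)
    (hε : ∀ y, y ≠ x → ∀ η ∈ W y, F η ≤ φ y + ε ∧ φ y ≤ F η + ε) :
    let r : S → ℝ≥0∞ := fun y => Q.meanRate μ (wells W) (W x) (W y)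
    (a + ∑ z : {y // y ≠ x}, r z) * F ξ
      ≤ ∑ z : {y // y ≠ x}, r z * (φ z + ε) + (a + ∑ z : {y // y ≠ x}, r z) * ρ ∧
    ∑ z : {y // y ≠ x}, r z * φ z
      ≤ (a + ∑ z : {y // y ≠ x}, r z) * (F ξ + ρ) + (∑ z : {y // y ≠ x}, r z) * ε := by
  intro r
  have hx : (W x).Nonempty := ⟨ξ, hξ⟩
  have hμ0 : μ (W x) ≠ 0 :=
    fun h0 => h.measure_ne_zero ξ (measure_mono_null (singleton_subset_iff.2 hξ) h0)
  have hμt : μ (W x) ≠ ∞ := measure_ne_top _ _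
  set B := otherWells W x with hB
  -- In this exact identity F is now replaced by its value at ξ up to ρ on the well and by φ up to ε
  -- on the other wells; the mean rates appear as averages of the trace operator.
  have hid := h.liouville.tsum_resolvent_eq h.reversible h.pos (B := B) disjoint_sdiff_right
    (wells_eq_union W x) hne ha' hF1 hFA hFS
  have hBone : Q.traceOp (wells W) (B.indicator 1) = Q.traceOp (wells W)
      (fun ζ => ∑ z : {y // y ≠ x}, (W z).indicator 1 ζ * 1) := by
    congr 1
    funext ζ
    by_cases hζ : ζ ∈ B
    · obtain ⟨y, hy, hζy⟩ := (mem_otherWells_iff hW).1 hζ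
      rw [indicator_of_mem hζ, sum_indicator_of_mem hW (fun _ => 1) hy hζy, Pi.one_apply]
    · rw [indicator_of_notMem hζ, sum_indicator_of_notMem hW (fun _ => 1) hζ]
  have hconst : ∀ c : ℝ≥0∞, ∑' η, (W x).indicator (fun η => μ {η} *
      ((a + Q.exitRate η * Q.traceOp (wells W) (B.indicator 1) η) * c)) η
      = (a + ∑ z : {y // y ≠ x}, r z) * c * μ (W x) := by
    intro c
    have h1 := h.tsum_traceOp_sum hW hx (fun _ => 1)
    rw [← hBone] at h1
    simp only [mul_one] at h1
    calc _ = ∑' η, ((W x).indicator (fun η => μ {η}) η * (a * c) + (W x).indicator (fun η => μ {η} *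
          (Q.exitRate η * Q.traceOp (wells W) (B.indicator 1) η)) η * c) := by
          refine tsum_congr fun η => ?_
          by_cases hη : η ∈ W x
          · simp only [indicator_of_mem hη]; ring
          · simp only [indicator_of_notMem hη, zero_mul, add_zero]
      _ = μ (W x) * (a * c) + (∑ z : {y // y ≠ x}, r z) * μ (W x) * c := by
          rw [ENNReal.tsum_add, ENNReal.tsum_mul_right, ENNReal.tsum_mul_right, h1,
            tsum_indicator_singleton]
      _ = _ := by ring
  have hmono : ∀ f g : E → ℝ≥0∞, (∀ η ∈ W x, f η ≤ g η) →
      ∑' η, (W x).indicator f η ≤ ∑' η, (W x).indicator g η := by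
    intro f g hfg
    refine ENNReal.tsum_le_tsum fun η => ?_
    by_cases hη : η ∈ W x
    · simpa only [indicator_of_mem hη] using hfg η hη
    · simp only [indicator_of_notMem hη, le_refl]
  have hadd : ∀ f : E → ℝ≥0∞, ∀ c : ℝ≥0∞, ∑' η, (W x).indicator (fun η => μ {η} *
      ((a + Q.exitRate η * Q.traceOp (wells W) (B.indicator 1) η) * (f η + c))) η
      = ∑' η, (W x).indicator (fun η => μ {η} *
      ((a + Q.exitRate η * Q.traceOp (wells W) (B.indicator 1) η) * f η)) η
        + (a + ∑ z : {y // y ≠ x}, r z) * c * μ (W x) := by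
    intro f c
    rw [← hconst, ← ENNReal.tsum_add]
    refine tsum_congr fun η => ?_
    by_cases hη : η ∈ W x
    · simp only [indicator_of_mem hη]; ring
    · simp only [indicator_of_notMem hη, add_zero]
  constructor
  · rw [← ENNReal.mul_le_mul_iff_left hμ0 hμt, add_mul (∑ z : {y // y ≠ x}, _), ← hconst]
    refine (hmono _ (fun η => μ {η} *
      ((a + Q.exitRate η * Q.traceOp (wells W) (B.indicator 1) η) * (F η + ρ))) fun η hη => ?_).trans ?_
    · exact mul_le_mul_right (mul_le_mul_right (hρ η hη).2 _) _
    rw [hadd, hid]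
    refine add_le_add_left ?_ _
    rw [← h.tsum_traceOp_sum hW hx (fun z => φ z + ε)]
    refine hmono _ _ fun η _ => mul_le_mul_right (mul_le_mul_right
      ((Q.isKernelOp_traceOp _).mono (fun ζ => ?_) η) _) _
    by_cases hζ : ζ ∈ B
    · obtain ⟨y, hy, hζy⟩ := (mem_otherWells_iff hW).1 hζ
      rw [indicator_of_mem hζ, sum_indicator_of_mem hW (fun z => φ z + ε) hy hζy]
      exact (hε y hy ζ hζy).1
    · rw [indicator_of_notMem hζ]; exact zero_le
  · rw [← ENNReal.mul_le_mul_iff_left hμ0 hμt, ← h.tsum_traceOp_sum hW hx φ]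
    calc _ ≤ ∑' η, (W x).indicator (fun η => μ {η} * (Q.exitRate η *
            Q.traceOp (wells W) (fun ζ => B.indicator F ζ +
              ∑ z : {y // y ≠ x}, (W z).indicator 1 ζ * ε) η)) η := by
          refine hmono _ _ fun η _ => mul_le_mul_right (mul_le_mul_right
            ((Q.isKernelOp_traceOp _).mono (fun ζ => ?_) η) _) _
          by_cases hζ : ζ ∈ B
          · obtain ⟨y, hy, hζy⟩ := (mem_otherWells_iff hW).1 hζ
            rw [indicator_of_mem hζ, sum_indicator_of_mem hW φ hy hζy,
              sum_indicator_of_mem hW (fun _ => ε) hy hζy]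
            exact (hε y hy ζ hζy).2
          · rw [sum_indicator_of_notMem hW φ hζ]; exact zero_le
      _ = ∑' η, (W x).indicator (fun η => μ {η} *
            (Q.exitRate η * Q.traceOp (wells W) (B.indicator F) η)) η +
            (∑ z : {y // y ≠ x}, r z * ε) * μ (W x) := by
          rw [← h.tsum_traceOp_sum hW hx (fun _ => ε), ← ENNReal.tsum_add]
          refine tsum_congr fun η => ?_
          by_cases hη : η ∈ W x
          · simp only [indicator_of_mem hη]
            rw [(Q.isKernelOp_traceOp _).map_add]
            ring
          · simp only [indicator_of_notMem hη, add_zero]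
      _ ≤ _ := by
          rw [add_mul _ _ (μ (W x)), ← Finset.sum_mul]
          refine add_le_add_left ?_ _
          rw [← hid, ← hconst]
          refine hmono _ _ fun η hη => ?_
          exact mul_le_mul_right (mul_le_mul_right (hρ η hη).1 _) _

end RateMatrix

/-- Uniform convergence on the sets `W N` of the functions `u N` to the constant `c`. -/
def UniformLimit {E : ℕ → Type*} (W : ∀ N, Set (E N)) (u : ∀ N, E N → ℝ≥0∞) (c : ℝ≥0∞) : Prop :=
  ∀ ε : ℝ≥0∞, ε ≠ 0 → ∀ᶠ N in atTop, ∀ η ∈ W N, u N η ≤ c + ε ∧ c ≤ u N η + ε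

theorem UniformLimit.mul {E : ℕ → Type*} {W : ∀ N, Set (E N)} {u : ∀ N, E N → ℝ≥0∞} {c : ℝ≥0∞}
    (h : UniformLimit W u c) {k : ℝ≥0∞} (hk : k ≤ 1) {v : ∀ N, E N → ℝ≥0∞}
    (hv : ∀ N, ∀ η ∈ W N, v N η = k * u N η) : UniformLimit W v (k * c) := by
  intro ε hε
  filter_upwards [h ε hε] with N hN η hη
  rw [hv N η hη]
  have h1 : k * ε ≤ ε := mul_le_of_le_one_left zero_le hk
  constructor
  · calc k * u N η ≤ k * (c + ε) := mul_le_mul_right (hN η hη).1 _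
      _ = k * c + k * ε := mul_add _ _ _
      _ ≤ _ := add_le_add_right h1 _
  · calc k * c ≤ k * (u N η + ε) := mul_le_mul_right (hN η hη).2 _
      _ = k * u N η + k * ε := mul_add _ _ _
      _ ≤ _ := add_le_add_right h1 _

theorem UniformLimit.tendsto {E : ℕ → Type*} {W : ∀ N, Set (E N)} {u : ∀ N, E N → ℝ≥0∞} {c : ℝ≥0∞}
    (h : UniformLimit W u c) (hc : c ≠ ∞) {η : ∀ N, E N} (hη : ∀ N, η N ∈ W N) :
    Tendsto (fun N => u N (η N)) atTop (𝓝 c) := by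
  rw [ENNReal.tendsto_nhds hc]
  intro ε hε
  filter_upwards [h ε hε.ne'] with N hN
  exact ⟨tsub_le_iff_right.2 (hN _ (hη N)).2, (hN _ (hη N)).1⟩

section

variable {S : Type*} [Fintype S] [DecidableEq S] {E : ℕ → Type*} [∀ N, Countable (E N)]
  [∀ N, MeasurableSpace (E N)] [∀ N, DiscreteMeasurableSpace (E N)]

/-- The hypotheses on capacities and mean rates under which the projected trace converges. -/
structure MetastableSetting (Q : ∀ N, RateMatrix (E N)) (μ : ∀ N, Measure (E N))
    (W : ∀ N, S → Set (E N)) (ξ : ∀ N, S → E N) (θ : ℕ → ℝ≥0) (r : S → S → ℝ≥0) : Prop where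
  chain : ∀ N, (Q N).RecurrentReversible (μ N)
  disjoint : ∀ N, Pairwise fun x y => Disjoint (W N x) (W N y)
  mem : ∀ N x, ξ N x ∈ W N x
  pos : ∀ N, 0 < θ N
  capacity : ∀ x, Tendsto (fun N => (Q N).capacity (μ N) (W N x) (otherWells (W N) x) /
        (Q N).pointCapacity (μ N) (W N x) (ξ N x)) atTop (𝓝 0)
  meanRate : ∀ x y, x ≠ y → Tendsto (fun N => (θ N : ℝ≥0∞) *
        (Q N).meanRate (μ N) (wells (W N)) (W N x) (W N y)) atTop (𝓝 (r x y))

variable {Q : ∀ N, RateMatrix (E N)} {μ : ∀ N, Measure (E N)} [∀ N, IsFiniteMeasure (μ N)]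
  {W : ∀ N, S → Set (E N)} {ξ : ∀ N, S → E N} {θ : ℕ → ℝ≥0} {r : S → S → ℝ≥0}

/-- Multiplied by θ, the two bounds of `resolvent_bounds` involve only θ r_N, which converges by
(H0), and the oscillation ρ, which tends to 0 by (H1). Since b > 0, the denominators stay away from
0 even when x is absorbing. -/
theorem MetastableSetting.uniformLimit [Nontrivial S] (h : MetastableSetting Q μ W ξ θ r) {x : S}
    {b : ℝ≥0∞} (hb : b ≠ 0) (hb' : b ≠ ∞) {F : ∀ N, E N → ℝ≥0∞} (hF1 : ∀ N η, F N η ≤ 1)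
    (hFA : ∀ N, ∀ η ∈ W N x, F N η =
      (Q N).exitRate η / ((Q N).exitRate η + b / θ N) * (Q N).jumpOp (F N) η)
    (hFS : ∀ N, ∀ η ∉ wells (W N), F N η = (Q N).jumpOp (F N) η) {φ : S → ℝ≥0∞}
    (hφ1 : ∀ y, φ y ≤ 1)
    (hφ : ∀ y, y ≠ x → UniformLimit (fun N => W N y) F (φ y)) :
    UniformLimit (fun N => W N x) F
      ((∑ z : {y // y ≠ x}, (r x z : ℝ≥0∞) * φ z) / (b + ∑ z : {y // y ≠ x}, (r x z : ℝ≥0∞))) := by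
  intro ε' hε'
  set c := (∑ z : {y // y ≠ x}, (r x z : ℝ≥0∞) * φ z) / (b + ∑ z : {y // y ≠ x}, (r x z : ℝ≥0∞))
    with hc
  -- The minimum with 1 keeps ε finite. The quarter δ is spent twice on the errors in φ and in the
  -- limit of the rates, and twice on ρ, at the metapoint and then on the rest of the well.
  set ε := min ε' 1 with hε
  have hε0 : ε ≠ 0 := by simp [hε, hε']
  have hεt : ε ≠ ∞ := ne_top_of_le_ne_top ENNReal.one_ne_top (min_le_right _ _)
  set δ := ε / 4 with hδ
  have hδ0 : δ ≠ 0 := by simp [hδ, hε0]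
  have hδt : δ ≠ ∞ := ENNReal.div_ne_top hεt (by norm_num)
  have h4 : δ + δ + (δ + δ) = ε := by
    rw [← two_mul, ← two_mul, ← mul_assoc, hδ]
    norm_num
    exact ENNReal.mul_div_cancel (by norm_num) (by norm_num)
  set r' : ∀ N, S → ℝ≥0∞ := fun N y => (Q N).meanRate (μ N) (wells (W N)) (W N x) (W N y) with hr'
  set ρ : ℕ → ℝ≥0∞ := fun N => 3 * ((Q N).capacity (μ N) (W N x) (otherWells (W N) x) /
        (Q N).pointCapacity (μ N) (W N x) (ξ N x)) with hρ
  have hρt : Tendsto ρ atTop (𝓝 0) := by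
    simpa using ENNReal.Tendsto.const_mul (h.capacity x) (a := 3) (Or.inr (by norm_num))
  have hrz : ∀ z : {y // y ≠ x}, Tendsto (fun N => (θ N : ℝ≥0∞) * r' N z) atTop (𝓝 (r x z)) :=
    fun z => h.meanRate x z z.2.symm
  have hsum : Tendsto (fun N => b + ∑ z : {y // y ≠ x}, (θ N : ℝ≥0∞) * r' N z) atTop
      (𝓝 (b + ∑ z : {y // y ≠ x}, (r x z : ℝ≥0∞))) :=
    tendsto_const_nhds.add (tendsto_finsetSum _ fun z _ => hrz z)
  have hrt : b + ∑ z : {y // y ≠ x}, (r x z : ℝ≥0∞) ≠ ∞ :=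
    ENNReal.add_ne_top.2 ⟨hb', ENNReal.sum_ne_top.2 fun z _ => ENNReal.coe_ne_top⟩
  have hr0 : b + ∑ z : {y // y ≠ x}, (r x z : ℝ≥0∞) ≠ 0 := by simp [hb]
  have hlim : ∀ k : S → ℝ≥0∞, (∀ y, k y ≠ ∞) → Tendsto (fun N =>
      (∑ z : {y // y ≠ x}, (θ N : ℝ≥0∞) * r' N z * k z) /
        (b + ∑ z : {y // y ≠ x}, (θ N : ℝ≥0∞) * r' N z)) atTop
      (𝓝 ((∑ z : {y // y ≠ x}, (r x z : ℝ≥0∞) * k z) /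
        (b + ∑ z : {y // y ≠ x}, (r x z : ℝ≥0∞)))) := by
    intro k hk
    refine ENNReal.Tendsto.div (tendsto_finsetSum _ fun z _ =>
      ENNReal.Tendsto.mul_const (hrz z) (Or.inr (hk z))) (Or.inr hr0) hsum (Or.inl hrt)
  have hφt : ∀ y, φ y ≠ ∞ := fun y => ne_top_of_le_ne_top ENNReal.one_ne_top (hφ1 y)
  have hct : c ≠ ∞ := ENNReal.div_ne_top (ENNReal.sum_ne_top.2 fun z _ =>
    ENNReal.mul_ne_top ENNReal.coe_ne_top (hφt z)) hr0
  have hup : ∀ᶠ N in atTop, (∑ z : {y // y ≠ x}, (θ N : ℝ≥0∞) * r' N z * (φ z + δ)) /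
        (b + ∑ z : {y // y ≠ x}, (θ N : ℝ≥0∞) * r' N z) < c + δ + δ := by
    refine (hlim (fun y => φ y + δ) fun y => ENNReal.add_ne_top.2 ⟨hφt y, hδt⟩).eventually_lt_const ?_
    refine lt_of_le_of_lt ?_ (ENNReal.lt_add_right (ENNReal.add_ne_top.2 ⟨hct, hδt⟩) hδ0)
    simp only [mul_add, Finset.sum_add_distrib, ENNReal.add_div, ← Finset.sum_mul]
    refine add_le_add_right ?_ _
    refine ENNReal.div_le_of_le_mul ?_
    rw [mul_comm]
    exact mul_le_mul_right le_add_self _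
  have hlow : ∀ᶠ N in atTop, c < (∑ z : {y // y ≠ x}, (θ N : ℝ≥0∞) * r' N z * φ z) /
        (b + ∑ z : {y // y ≠ x}, (θ N : ℝ≥0∞) * r' N z) + δ :=
    ((hlim φ hφt).add_const δ).eventually_const_lt (ENNReal.lt_add_right hct hδ0)
  have hφN : ∀ᶠ N in atTop, ∀ y : {y // y ≠ x}, ∀ η ∈ W N y,
      F N η ≤ φ y + δ ∧ φ y ≤ F N η + δ :=
    eventually_all.2 fun y => hφ y y.2 δ hδ0
  filter_upwards [hup, hlow, hφN, hρt.eventually_le_const (pos_iff_ne_zero.2 hδ0),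
    hsum.eventually_lt_const hrt.lt_top] with N hup hlow hφN hρN hfin η hη
  obtain ⟨y, hy⟩ := exists_ne x
  have hθ0 : (θ N : ℝ≥0∞) ≠ 0 := by simpa using (h.pos N).ne'
  have hθt : (θ N : ℝ≥0∞) ≠ ∞ := ENNReal.coe_ne_top
  have hB : (otherWells (W N) x).Nonempty :=
    ⟨ξ N y, subset_otherWells (h.disjoint N) hy (h.mem N y)⟩
  have hρb : ∀ ζ ∈ W N x, F N ζ ≤ F N (ξ N x) + ρ N ∧ F N (ξ N x) ≤ F N ζ + ρ N := by
    intro ζ hζ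
    classical
    -- The equations on the well and off the wells are one damped equation off the other wells, with
    -- factor w ≤ 1.
    set w : E N → ℝ≥0∞ := fun η =>
      if η ∈ W N x then (Q N).exitRate η / ((Q N).exitRate η + b / θ N) else 1 with hw
    have hw1 : ∀ η, w η ≤ 1 := by
      intro η
      simp only [hw]
      split_ifs
      · exact ENNReal.div_le_of_le_mul (by rw [one_mul]; exact le_self_add)
      · exact le_rfl
    have hFw : ∀ η ∉ otherWells (W N) x, F N η = w η * (Q N).jumpOp (F N) η := by
      intro η hη
      simp only [hw]
      split_ifs with hηx
      · exact hFA N η hηx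
      · rw [one_mul]
        exact hFS N η fun h => hη ⟨h, hηx⟩
    obtain ⟨h1, h2⟩ := (h.chain N).escapeProb_le (B := otherWells (W N) x) disjoint_sdiff_right hζ
      (h.mem N x)
    exact ⟨((h.chain N).liouville.le_add_escapeProb (hF1 N) hw1 hFw ζ).trans (add_le_add_right h1 _),
      ((h.chain N).liouville.le_add_escapeProb (hF1 N) hw1 hFw _).trans (add_le_add_right h2 _)⟩
  obtain ⟨hA, hBd⟩ := (h.chain N).resolvent_bounds (h.disjoint N) (h.mem N x) hB
    (ENNReal.div_ne_top hb' hθ0) (hF1 N) (hFA N) (hFS N) hρb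
    (fun y hy => hφN ⟨y, hy⟩)
  have hmul : (θ N : ℝ≥0∞) * (b / θ N + ∑ z : {y // y ≠ x}, r' N z)
      = b + ∑ z : {y // y ≠ x}, (θ N : ℝ≥0∞) * r' N z := by
    rw [mul_add, Finset.mul_sum, ENNReal.mul_div_cancel hθ0 hθt]
  set K := b + ∑ z : {y // y ≠ x}, (θ N : ℝ≥0∞) * r' N z with hK
  have hK0 : K ≠ 0 := by simp [hK, hb]
  have hξup : F N (ξ N x) ≤ c + δ + δ + ρ N := by
    have h1 := mul_le_mul_right hA (θ N : ℝ≥0∞)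
    rw [mul_add, ← mul_assoc, ← mul_assoc, hmul, Finset.mul_sum] at h1
    simp only [← mul_assoc] at h1
    have h2 : F N (ξ N x) ≤ (∑ z : {y // y ≠ x}, (θ N : ℝ≥0∞) * r' N z * (φ z + δ)) / K + ρ N := by
      rw [← ENNReal.mul_le_mul_iff_right hK0 hfin.ne, mul_add, ENNReal.mul_div_cancel hK0 hfin.ne]
      exact h1
    exact h2.trans (add_le_add_left hup.le _)
  have hξlow : c ≤ F N (ξ N x) + ρ N + δ + δ := by
    have h1 := mul_le_mul_right hBd (θ N : ℝ≥0∞)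
    rw [mul_add, ← mul_assoc, hmul, Finset.mul_sum, ← mul_assoc, Finset.mul_sum] at h1
    simp only [← mul_assoc] at h1
    have h2 : (∑ z : {y // y ≠ x}, (θ N : ℝ≥0∞) * r' N z * φ z) / K
        ≤ F N (ξ N x) + ρ N + δ := by
      rw [← ENNReal.mul_le_mul_iff_right hK0 hfin.ne, mul_add _ _ δ,
        ENNReal.mul_div_cancel hK0 hfin.ne]
      refine h1.trans (add_le_add_right (mul_le_mul_left ?_ _) _)
      exact le_add_self
    exact hlow.le.trans (add_le_add_left h2 _)
  have hεle : ε ≤ ε' := min_le_left _ _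
  constructor
  · calc F N η ≤ c + δ + δ + ρ N + ρ N := (hρb η hη).1.trans (add_le_add_left hξup _)
      _ ≤ c + δ + δ + δ + δ := by gcongr
      _ = c + ε := by rw [← h4]; ring
      _ ≤ c + ε' := add_le_add_right hεle _
  · calc c ≤ F N η + ρ N + ρ N + δ + δ := hξlow.trans (by gcongr; exact (hρb η hη).2)
      _ ≤ F N η + δ + δ + δ + δ := by gcongr
      _ = F N η + ε := by rw [← h4]; ring
      _ ≤ F N η + ε' := add_le_add_right hεle _

end

/-! ### Time spent outside the wells -/

/-- On [p, q] the density exp(-s) is at least exp(-t), and its integral over the larger interval [p,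
q'] is exp(-p) - exp(-q'). -/
theorem ofReal_sub_le_exp_mul {p q q' t : ℝ} (hpq : p ≤ q) (hqq : q ≤ q') (hqt : q ≤ t) :
    q - p ≤ Real.exp t * (Real.exp (-p) - Real.exp (-q')) := by
  have h1 : Real.exp (-q') ≤ Real.exp (-q) := Real.exp_le_exp.2 (by linarith)
  have h2 : Real.exp (-q) * (q - p + 1) ≤ Real.exp (-p) := by
    have := Real.add_one_le_exp (q - p)
    calc _ ≤ Real.exp (-q) * Real.exp (q - p) := by gcongr
      _ = Real.exp (-p) := by rw [← Real.exp_add]; congr 1; ring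
  have h3 : 1 ≤ Real.exp t * Real.exp (-q) := by
    rw [← Real.exp_add]; exact Real.one_le_exp (by linarith)
  calc q - p ≤ (Real.exp t * Real.exp (-q)) * (q - p) :=
        le_mul_of_one_le_left (by linarith) h3
    _ = Real.exp t * (Real.exp (-q) * (q - p)) := by ring
    _ ≤ _ := by
        refine mul_le_mul_of_nonneg_left ?_ (Real.exp_pos t).le
        nlinarith

namespace RateMatrix

variable {E : Type*} (Q : RateMatrix E)

/-- The contribution of the `n`-th holding interval to the discounted time spent in `D`. -/
def discountedTime (a : ℝ≥0∞) (D : Set E) (ω : (ℕ → E) × (ℕ → ℝ)) (n : ℕ) : ℝ≥0∞ :=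
  D.indicator (fun _ => expNeg (a * Q.jumpTime ω n) * (1 - expNeg (a * Q.holdingTime ω n))) (ω.1 n)

theorem jumpTime_shift (ω : (ℕ → E) × (ℕ → ℝ)) (n : ℕ) :
    Q.jumpTime ω (n + 1) = Q.holdingTime ω 0 + Q.jumpTime (shift ω) n := by
  rw [jumpTime, Finset.sum_range_succ', add_comm]
  rfl

theorem discountedTime_succ (a : ℝ≥0∞) (D : Set E) (ω : (ℕ → E) × (ℕ → ℝ)) (n : ℕ) :
    Q.discountedTime a D ω (n + 1)
      = expNeg (a * Q.holdingTime ω 0) * Q.discountedTime a D (shift ω) n := by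
  by_cases h : ω.1 (n + 1) ∈ D
  · rw [discountedTime, discountedTime, indicator_of_mem h,
      indicator_of_mem (show (shift ω).1 n ∈ D from h), jumpTime_shift, mul_add, expNeg_add,
      holdingTime_shift, mul_assoc]
  · rw [discountedTime, discountedTime, indicator_of_notMem h,
      indicator_of_notMem (show (shift ω).1 n ∉ D from h), mul_zero]

-- A fixed time horizon is traded for an exponential discount, at the cost of a factor exp t; the
-- discounted time is accessible through a resolvent equation.
variable {Q} in
theorem RegularPath.occupationTime_le {ω : (ℕ → E) × (ℕ → ℝ)} (h : Q.RegularPath ω) {θ : ℝ≥0}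
    (hθ : 0 < θ) (D : Set E) (t : ℝ≥0) :
    occupationTime D (fun s => Q.process ω (s * θ)) t
      ≤ ENNReal.ofReal (Real.exp t) * ∑' n, Q.discountedTime (θ : ℝ≥0∞)⁻¹ D ω n := by
  have hθ' : (0 : ℝ) < θ := hθ
  set S : ℕ → ℝ := fun n => (Q.jumpTime ω n).toReal / θ with hS
  have hS0 : ∀ n, 0 ≤ S n := fun n => div_nonneg ENNReal.toReal_nonneg hθ'.le
  have hSm : ∀ n, S n ≤ S (n + 1) := fun n => by
    simp only [hS]
    gcongr
    · exact h.jumpTime_ne_top _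
    · exact Q.monotone_jumpTime ω n.le_succ
  have hexp : ∀ n, expNeg ((θ : ℝ≥0∞)⁻¹ * Q.jumpTime ω n) = ENNReal.ofReal (Real.exp (-S n)) := by
    intro n
    have hne : (θ : ℝ≥0∞)⁻¹ * Q.jumpTime ω n ≠ ∞ :=
      ENNReal.mul_ne_top (by simpa using hθ.ne') (h.jumpTime_ne_top n)
    rw [expNeg_of_ne_top hne, ENNReal.toReal_mul, ENNReal.toReal_inv, ENNReal.coe_toReal]
    simp only [hS]
    congr 3
    rw [div_eq_inv_mul]
  have hdisc : ∀ n, Q.discountedTime (θ : ℝ≥0∞)⁻¹ D ω n = D.indicator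
      (fun _ => ENNReal.ofReal (Real.exp (-S n) - Real.exp (-S (n + 1)))) (ω.1 n) := by
    intro n
    rw [discountedTime]
    congr 1
    funext _
    rw [ENNReal.mul_sub (fun _ _ => expNeg_ne_top _), mul_one, ← expNeg_add, ← mul_add,
      ← jumpTime_succ, hexp, hexp, ENNReal.ofReal_sub _ (Real.exp_pos _).le]
  rw [occupationTime]
  -- The rescaled holding intervals are taken closed: they may overlap at end points, which is
  -- harmless for an upper bound.
  have hpt : ∀ s ∈ Icc (0 : ℝ) t, D.indicator (fun _ => (1 : ℝ≥0∞)) (Q.process ω (s.toNNReal * θ))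
      ≤ ∑' n, (Icc (S n) (min (S (n + 1)) t)).indicator
        (fun _ => D.indicator (fun _ => (1 : ℝ≥0∞)) (ω.1 n)) s := by
    intro s hs
    obtain ⟨n, hn1, hn2⟩ := Q.exists_jumpTime_le h.tsum_eq (s.toNNReal * θ)
    rw [Q.process_eq hn1 hn2]
    refine le_trans ?_ (ENNReal.le_tsum n)
    rw [indicator_of_mem (a := s)]
    refine ⟨?_, le_min ?_ hs.2⟩
    · rw [div_le_iff₀ hθ']
      have := ENNReal.toReal_mono ENNReal.coe_ne_top hn1
      simpa [Real.coe_toNNReal _ hs.1] using this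
    · rw [le_div_iff₀ hθ']
      have := ENNReal.toReal_mono (h.jumpTime_ne_top _) hn2.le
      simpa [Real.coe_toNNReal _ hs.1] using this
  refine (setLIntegral_mono' measurableSet_Icc hpt).trans ?_
  refine (setLIntegral_le_lintegral _ _).trans ?_
  have hmeas : ∀ n, MeasurableSet (Icc (S n) (min (S (n + 1)) t)) := fun n => measurableSet_Icc
  rw [lintegral_tsum fun n => (measurable_const.indicator (hmeas n)).aemeasurable,
    ← ENNReal.tsum_mul_left]
  refine ENNReal.tsum_le_tsum fun n => ?_
  rw [lintegral_indicator_const (hmeas n), hdisc]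
  by_cases hD : ω.1 n ∈ D
  · simp only [indicator_of_mem hD, one_mul]
    rw [Real.volume_Icc, ← ENNReal.ofReal_mul (Real.exp_pos _).le]
    by_cases hlt : S n ≤ min (S (n + 1)) t
    · exact ENNReal.ofReal_le_ofReal
        (ofReal_sub_le_exp_mul hlt (min_le_left _ _) (min_le_right _ _))
    · rw [ENNReal.ofReal_of_nonpos (by linarith)]
      exact zero_le
  · simp [indicator_of_notMem hD]

theorem measurable_jumpTime [MeasurableSpace E] [DiscreteMeasurableSpace E] (n : ℕ) :
    Measurable fun ω => Q.jumpTime ω n := by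
  unfold jumpTime
  exact Finset.measurable_sum _ fun i _ => Q.measurable_holdingTime i

theorem measurable_discountedTime [MeasurableSpace E] [DiscreteMeasurableSpace E] (a : ℝ≥0∞)
    (D : Set E) (n : ℕ) : Measurable fun ω => Q.discountedTime a D ω n := by
  have h1 : Measurable fun ω => Q.jumpTime ω n := Q.measurable_jumpTime n
  have h2 : Measurable fun ω => Q.holdingTime ω n := Q.measurable_holdingTime n
  have h3 : Measurable fun ω : (ℕ → E) × (ℕ → ℝ) =>
      D.indicator (fun _ => (1 : ℝ≥0∞)) (ω.1 n) :=
    (measurable_one.indicator MeasurableSet.of_discrete).comp (measurable_fst_apply n)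
  have : (fun ω => Q.discountedTime a D ω n) = fun ω => D.indicator (fun _ => (1 : ℝ≥0∞)) (ω.1 n) *
      (expNeg (a * Q.jumpTime ω n) * (1 - expNeg (a * Q.holdingTime ω n))) := by
    funext ω
    by_cases h : ω.1 n ∈ D <;> simp [discountedTime, h]
  rw [this]
  exact h3.mul ((measurable_expNeg.comp (h1.const_mul a)).mul
    (measurable_const.sub (measurable_expNeg.comp (h2.const_mul a))))

variable [Countable E] [MeasurableSpace E] [DiscreteMeasurableSpace E]

theorem lintegral_expNeg_holdingTime (η : E) {a : ℝ≥0∞} (ha : a ≠ 0) (ha' : a ≠ ∞) :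
    ∫⁻ ω, expNeg (a * Q.holdingTime ω 0) ∂Q.law η = Q.exitRate η / (Q.exitRate η + a) := by
  have := Q.lintegral_expNeg_mul_shift η ha ha' (G := fun _ => 1) measurable_const
  simpa [jumpOp_const] using this

/-- Induction on the number of holding intervals, with the Markov property at the first jump. Only
this inequality is needed, so uniqueness for the resolvent equation plays no role. -/
theorem lintegral_discountedTime_le {a : ℝ≥0∞} (ha : a ≠ 0) (ha' : a ≠ ∞) (D : Set E)
    {V : E → ℝ≥0∞} (hV : ∀ η, V η = Q.exitRate η / (Q.exitRate η + a) * Q.jumpOp V η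
      + a / (Q.exitRate η + a) * D.indicator 1 η) (η : E) :
    ∫⁻ ω, ∑' n, Q.discountedTime a D ω n ∂Q.law η ≤ V η := by
  have hm := Q.measurable_discountedTime a D
  have key : ∀ (m : ℕ) (η : E),
      ∫⁻ ω, ∑ n ∈ Finset.range m, Q.discountedTime a D ω n ∂Q.law η ≤ V η := by
    intro m
    induction m with
    | zero => simp
    | succ m ih =>
      intro η
      simp only [Finset.sum_range_succ', discountedTime_succ, ← Finset.mul_sum]
      rw [lintegral_add_right _ (hm 0),
        Q.lintegral_expNeg_mul_shift η ha ha' (Finset.measurable_sum _ fun n _ => hm n), hV η]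
      refine add_le_add (mul_le_mul_right (jumpOp_mono ih η) _) ?_
      have h0 : ∫⁻ ω, Q.discountedTime a D ω 0 ∂Q.law η
          = ∫⁻ ω, D.indicator 1 η * (1 - expNeg (a * Q.holdingTime ω 0)) ∂Q.law η := by
        refine lintegral_congr_ae ?_
        filter_upwards [Q.law_zero η] with ω h0
        by_cases h : η ∈ D <;> simp [discountedTime, jumpTime_zero, h0, h]
      have hme : Measurable fun ω => expNeg (a * Q.holdingTime ω 0) :=
        measurable_expNeg.comp ((Q.measurable_holdingTime 0).const_mul a)
      have hms : Measurable fun ω => 1 - expNeg (a * Q.holdingTime ω 0) := measurable_const.sub hme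
      rw [h0, lintegral_const_mul _ hms, mul_comm]
      refine mul_le_mul_left ?_ _
      rw [lintegral_sub hme _ (Eventually.of_forall fun ω => expNeg_le_one _), lintegral_one,
        measure_univ, Q.lintegral_expNeg_holdingTime η ha ha', tsub_le_iff_right, ← ENNReal.add_div,
        add_comm a, ENNReal.div_self]
      · simp [ha]
      · exact ENNReal.add_ne_top.2 ⟨Q.exitRate_ne_top η, ha'⟩
      · exact (lintegral_mono fun ω => expNeg_le_one _).trans_lt (by simp) |>.ne
  rw [lintegral_tsum fun n => (hm n).aemeasurable]
  refine ENNReal.tsum_le_of_sum_range_le fun m => ?_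
  rw [← lintegral_finsetSum _ fun n _ => hm n]
  exact key m η

variable {Q} {μ : Measure E} [IsProbabilityMeasure μ]

/-- The energy bound of `exists_resolvent` controls the oscillation of V around V ξ through
capacities, and its L² bound off D controls the average of V² over A. Together they bound V at every
point of A. -/
theorem RecurrentReversible.lintegral_occupationTime_le (h : Q.RecurrentReversible μ) {A D : Set E}
    (hAD : Disjoint A D) {ξ : E} (hξ : ξ ∈ A) {θ : ℝ≥0} (hθ : 0 < θ) (t : ℝ≥0) {η : E}
    (hη : η ∈ A) :
    ∫⁻ ω, occupationTime D (fun s => Q.process ω (s * θ)) t ∂Q.law η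
      ≤ ENNReal.ofReal (Real.exp t) *
        (4 * (μ D / μ A) + 6 * ((θ : ℝ≥0∞)⁻¹ * μ D / Q.pointCapacity μ A ξ)) ^ (2⁻¹ : ℝ) := by
  have ha : (θ : ℝ≥0∞)⁻¹ ≠ 0 := by simp
  have ha' : (θ : ℝ≥0∞)⁻¹ ≠ ∞ := by simpa using hθ.ne'
  obtain ⟨V, hV01, hVeq, hVD, hVA⟩ := exists_resolvent h.reversible h.pos h.measure_ne_zero ha' D
  have hμ0 : μ A ≠ 0 :=
    fun h0 => h.measure_ne_zero ξ (measure_mono_null (singleton_subset_iff.2 hξ) h0)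
  have hμt : μ A ≠ ∞ := measure_ne_top _ _
  set σ := (θ : ℝ≥0∞)⁻¹ * μ D / Q.pointCapacity μ A ξ with hσ
  have hdiff : ∀ ζ ∈ A, ENNReal.ofReal ((V ζ - V ξ) ^ 2) ≤ σ := by
    intro ζ hζ
    by_cases hne : ζ = ξ
    · simp [hne]
    have h1 := (capacity_mul_sq_le (μ := μ) (Q := Q) (f := V) (C := 1) (fun η => by
      rw [abs_of_nonneg (hV01 η).1]; exact (hV01 η).2) ζ ξ).trans hVD
    have hc0 : Q.capacity μ {ζ} {ξ} ≠ 0 := capacity_singleton_ne_zero h.reversible h.irreducible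
      h.pos h.measure_ne_zero (disjoint_singleton.2 hne) (singleton_nonempty _)
      (singleton_nonempty _)
    rw [mul_comm] at h1
    refine ((ENNReal.le_div_iff_mul_le (Or.inl hc0) (Or.inl (h.capacity_ne_top hne))).2 h1).trans ?_
    exact ENNReal.div_le_div_left (iInf₂_le ζ ⟨hζ, hne⟩) _
  have hsq : ∀ ζ ∈ A, ∀ p q : E, (p = ζ ∧ q = ξ ∨ p = ξ ∧ q = ζ) →
      ENNReal.ofReal (V p ^ 2) ≤ 2 * ENNReal.ofReal (V q ^ 2) + 2 * σ := by
    intro ζ hζ p q hpq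
    have h1 : V p ^ 2 ≤ 2 * V q ^ 2 + 2 * (V ζ - V ξ) ^ 2 := by
      rcases hpq with ⟨rfl, rfl⟩ | ⟨rfl, rfl⟩
      · nlinarith [sq_nonneg (V p - 2 * V q)]
      · nlinarith [sq_nonneg (V p - 2 * V q)]
    calc _ ≤ ENNReal.ofReal (2 * V q ^ 2 + 2 * (V ζ - V ξ) ^ 2) := ENNReal.ofReal_le_ofReal h1
      _ = 2 * ENNReal.ofReal (V q ^ 2) + 2 * ENNReal.ofReal ((V ζ - V ξ) ^ 2) := by
          rw [ENNReal.ofReal_add (by positivity) (by positivity), ENNReal.ofReal_mul (by norm_num),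
            ENNReal.ofReal_mul (by norm_num)]
          norm_num
      _ ≤ _ := add_le_add_right (mul_le_mul_right (hdiff ζ hζ) _) _
  have hVsum : ∑' ζ, A.indicator (fun ζ => μ {ζ} * ENNReal.ofReal (V ζ ^ 2)) ζ ≤ μ D := by
    rw [ENNReal.mul_le_mul_iff_right ha ha'] at hVA
    refine le_trans (ENNReal.tsum_le_tsum fun ζ => ?_) hVA
    exact indicator_le_indicator_of_subset hAD.subset_compl_right (fun _ => zero_le) ζ
  -- Averaging over A gives V(ξ)² ≤ 2 μ(D)/μ(A) + 2σ. A second use of `hsq` doubles this and adds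
  -- 2σ: hence the constants 4 and 6.
  have hξ2 : ENNReal.ofReal (V ξ ^ 2) ≤ 2 * (μ D / μ A) + 2 * σ := by
    have h1 : ENNReal.ofReal (V ξ ^ 2) * μ A ≤ 2 * μ D + 2 * σ * μ A := by
      calc _ = ∑' ζ, A.indicator (fun ζ => μ {ζ}) ζ * ENNReal.ofReal (V ξ ^ 2) := by
            rw [ENNReal.tsum_mul_right, tsum_indicator_singleton, mul_comm]
        _ ≤ ∑' ζ, (2 * A.indicator (fun ζ => μ {ζ} * ENNReal.ofReal (V ζ ^ 2)) ζ
            + 2 * σ * A.indicator (fun ζ => μ {ζ}) ζ) := by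
            refine ENNReal.tsum_le_tsum fun ζ => ?_
            by_cases hζ : ζ ∈ A
            · simp only [indicator_of_mem hζ]
              calc _ ≤ μ {ζ} * (2 * ENNReal.ofReal (V ζ ^ 2) + 2 * σ) :=
                    mul_le_mul_right (hsq ζ hζ ξ ζ (Or.inr ⟨rfl, rfl⟩)) _
                _ = _ := by ring
            · simp [indicator_of_notMem hζ]
        _ ≤ _ := by
            rw [ENNReal.tsum_add, ENNReal.tsum_mul_left, ENNReal.tsum_mul_left,
              tsum_indicator_singleton]
            exact add_le_add_left (mul_le_mul_right hVsum _) _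
    rw [← ENNReal.mul_le_mul_iff_left hμ0 hμt, add_mul, mul_assoc 2 (μ D / μ A),
      ENNReal.div_mul_cancel hμ0 hμt]
    exact h1
  have hη2 : ENNReal.ofReal (V η) ^ 2 ≤ 4 * (μ D / μ A) + 6 * σ := by
    rw [← ENNReal.ofReal_pow (hV01 η).1]
    calc _ ≤ 2 * ENNReal.ofReal (V ξ ^ 2) + 2 * σ := hsq η hη η ξ (Or.inl ⟨rfl, rfl⟩)
      _ ≤ 2 * (2 * (μ D / μ A) + 2 * σ) + 2 * σ := add_le_add_left (mul_le_mul_right hξ2 _) _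
      _ = _ := by ring
  have hη1 : ENNReal.ofReal (V η) ≤ (4 * (μ D / μ A) + 6 * σ) ^ (2⁻¹ : ℝ) := by
    rw [ENNReal.le_rpow_inv_iff (by norm_num)]
    exact_mod_cast hη2
  refine le_trans ?_ (mul_le_mul_right hη1 _)
  refine le_trans ?_ (mul_le_mul_right (Q.lintegral_discountedTime_le ha ha' D hVeq η) _)
  rw [← lintegral_const_mul' _ _ ENNReal.ofReal_ne_top]
  refine lintegral_mono_ae ?_
  filter_upwards [h.noExplosion.ae_regularPath h.pos η] with ω hω
  exact hω.occupationTime_le hθ D t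

/-- The harmonic extension of the indicator of the other wells is the potential u of
`tsum_escape_le_capacity`. The resulting bound is what compares the time-scale θ with the
capacities. -/
theorem RecurrentReversible.sum_meanRate_mul_le_capacity {S : Type*} [Fintype S] [DecidableEq S]
    {W : S → Set E} (h : Q.RecurrentReversible μ) (hW : Pairwise fun x y => Disjoint (W x) (W y))
    {x : S} (hx : (W x).Nonempty) (hne : (otherWells W x).Nonempty) :
    (∑ z : {y // y ≠ x}, Q.meanRate μ (wells W) (W x) (W z)) * μ (W x)
      ≤ Q.capacity μ (W x) (otherWells W x) := by
  set B := otherWells W x with hB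
  have hBS : B ⊆ wells W := sdiff_subset
  have hBone : B.indicator 1 = fun ζ => ∑ z : {y // y ≠ x}, (W z).indicator 1 ζ * (1 : ℝ≥0∞) := by
    funext ζ
    by_cases hζ : ζ ∈ B
    · obtain ⟨y, hy, hζy⟩ := (mem_otherWells_iff hW).1 hζ
      rw [indicator_of_mem hζ, sum_indicator_of_mem hW (fun _ => 1) hy hζy, Pi.one_apply]
    · rw [indicator_of_notMem hζ, sum_indicator_of_notMem hW (fun _ => 1) hζ]
  have h1 := h.tsum_traceOp_sum hW hx (fun _ => 1)
  rw [← hBone] at h1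
  simp only [mul_one] at h1
  rw [← h1]
  have h2 := tsum_escape_le_capacity h.liouville h.reversible h.pos h.measure_ne_zero
    (A := W x) (B := B) disjoint_sdiff_right hne (u := Q.harmExt (wells W) (B.indicator 1))
    (fun ζ => ?_) (fun ζ hζ => ?_) (fun ζ hζ => ?_) (fun ζ hζ hζ' => ?_)
  · refine le_trans (ENNReal.tsum_le_tsum fun η => ?_) h2
    refine le_of_eq ?_
    congr 1
    funext η
    rw [mul_assoc]
    rfl
  · rw [← h.liouville.law_entersIn (S := wells W) (hx.mono (subset_wells W x)) hBS]
    exact prob_le_one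
  · rw [harmExt_of_mem _ (subset_wells W x hζ), indicator_of_notMem]
    exact fun h' => h'.2 hζ
  · rw [harmExt_of_mem _ (hBS hζ), indicator_of_mem hζ, Pi.one_apply]
  · refine harmExt_of_notMem _ fun h' => ?_
    exact hζ' ⟨h', hζ⟩

end RateMatrix

/-! ### Condition (M3) at the non-absorbing wells -/

section Negligible

variable {S : Type*} [Fintype S] [DecidableEq S] {E : ℕ → Type*} [∀ N, Countable (E N)]
  [∀ N, MeasurableSpace (E N)] [∀ N, DiscreteMeasurableSpace (E N)]
  {Q : ∀ N, RateMatrix (E N)} {μ : ∀ N, Measure (E N)} [∀ N, IsProbabilityMeasure (μ N)]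
  {W : ∀ N, S → Set (E N)} {ξ : ∀ N, S → E N} {θ : ℕ → ℝ≥0} {r : S → S → ℝ≥0}

theorem MetastableSetting.negligibleCondition (h : MetastableSetting Q μ W ξ θ r) {x y : S}
    (hxy : y ≠ x) (hr : r x y ≠ 0)
    (H2 : Tendsto (fun N => μ N (annulus (W N)) / μ N (W N x)) atTop (𝓝 0)) :
    NegligibleCondition Q W θ x := by
  intro t _
  set K : ℕ → ℝ≥0∞ := fun N => ∑ z : {y // y ≠ x}, (θ N : ℝ≥0∞) *
    (Q N).meanRate (μ N) (wells (W N)) (W N x) (W N z) with hK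
  set K' : ℝ≥0∞ := ∑ z : {y // y ≠ x}, (r x z : ℝ≥0∞) with hK'
  have hKt : Tendsto K atTop (𝓝 K') := tendsto_finsetSum _ fun z _ => h.meanRate x z z.2.symm
  have hK'0 : K' ≠ 0 := by
    intro h0
    have := Finset.sum_eq_zero_iff.1 h0 ⟨y, hxy⟩ (Finset.mem_univ _)
    exact hr (by simpa using this)
  have hK't : K' ≠ ∞ := ENNReal.sum_ne_top.2 fun z _ => ENNReal.coe_ne_top
  set d : ℕ → ℝ≥0∞ := fun N => μ N (annulus (W N)) / μ N (W N x) with hd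
  set c : ℕ → ℝ≥0∞ := fun N => (Q N).capacity (μ N) (W N x) (otherWells (W N) x) /
        (Q N).pointCapacity (μ N) (W N x) (ξ N x) with hc
  have hlim : Tendsto (fun N => ENNReal.ofReal (Real.exp t) *
      (4 * d N + 6 * (d N * c N * (K N)⁻¹)) ^ (2⁻¹ : ℝ)) atTop (𝓝 0) := by
    have h1 : Tendsto (fun N => d N * c N) atTop (𝓝 0) := by
      simpa using ENNReal.Tendsto.mul H2 (Or.inr ENNReal.zero_ne_top) (h.capacity x)
        (Or.inr ENNReal.zero_ne_top)
    have h2 : Tendsto (fun N => d N * c N * (K N)⁻¹) atTop (𝓝 0) := by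
      have := ENNReal.Tendsto.mul h1 (Or.inr (ENNReal.inv_ne_top.2 hK'0))
        (tendsto_inv_iff.2 hKt) (Or.inr ENNReal.zero_ne_top)
      simpa using this
    have h3 : Tendsto (fun N => 4 * d N + 6 * (d N * c N * (K N)⁻¹)) atTop (𝓝 0) := by
      have := (ENNReal.Tendsto.const_mul H2 (a := 4) (Or.inr (by norm_num))).add
        (ENNReal.Tendsto.const_mul h2 (a := 6) (Or.inr (by norm_num)))
      simpa using this
    have h4 := ((ENNReal.continuous_rpow_const (y := (2⁻¹ : ℝ))).tendsto 0).comp h3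
    rw [ENNReal.zero_rpow_of_pos (by norm_num)] at h4
    simpa using ENNReal.Tendsto.const_mul h4 (a := ENNReal.ofReal (Real.exp t))
      (Or.inr ENNReal.ofReal_ne_top)
  refine tendsto_of_tendsto_of_tendsto_of_le_of_le' tendsto_const_nhds hlim
    (Eventually.of_forall fun N => zero_le) ?_
  filter_upwards [hKt.eventually_lt_const hK't.lt_top,
    hKt.eventually_const_lt (pos_iff_ne_zero.2 hK'0)] with N hKt hK0
  refine iSup₂_le fun η hη => ?_
  have hAD : Disjoint (W N x) (annulus (W N)) :=
    disjoint_compl_right_iff_subset.2 (subset_wells (W N) x)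
  refine ((h.chain N).lintegral_occupationTime_le hAD (h.mem N x) (h.pos N) t hη).trans ?_
  refine mul_le_mul_right (ENNReal.rpow_le_rpow ?_ (by norm_num)) _
  refine add_le_add_right (mul_le_mul_right ?_ _) _
  have hθ0 : (θ N : ℝ≥0∞) ≠ 0 := by simpa using (h.pos N).ne'
  have hθt : (θ N : ℝ≥0∞) ≠ ∞ := ENNReal.coe_ne_top
  have hμ0 : μ N (W N x) ≠ 0 := fun h0 => (h.chain N).measure_ne_zero (ξ N x)
    (measure_mono_null (singleton_subset_iff.2 (h.mem N x)) h0)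
  have hcap := (h.chain N).sum_meanRate_mul_le_capacity (h.disjoint N) ⟨_, h.mem N x⟩
    ⟨ξ N y, subset_otherWells (h.disjoint N) hxy (h.mem N y)⟩
  -- Since K / θ is the total mean rate, the capacity bound reads K / θ ≤ Cap / μ(𝓔^x). It turns the
  -- term with 1/θ into the product of the ratios of (H1) and (H2), divided by K, whose limit is
  -- positive.
  have hinv : (θ N : ℝ≥0∞)⁻¹ ≤ (Q N).capacity (μ N) (W N x) (otherWells (W N) x)
      * (μ N (W N x))⁻¹ * (K N)⁻¹ := by
    rw [← div_eq_mul_inv, ← div_eq_mul_inv, ENNReal.le_div_iff_mul_le (Or.inl hK0.ne')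
      (Or.inl hKt.ne), ENNReal.le_div_iff_mul_le (Or.inl hμ0) (Or.inl (measure_ne_top _ _))]
    refine le_trans (le_of_eq ?_) hcap
    simp only [hK]
    rw [← Finset.mul_sum, ← mul_assoc, ENNReal.inv_mul_cancel hθ0 hθt, one_mul]
  simp only [hd, hc, div_eq_mul_inv]
  calc _ ≤ (Q N).capacity (μ N) (W N x) (otherWells (W N) x) * (μ N (W N x))⁻¹ * (K N)⁻¹ *
        μ N (annulus (W N)) * ((Q N).pointCapacity (μ N) (W N x) (ξ N x))⁻¹ :=
        mul_le_mul_left (mul_le_mul_left hinv _) _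
    _ = _ := by ring

end Negligible

/-! ### Weak convergence on a cube, and convergence in distribution through an encoding -/

section Cube

open BoundedContinuousFunction

variable {ι : Type*} [Countable ι]

/-- The coordinate functions on a cube. -/
def cubeCoord (i : ι) : (ι → unitInterval) →ᵇ ℝ :=
  mkOfCompact ⟨fun a => (a i : ℝ), by fun_prop⟩

/-- On a compact space all families of measures are tight, and the polynomials in the coordinates
form an algebra which separates points, so it suffices to test on them; by linearity, on monomials.
-/
theorem tendsto_of_tendsto_monomials {μ : ℕ → ProbabilityMeasure (ι → unitInterval)}
    {μ₀ : ProbabilityMeasure (ι → unitInterval)}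
    (h : ∀ l : List ι, Tendsto (fun n => ∫ a : ι → unitInterval, (l.map fun i => (a i : ℝ)).prod ∂(μ n : Measure _))
      atTop (𝓝 (∫ a : ι → unitInterval, (l.map fun i => (a i : ℝ)).prod ∂(μ₀ : Measure _)))) :
    Tendsto μ atTop (𝓝 μ₀) := by
  let A : StarSubalgebra ℝ ((ι → unitInterval) →ᵇ ℝ) :=
    { Algebra.adjoin ℝ (range (cubeCoord (ι := ι))) with
      star_mem' := fun {f} hf => by
        have : star f = f := by ext a; simp
        rw [this]; exact hf }
  refine ProbabilityMeasure.tendsto_of_tight_of_separatesPoints ℝ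
    IsTightMeasureSet.of_compactSpace (A := A) ?_ ?_
  · intro a b hab
    obtain ⟨i, hi⟩ := Function.ne_iff.1 hab
    refine ⟨_, ⟨toContinuousMapStarₐ ℝ (cubeCoord i), ⟨cubeCoord i,
      Algebra.subset_adjoin (mem_range_self i), rfl⟩, rfl⟩, ?_⟩
    exact fun h => hi (Subtype.ext h)
  · intro g hg
    have hg' : g ∈ Submodule.span ℝ (Submonoid.closure (range (cubeCoord (ι := ι))) : Set _) := by
      rw [← Algebra.adjoin_eq_span]; exact hg
    induction hg' using Submodule.span_induction with
    | mem f hf =>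
      obtain ⟨l, hl, rfl⟩ := Submonoid.exists_list_of_mem_closure hf
      have : ∃ l' : List ι, l = l'.map cubeCoord := by
        clear hf hg
        induction l with
        | nil => exact ⟨[], rfl⟩
        | cons f l ih =>
          obtain ⟨l', hl'⟩ := ih fun y hy => hl y (List.mem_cons_of_mem _ hy)
          obtain ⟨i, hi⟩ := hl f List.mem_cons_self
          exact ⟨i :: l', by rw [List.map_cons, hi, hl']⟩
      obtain ⟨l', rfl⟩ := this
      have happ : ∀ a, (l'.map cubeCoord).prod a = (l'.map fun i => (a i : ℝ)).prod := by
        intro a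
        clear hf hg hl
        induction l' with
        | nil => simp
        | cons i l' ih =>
          rw [List.map_cons, List.prod_cons, mul_apply, ih, List.map_cons, List.prod_cons]
          rfl
      simp only [happ]
      exact h l'
    | zero => simp
    | add f g hf' hg' ihf ihg =>
      have h1 : ∀ ν : ProbabilityMeasure (ι → unitInterval), ∫ a, (f + g) a ∂(ν : Measure _)
          = ∫ a, f a ∂(ν : Measure _) + ∫ a, g a ∂(ν : Measure _) := fun ν =>
        integral_add (f.integrable _) (g.integrable _)
      simp only [h1]
      refine (ihf ?_).add (ihg ?_)
      · change f ∈ Subalgebra.toSubmodule (Algebra.adjoin ℝ _)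
        rw [Algebra.adjoin_eq_span]; exact hf'
      · change g ∈ Subalgebra.toSubmodule (Algebra.adjoin ℝ _)
        rw [Algebra.adjoin_eq_span]; exact hg'
    | smul c f hf' ihf =>
      have h1 : ∀ ν : ProbabilityMeasure (ι → unitInterval), ∫ a, (c • f) a ∂(ν : Measure _)
          = c * ∫ a, f a ∂(ν : Measure _) := fun ν => integral_const_mul c _
      simp only [h1]
      refine (ihf ?_).const_mul c
      change f ∈ Subalgebra.toSubmodule (Algebra.adjoin ℝ _)
      rw [Algebra.adjoin_eq_span]; exact hf'

end Cube

section Encoding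

variable {K T : Type*} [TopologicalSpace K] [TopologicalSpace T]

/-- A relation `G` between codes and points is continuous if the points related to a code close to
a code of `X` are close to `X`. -/
def IsContinuousCode (G : K → T → Prop) : Prop :=
  ∀ a X, G a X → ∀ U : Set T, IsOpen U → X ∈ U → ∃ V : Set K, IsOpen V ∧ a ∈ V ∧
    ∀ b ∈ V, ∀ Y, G b Y → Y ∈ U

/-- The codes which force the encoded point to be in `U`. -/
def forcedCodes (G : K → T → Prop) (U : Set T) : Set K :=
  ⋃₀ {V | IsOpen V ∧ ∀ b ∈ V, ∀ Y, G b Y → Y ∈ U}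

theorem isOpen_forcedCodes {T : Type*} (G : K → T → Prop) (U : Set T) : IsOpen (forcedCodes G U) :=
  isOpen_sUnion fun _ h => h.1

theorem IsContinuousCode.mem_iff {G : K → T → Prop} (hG : IsContinuousCode G) {U : Set T}
    (hU : IsOpen U) {a : K} {X : T} (h : G a X) : a ∈ forcedCodes G U ↔ X ∈ U := by
  constructor
  · rintro ⟨V, hV, ha⟩
    exact hV.2 a ha X h
  · intro hX
    obtain ⟨V, h1, h2, h3⟩ := hG a X h U hU hX
    exact ⟨V, ⟨h1, h3⟩, h2⟩

variable [MeasurableSpace K] [BorelSpace K] [MeasurableSpace T] [BorelSpace T]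

/-- The map `X` itself is not known to be measurable. Off a null set the preimage of an open set is
the preimage under D of an open set of codes. -/
theorem IsContinuousCode.aemeasurable {G : K → T → Prop} (hG : IsContinuousCode G) {Ω : Type*}
    [MeasurableSpace Ω] {P : Measure Ω} [NeZero P] {D : Ω → K} (hD : Measurable D) {X : Ω → T}
    (h : ∀ᵐ ω ∂P, G (D ω) (X ω)) : AEMeasurable X P := by
  classical
  obtain ⟨s, hs, hms, hPs⟩ := exists_measurable_superset_of_null (ae_iff.1 h)
  obtain ⟨ω₀⟩ : Nonempty Ω := P.nonempty_of_neZero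
  have hG' : ∀ ω ∉ s, G (D ω) (X ω) := fun ω hω => by
    by_contra hn
    exact hω (hs hn)
  refine ⟨s.piecewise (fun _ => X ω₀) X, measurable_of_isOpen fun U hU => ?_, ?_⟩
  · have : s.piecewise (fun _ => X ω₀) X ⁻¹' U
        = s ∩ {_ω | X ω₀ ∈ U} ∪ sᶜ ∩ D ⁻¹' forcedCodes G U := by
      ext ω
      by_cases hω : ω ∈ s
      · simp [hω]
      · simp [hω, hG.mem_iff hU (hG' ω hω)]
    rw [this]
    exact (hms.inter (MeasurableSet.const _)).union
      (hms.compl.inter (hD (isOpen_forcedCodes G U).measurableSet))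
  · have : ∀ᵐ ω ∂P, ω ∉ s := measure_eq_zero_iff_ae_notMem.1 hPs
    filter_upwards [this] with ω hω
    simp [hω]

theorem IsContinuousCode.map_apply {G : K → T → Prop} (hG : IsContinuousCode G) {Ω : Type*}
    [MeasurableSpace Ω] {P : Measure Ω} {D : Ω → K} (hD : Measurable D) {X : Ω → T}
    (hX : AEMeasurable X P) (h : ∀ᵐ ω ∂P, G (D ω) (X ω)) {U : Set T} (hU : IsOpen U) :
    P.map X U = P.map D (forcedCodes G U) := by
  rw [Measure.map_apply_of_aemeasurable hX hU.measurableSet,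
    Measure.map_apply hD (isOpen_forcedCodes G U).measurableSet]
  refine measure_congr ?_
  filter_upwards [h] with ω hω
  exact propext (hG.mem_iff hU hω).symm

/-- A continuous mapping theorem for a relation: most points of the cube encode no path, so there is
no map to apply. The portmanteau criterion by open sets only sees U through the open set
`forcedCodes G U`. -/
theorem IsContinuousCode.tendstoInDistribution [HasOuterApproxClosed K] {G : K → T → Prop}
    (hG : IsContinuousCode G) {Ω : ℕ → Type*} [∀ N, MeasurableSpace (Ω N)]
    {P : ∀ N, Measure (Ω N)} [∀ N, IsProbabilityMeasure (P N)] {Ω' : Type*} [MeasurableSpace Ω']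
    {P' : Measure Ω'} [IsProbabilityMeasure P'] {D : ∀ N, Ω N → K} {D' : Ω' → K}
    {X : ∀ N, Ω N → T} {X' : Ω' → T} (hX : ∀ N, ∀ᵐ ω ∂P N, G (D N ω) (X N ω))
    (hX' : ∀ᵐ ω ∂P', G (D' ω) (X' ω)) (hD : TendstoInDistribution D atTop D' P P')
    (hm : ∀ N, Measurable (D N)) (hm' : Measurable D') :
    TendstoInDistribution X atTop X' P P' := by
  have hXm : ∀ N, AEMeasurable (X N) (P N) := fun N => hG.aemeasurable (hm N) (hX N)
  have hXm' : AEMeasurable X' P' := hG.aemeasurable hm' hX'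
  refine ⟨hXm, hXm', tendsto_of_forall_isOpen_le_liminf' fun U hU => ?_⟩
  have h1 := ProbabilityMeasure.le_liminf_measure_open_of_tendsto hD.tendsto
    (isOpen_forcedCodes G U)
  have h2 : ∀ N, (P N).map (X N) U = (P N).map (D N) (forcedCodes G U) := fun N =>
    hG.map_apply (hm N) (hXm N) (hX N) hU
  simp only [ProbabilityMeasure.coe_mk] at h1 ⊢
  rw [hG.map_apply hm' hXm' hX' hU]
  simp only [h2]
  exact h1

end Encoding

/-! ### Step paths and the Skorohod topology -/

/-- The map is piecewise linear: the identity up to p, the translation by v - u from u on, and in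
between of slope (v - p) / (u - p) > 0. The ramp c rises from 0 at p to 1 at u. -/
theorem exists_orderIso_shift {p u v : ℝ} (hu : p < u) (hv : p < v) :
    ∃ g : ℝ ≃o ℝ, (∀ s ≤ p, g s = s) ∧ (∀ s, u ≤ s → g s = s + (v - u)) ∧
      ∀ s, |g s - s| ≤ |v - u| := by
  set c : ℝ → ℝ := fun s => max 0 (min 1 ((s - p) / (u - p))) with hc
  have hc0 : ∀ s, 0 ≤ c s := fun s => le_max_left _ _
  have hc1 : ∀ s, c s ≤ 1 := fun s => max_le zero_le_one (min_le_left _ _)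
  have hup : 0 < u - p := sub_pos.2 hu
  have hcm : ∀ s s', s ≤ s' → c s ≤ c s' := fun s s' h => by
    simp only [hc]; gcongr
  have hcl : ∀ s s', s ≤ s' → (c s' - c s) * (u - p) ≤ s' - s := by
    intro s s' h
    have h1 : (s' - p) / (u - p) = (s - p) / (u - p) + (s' - s) / (u - p) := by
      rw [← add_div]; congr 1; ring
    have h2 : 0 ≤ (s' - s) / (u - p) := div_nonneg (by linarith) hup.le
    rw [← le_div_iff₀ hup]
    simp only [hc, h1]
    generalize (s - p) / (u - p) = x at *
    generalize (s' - s) / (u - p) = y at *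
    rcases le_total 1 (x + y) with h3 | h3 <;> rcases le_total 1 x with h4 | h4 <;>
      rcases le_total 0 x with h5 | h5 <;> rcases le_total 0 (x + y) with h6 | h6 <;>
      simp [h3, h4, h5, h6] <;> linarith
  set f : ℝ → ℝ := fun s => s + (v - u) * c s with hf
  have hbd : ∀ s, |f s - s| ≤ |v - u| := by
    intro s
    simp only [hf, add_sub_cancel_left, abs_mul, abs_of_nonneg (hc0 s)]
    exact mul_le_of_le_one_right (abs_nonneg _) (hc1 s)
  have hmono : StrictMono f := by
    intro s s' h
    simp only [hf]
    have h1 := hcm s s' h.le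
    have h2 := hcl s s' h.le
    rcases h1.eq_or_lt with h3 | h3
    · rw [h3]; linarith
    · nlinarith [mul_pos (sub_pos.2 hv) (sub_pos.2 h3)]
  have hcont : Continuous f := by
    simp only [hf, hc]; fun_prop
  have hsurj : Function.Surjective f := by
    refine hcont.surjective ?_ ?_
    · refine tendsto_atTop_mono (f := fun s => s + -|v - u|) (fun s => ?_)
        (tendsto_atTop_add_const_right _ _ tendsto_id)
      have := (abs_le.1 (hbd s)).1
      linarith
    · have hbot : Tendsto (fun s : ℝ => s + |v - u|) atBot atBot :=
        tendsto_atBot_add_const_right _ _ tendsto_id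
      refine tendsto_atBot_mono (fun s => ?_) hbot
      have := (abs_le.1 (hbd s)).2
      linarith
  refine ⟨StrictMono.orderIsoOfSurjective f hmono hsurj, fun s hs => ?_, fun s hs => ?_, hbd⟩
  · change f s = s
    have : c s = 0 := max_eq_left ((min_le_right _ _).trans
      (div_nonpos_of_nonpos_of_nonneg (by linarith) hup.le))
    simp [hf, this]
  · change f s = s + (v - u)
    have h1 : 1 ≤ (s - p) / (u - p) := by rw [le_div_iff₀ hup]; linarith
    have : c s = 1 := by simp [hc, min_eq_left h1]
    simp [hf, this]

theorem exists_orderIso_nodes {p p' : ℕ → ℝ} (h0 : p 0 = p' 0) {δ : ℝ} (n : ℕ)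
    (hp : ∀ i < n, p i < p (i + 1)) (hp' : ∀ i < n, p' i < p' (i + 1))
    (hδ : ∀ i ≤ n, |p' i - p i| ≤ δ) :
    ∃ l : ℝ ≃o ℝ, (∀ i ≤ n, l (p' i) = p i) ∧ (∀ s, |l s - s| ≤ 2 * n * δ) ∧
      ∀ s, p' n ≤ s → l s = s + (p n - p' n) := by
  induction n with
  | zero =>
    refine ⟨OrderIso.refl ℝ, fun i hi => ?_, fun s => by simp, fun s _ => by simp [h0]⟩
    rw [Nat.le_zero.1 hi]; exact h0.symm
  | succ n ih =>
    obtain ⟨l, h1, h2, h3⟩ := ih (fun i hi => hp i (by omega)) (fun i hi => hp' i (by omega))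
      (fun i hi => hδ i (by omega))
    have hpn := hp n (by omega)
    have hpn' := hp' n (by omega)
    -- After its last node l is a translation, so it puts the next node at p' (n + 1) + (p n - p'
    -- n). The correction g moves it to p (n + 1) and fixes all earlier nodes; its displacement is
    -- at most 2δ, hence the total 2nδ.
    obtain ⟨g, g1, g2, g3⟩ := exists_orderIso_shift (p := p n) (u := p' (n + 1) + (p n - p' n))
      (v := p (n + 1)) (by linarith) hpn
    have hmono : ∀ i ≤ n, p i ≤ p n := by
      intro i hi
      rcases Nat.exists_eq_add_of_le hi with ⟨k, rfl⟩
      clear hi g1 g2 g3 g h1 h2 h3 l ih hδ hp' hpn hpn'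
      induction k with
      | zero => simp
      | succ k ih => exact (ih fun j hj => hp j (by omega)).trans (hp (i + k) (by omega)).le
    have hlast : ∀ s, p' (n + 1) ≤ s → g (l s) = s + (p (n + 1) - p' (n + 1)) := by
      intro s hs
      rw [h3 s (by linarith), g2 _ (by linarith)]
      ring
    refine ⟨l.trans g, fun i hi => ?_, fun s => ?_, hlast⟩
    · rcases Nat.lt_or_ge n i with h | h
      · have : i = n + 1 := by omega
        subst this
        change g (l _) = _
        rw [hlast _ le_rfl]; ring
      · change g (l _) = _
        rw [h1 i h, g1 _ (hmono i h)]
    · change |g (l s) - s| ≤ _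
      have e1 := abs_le.1 (g3 (l s))
      have e2 := abs_le.1 (h2 s)
      have e3 := abs_le.1 (hδ n (by omega))
      have e4 := abs_le.1 (hδ (n + 1) le_rfl)
      have e5 : |p (n + 1) - (p' (n + 1) + (p n - p' n))| ≤ 2 * δ := by
        rw [abs_le]; constructor <;> linarith
      push_cast
      rw [abs_le]
      constructor <;> linarith

/-- The restriction to `ℝ₊` of an increasing bijection of the line fixing the origin. -/
def OrderIso.restrictNNReal (l : ℝ ≃o ℝ) (h : l 0 = 0) : ℝ≥0 ≃o ℝ≥0 where
  toFun s := ⟨l s, by rw [← h]; exact l.monotone s.2⟩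
  invFun s := ⟨l.symm s, by
    have : l.symm 0 = 0 := by rw [OrderIso.symm_apply_eq, h]
    rw [← this]; exact l.symm.monotone s.2⟩
  left_inv s := NNReal.eq (l.symm_apply_apply s)
  right_inv s := NNReal.eq (l.apply_symm_apply s)
  map_rel_iff' {s t} := by
    change l s ≤ l t ↔ _
    rw [l.le_iff_le, NNReal.coe_le_coe]

variable {S : Type*}

/-- The path `f` takes the value `x i` on `[t i, t (i + 1))`, and the times `t i` increase strictly
to infinity (which may be reached after finitely many steps). -/
structure IsStepPath (x : ℕ → S) (t : ℕ → ℝ≥0∞) (f : ℝ≥0 → Option S) : Prop where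
  zero : t 0 = 0
  lt : ∀ i, t i ≠ ∞ → t i < t (i + 1)
  iSup_eq : ⨆ i, t i = ∞
  eq : ∀ i (s : ℝ≥0), t i ≤ s → s < t (i + 1) → f s = some (x i)

namespace IsStepPath

variable {x : ℕ → S} {t : ℕ → ℝ≥0∞} {f : ℝ≥0 → Option S}

theorem exists_index (h : IsStepPath x t f) (s : ℝ≥0) :
    ∃ n, (∀ i ≤ n, t i ≤ s) ∧ s < t (n + 1) := by
  classical
  have hex : ∃ i, (s : ℝ≥0∞) < t i := by
    rw [← lt_iSup_iff, h.iSup_eq]; exact ENNReal.coe_lt_top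
  have hpos : Nat.find hex ≠ 0 := by
    intro h0
    have := Nat.find_spec hex
    rw [h0, h.zero] at this
    exact absurd this not_lt_zero
  obtain ⟨n, hn⟩ := Nat.exists_eq_succ_of_ne_zero hpos
  refine ⟨n, fun i hi => not_lt.1 (Nat.find_min hex (by omega)), ?_⟩
  rw [← Nat.succ_eq_add_one, ← hn]
  exact Nat.find_spec hex

theorem isCadlag (h : IsStepPath x t f) : IsCadlag f := by
  intro s
  obtain ⟨n, hn, hn'⟩ := h.exists_index s
  constructor
  · have : ∀ᶠ s' : ℝ≥0 in 𝓝 s, (s' : ℝ≥0∞) < t (n + 1) :=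
      (ENNReal.continuous_coe.tendsto s).eventually_lt_const hn'
    filter_upwards [nhdsWithin_le_nhds this, self_mem_nhdsWithin] with s' h1 h2
    rw [h.eq n s (hn n le_rfl) hn', h.eq n s' ((hn n le_rfl).trans
      (by exact_mod_cast (le_of_lt h2))) h1]
  · rcases (hn n le_rfl).eq_or_lt with heq | hlt
    · rcases n with _ | n
      -- At time 0 there are no earlier times, so any value serves as the left limit.
      · refine ⟨none, ?_⟩
        rw [h.zero] at heq
        have hs : s = 0 := by exact_mod_cast heq.symm
        subst hs
        filter_upwards [self_mem_nhdsWithin] with s' h1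
        exact absurd (mem_Iio.1 h1) not_lt_zero
      · refine ⟨some (x n), ?_⟩
        have hlt : t n < s := by
          rw [← heq]
          exact h.lt n (ne_top_of_le_ne_top ENNReal.coe_ne_top (hn n (by omega)))
        have : ∀ᶠ s' : ℝ≥0 in 𝓝 s, t n < (s' : ℝ≥0∞) :=
          (ENNReal.continuous_coe.tendsto s).eventually_const_lt hlt
        filter_upwards [nhdsWithin_le_nhds this, self_mem_nhdsWithin] with s' h1 h2
        refine h.eq n s' h1.le ?_
        rw [heq]
        exact_mod_cast h2
    · refine ⟨some (x n), ?_⟩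
      have : ∀ᶠ s' : ℝ≥0 in 𝓝 s, t n < (s' : ℝ≥0∞) :=
        (ENNReal.continuous_coe.tendsto s).eventually_const_lt hlt
      filter_upwards [nhdsWithin_le_nhds this, self_mem_nhdsWithin] with s' h1 h2
      refine h.eq n s' h1.le (lt_trans ?_ hn')
      exact_mod_cast h2

end IsStepPath

open Classical in
/-- The numbers `a (i, y) = exp(-t_i) 1{x_i = y}` encode the step path `X`. -/
def IsStepCode (a : ℕ × S → unitInterval) (X : SkorohodSpace (Option S)) : Prop :=
  ∃ (x : ℕ → S) (t : ℕ → ℝ≥0∞), IsStepPath x t X.toFun ∧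
    ∀ i y, ENNReal.ofReal (a (i, y)) = if x i = y then expNeg (t i) else 0

/-- Up to time T a path is described by finitely many steps. A nearby code has the same first
states, jump times close to the original ones, and its next jump after T; a time change matching the
jump times then places its path in the given Skorohod neighbourhood. -/
theorem isContinuousCode_isStepCode [Finite S] : IsContinuousCode (IsStepCode (S := S)) := by
  classical
  rintro a X ⟨x, t, hX, hcode⟩ U hU hXU
  obtain ⟨T, ε, hε, hTU⟩ := hU X hXU
  obtain ⟨n, hn, hn'⟩ := hX.exists_index T
  have htop : ∀ i ≤ n, t i ≠ ∞ := fun i hi => ne_top_of_le_ne_top ENNReal.coe_ne_top (hn i hi)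
  set p : ℕ → ℝ := fun i => (t i).toReal with hp
  -- The margin ρ before t (n + 1) allows the time change to carry T slightly beyond T without
  -- meeting the next jump.
  obtain ⟨ρ, hρ0, hρ⟩ : ∃ ρ : ℝ, 0 < ρ ∧ ENNReal.ofReal (T + ρ) < t (n + 1) := by
    obtain ⟨q, hq1, hq2⟩ := ENNReal.lt_iff_exists_nnreal_btwn.1 hn'
    refine ⟨q - T, sub_pos.2 (by exact_mod_cast hq1), ?_⟩
    rwa [add_sub_cancel, ENNReal.ofReal_coe_nnreal]
  -- The time change through n nodes displaces points by at most 2nδ, which must stay below both ε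
  -- and ρ.
  set δ : ℝ := min ε ρ / (2 * n + 1) with hδ
  have hm : 0 < min ε ρ := lt_min hε hρ0
  have hn1 : (0 : ℝ) < 2 * n + 1 := by positivity
  have hδ0 : 0 < δ := div_pos hm hn1
  have hδm : 2 * n * δ < min ε ρ := by
    have : (2 * n + 1) * δ = min ε ρ := by rw [hδ]; field_simp
    nlinarith
  -- A positive coordinate (i, x i) forces the i-th state, and its size locates the i-th time within
  -- δ. Small coordinates of index n + 1 force the next jump after T, whatever state it leads to;
  -- finiteness of S keeps this condition open.
  refine ⟨{b | (∀ i ∈ Finset.range (n + 1), Real.exp (-(p i + δ)) < b (i, x i) ∧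
      (b (i, x i) : ℝ) < Real.exp (-(p i - δ))) ∧ ∀ y, (b (n + 1, y) : ℝ) < Real.exp (-T)},
    ?_, ?_, ?_⟩
  · have hev : ∀ c : ℕ × S, Continuous fun b : ℕ × S → unitInterval => (b c : ℝ) := fun c =>
      continuous_subtype_val.comp (continuous_apply c)
    have h1 : IsOpen {b : ℕ × S → unitInterval | ∀ i ∈ Finset.range (n + 1),
        Real.exp (-(p i + δ)) < b (i, x i) ∧ (b (i, x i) : ℝ) < Real.exp (-(p i - δ))} := by
      simp only [ofPred_forall]
      refine isOpen_biInter_finset fun i _ => IsOpen.inter ?_ ?_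
      · exact isOpen_lt continuous_const (hev _)
      · exact isOpen_lt (hev _) continuous_const
    have h2 : IsOpen {b : ℕ × S → unitInterval | ∀ y, (b (n + 1, y) : ℝ) < Real.exp (-T)} := by
      simp only [ofPred_forall]
      exact isOpen_iInter_of_finite fun y => isOpen_lt (hev _) continuous_const
    exact h1.inter h2
  · constructor
    · intro i hi
      have hi' : i ≤ n := by simpa [Nat.lt_succ_iff] using hi
      have h1 := hcode i (x i)
      rw [if_pos rfl, expNeg_of_ne_top (htop i hi'),
        ENNReal.ofReal_eq_ofReal_iff (a (i, x i)).2.1 (Real.exp_pos _).le] at h1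
      rw [h1]
      exact ⟨Real.exp_lt_exp.2 (by simp only [hp]; linarith),
        Real.exp_lt_exp.2 (by simp only [hp]; linarith)⟩
    · intro y
      have h1 := hcode (n + 1) y
      have h2 : ENNReal.ofReal (a (n + 1, y)) < ENNReal.ofReal (Real.exp (-T)) := by
        rw [h1, ← expNeg_coe]
        split_ifs
        · exact expNeg_lt_expNeg hn'
        · rw [pos_iff_ne_zero, Ne, expNeg_eq_zero_iff]; exact ENNReal.coe_ne_top
      exact (ENNReal.ofReal_lt_ofReal_iff (Real.exp_pos _)).1 h2
  · rintro b ⟨hb1, hb2⟩ Y ⟨x', t', hY, hcode'⟩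
    refine hTU ?_
    have hnode : ∀ i ≤ n, x' i = x i ∧ t' i ≠ ∞ ∧ |(t' i).toReal - p i| ≤ δ := by
      intro i hi
      obtain ⟨h1, h2⟩ := hb1 i (by simpa [Nat.lt_succ_iff] using hi)
      have h3 := hcode' i (x i)
      have hbpos : 0 < (b (i, x i) : ℝ) := (Real.exp_pos _).trans h1
      have hxe : x' i = x i := by
        by_contra hne
        rw [if_neg hne, ENNReal.ofReal_eq_zero] at h3
        linarith
      have ht' : t' i ≠ ∞ := by
        intro ht
        rw [if_pos hxe, ht, expNeg_eq_zero_iff.2 rfl, ENNReal.ofReal_eq_zero] at h3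
        linarith
      rw [if_pos hxe, expNeg_of_ne_top ht',
        ENNReal.ofReal_eq_ofReal_iff hbpos.le (Real.exp_pos _).le] at h3
      rw [h3, Real.exp_lt_exp] at h1 h2
      exact ⟨hxe, ht', abs_le.2 ⟨by linarith, by linarith⟩⟩
    have hlast : (T : ℝ≥0∞) < t' (n + 1) := by
      have h3 := hcode' (n + 1) (x' (n + 1))
      have h4 := (ENNReal.ofReal_lt_ofReal_iff (Real.exp_pos _)).2 (hb2 (x' (n + 1)))
      rw [h3, if_pos rfl, ← expNeg_coe] at h4
      exact strictAnti_expNeg.lt_iff_gt.1 h4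
    have hltp : ∀ i < n, p i < p (i + 1) := fun i hi =>
      (ENNReal.toReal_lt_toReal (htop i hi.le) (htop (i + 1) hi)).2 (hX.lt i (htop i hi.le))
    have hltp' : ∀ i < n, (t' i).toReal < (t' (i + 1)).toReal := fun i hi =>
      (ENNReal.toReal_lt_toReal (hnode i hi.le).2.1 (hnode (i + 1) hi).2.1).2
        (hY.lt i (hnode i hi.le).2.1)
    have h0 : p 0 = (t' 0).toReal := by simp only [hp]; rw [hX.zero, hY.zero]
    obtain ⟨l, hl1, hl2, -⟩ := exists_orderIso_nodes h0 n hltp hltp' fun i hi => (hnode i hi).2.2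
    have hl0 : l 0 = 0 := by
      have := hl1 0 n.zero_le
      rwa [hY.zero, show p 0 = 0 by simp only [hp]; rw [hX.zero]; rfl, ENNReal.toReal_zero] at this
    refine ⟨l.restrictNNReal hl0, fun s hs => ?_⟩
    have hls : ((l.restrictNNReal hl0 s : ℝ≥0) : ℝ) = l s := rfl
    refine ⟨?_, ?_⟩
    · rw [NNReal.dist_eq, hls]
      exact (hl2 s).trans_lt (hδm.trans_le (min_le_left _ _))
    · obtain ⟨m, hm1, hm2⟩ := hY.exists_index s
      have hmn : m ≤ n := by
        by_contra hlt
        have := (hm1 (n + 1) (by omega)).trans (show (s : ℝ≥0∞) ≤ T by exact_mod_cast hs)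
        exact absurd (hlast.trans_le this) (lt_irrefl _)
      rw [hY.eq m s (hm1 m le_rfl) hm2, (hnode m hmn).1]
      refine (hX.eq m _ ?_ ?_).symm
      · rw [← ENNReal.ofReal_toReal (htop m hmn), ← ENNReal.ofReal_coe_nnreal]
        refine ENNReal.ofReal_le_ofReal ?_
        rw [hls]
        change p m ≤ _
        rw [← hl1 m hmn]
        exact l.monotone (ENNReal.toReal_le_coe_of_le_coe (hm1 m le_rfl))
      · rcases hmn.eq_or_lt with rfl | hlt
        · refine lt_of_le_of_lt ?_ hρ
          rw [← ENNReal.ofReal_coe_nnreal, hls]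
          refine ENNReal.ofReal_le_ofReal ?_
          have h1 := (abs_le.1 (hl2 s)).2
          have h2 : (s : ℝ) ≤ T := by exact_mod_cast hs
          have h3 := hδm.trans_le (min_le_right _ _)
          linarith
        · rw [← ENNReal.ofReal_toReal (htop (m + 1) hlt), ← ENNReal.ofReal_coe_nnreal, hls]
          have hls' : l s < p (m + 1) := by
            rw [← hl1 (m + 1) hlt]
            refine l.strictMono ?_
            have := (ENNReal.toReal_lt_toReal ENNReal.coe_ne_top (hnode (m + 1) hlt).2.1).2 hm2
            rwa [ENNReal.coe_toReal] at this
          refine (ENNReal.ofReal_lt_ofReal_iff ?_).2 hls'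
          refine lt_of_le_of_lt ?_ hls'
          rw [← hl0]
          exact l.monotone s.2

/-! ### Exit from a well -/

namespace RateMatrix

variable {E S : Type*} (Q : RateMatrix E) (W : S → Set E)

theorem traceTime_shift (A : Set E) (ω : (ℕ → E) × (ℕ → ℝ)) (n : ℕ) :
    Q.traceTime A ω (n + 1)
      = A.indicator (fun _ => Q.holdingTime ω 0) (ω.1 0) + Q.traceTime A (shift ω) n := by
  rw [traceTime, Finset.sum_range_succ', add_comm]
  rfl

open Classical in
/-- The time spent in the wells before the first visit of a well other than `W x`. -/
def exitTime (x : S) (ω : (ℕ → E) × (ℕ → ℝ)) : ℝ≥0∞ :=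
  if h : ∃ n, ω.1 n ∈ otherWells W x then Q.traceTime (wells W) ω (Nat.find h) else ∞

open Classical in
/-- The path after the first visit of a well other than `W x`. -/
def exitPath (x : S) (ω : (ℕ → E) × (ℕ → ℝ)) : (ℕ → E) × (ℕ → ℝ) :=
  if h : ∃ n, ω.1 n ∈ otherWells W x then shift^[Nat.find h] ω else ω

/-- The functional `exp(-b τ) G(ω')`, where `τ` is the exit time of `W x` and `ω'` is the path
after the exit. -/
def exitFun (b : ℝ≥0∞) (x : S) (G : (ℕ → E) × (ℕ → ℝ) → ℝ≥0∞) (ω : (ℕ → E) × (ℕ → ℝ)) : ℝ≥0∞ :=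
  expNeg (b * Q.exitTime W x ω) * G (exitPath W x ω)

variable {Q W} {x : S} {ω : (ℕ → E) × (ℕ → ℝ)}

theorem exitFun_of_mem (h : ω.1 0 ∈ otherWells W x) (b : ℝ≥0∞)
    (G : (ℕ → E) × (ℕ → ℝ) → ℝ≥0∞) : Q.exitFun W b x G ω = G ω := by
  classical
  have hex : ∃ n, ω.1 n ∈ otherWells W x := ⟨0, h⟩
  have h0 : Nat.find hex = 0 := (Nat.find_eq_zero hex).2 h
  rw [exitFun, exitTime, exitPath, dif_pos hex, dif_pos hex, h0, traceTime_zero, mul_zero,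
    expNeg_zero, one_mul, Function.iterate_zero_apply]

/-- If no other well is ever visited, the exit time is infinite; `b ≠ 0` then makes both sides
vanish. -/
theorem exitFun_shift (h : ω.1 0 ∉ otherWells W x) {b : ℝ≥0∞} (hb : b ≠ 0)
    (G : (ℕ → E) × (ℕ → ℝ) → ℝ≥0∞) : Q.exitFun W b x G ω
      = expNeg (b * (wells W).indicator (fun _ => Q.holdingTime ω 0) (ω.1 0))
        * Q.exitFun W b x G (shift ω) := by
  classical
  by_cases hex : ∃ n, ω.1 n ∈ otherWells W x
  · have hex' : ∃ n, (shift ω).1 n ∈ otherWells W x := by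
      obtain ⟨_ | n, hn⟩ := hex
      · exact absurd hn h
      · exact ⟨n, hn⟩
    have hfind : Nat.find hex = Nat.find hex' + 1 := Nat.find_comp_succ hex hex' h
    rw [exitFun, exitFun, exitTime, exitTime, exitPath, exitPath, dif_pos hex, dif_pos hex,
      dif_pos hex', dif_pos hex', hfind, traceTime_shift, mul_add, expNeg_add, mul_assoc,
      Function.iterate_succ_apply]
  · have hex' : ¬ ∃ n, (shift ω).1 n ∈ otherWells W x := fun ⟨n, hn⟩ => hex ⟨n + 1, hn⟩
    rw [exitFun, exitFun, exitTime, exitTime, dif_neg hex, dif_neg hex', ENNReal.mul_top hb,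
      expNeg_eq_zero_iff.2 rfl, zero_mul, zero_mul, mul_zero]

theorem measurable_traceTime [MeasurableSpace E] [DiscreteMeasurableSpace E] (A : Set E) (n : ℕ) :
    Measurable fun ω => Q.traceTime A ω n := by
  refine Finset.measurable_sum _ fun i _ => ?_
  have h1 : (fun ω : (ℕ → E) × (ℕ → ℝ) => A.indicator (fun _ => Q.holdingTime ω i) (ω.1 i))
      = fun ω => A.indicator (fun _ => 1) (ω.1 i) * Q.holdingTime ω i := by
    funext ω
    by_cases h : ω.1 i ∈ A <;> simp [h]
  rw [h1]
  exact ((measurable_one.indicator MeasurableSet.of_discrete).comp (measurable_fst_apply i)).mul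
    (Q.measurable_holdingTime i)

theorem measurable_exitFun [MeasurableSpace E] [DiscreteMeasurableSpace E] {b : ℝ≥0∞} (hb : b ≠ 0)
    (x : S) {G : (ℕ → E) × (ℕ → ℝ) → ℝ≥0∞} (hG : Measurable G) :
    Measurable (Q.exitFun W b x G) := by
  classical
  set A : ℕ → Set ((ℕ → E) × (ℕ → ℝ)) := fun n =>
    (fun ω : (ℕ → E) × (ℕ → ℝ) => ω.1 n) ⁻¹' otherWells W x ∩
      ⋂ k ∈ Iio n, (fun ω : (ℕ → E) × (ℕ → ℝ) => ω.1 k) ⁻¹' (otherWells W x)ᶜ with hA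
  have hAm : ∀ n, MeasurableSet (A n) := fun n => MeasurableSet.inter
    (measurable_fst_apply n MeasurableSet.of_discrete)
    (MeasurableSet.biInter (to_countable _) fun k _ =>
      measurable_fst_apply k MeasurableSet.of_discrete)
  have hmem : ∀ n ω, ω ∈ A n ↔ ω.1 n ∈ otherWells W x ∧ ∀ k < n, ω.1 k ∉ otherWells W x := by
    intro n ω; simp [hA]
  have : Q.exitFun W b x G = fun ω => ∑' n, (A n).indicator
      (fun ω => expNeg (b * Q.traceTime (wells W) ω n) * G (shift^[n] ω)) ω := by
    funext ω
    by_cases hex : ∃ n, ω.1 n ∈ otherWells W x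
    · rw [tsum_eq_single (Nat.find hex)]
      · rw [indicator_of_mem, exitFun, exitTime, exitPath, dif_pos hex, dif_pos hex]
        exact (hmem _ _).2 ⟨Nat.find_spec hex, fun k hk => Nat.find_min hex hk⟩
      · intro n hn
        rw [indicator_of_notMem]
        intro hω
        obtain ⟨h1, h2⟩ := (hmem _ _).1 hω
        exact hn ((Nat.find_eq_iff hex).2 ⟨h1, h2⟩).symm
    · rw [exitFun, exitTime, dif_neg hex, ENNReal.mul_top hb, expNeg_eq_zero_iff.2 rfl, zero_mul,
        ENNReal.tsum_eq_zero.2]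
      intro n
      rw [indicator_of_notMem]
      exact fun hω => hex ⟨n, ((hmem _ _).1 hω).1⟩
  rw [this]
  refine Measurable.tsum fun n => Measurable.indicator ?_ (hAm n)
  exact (measurable_expNeg.comp ((measurable_traceTime _ n).const_mul b)).mul
    (hG.comp (measurable_shift.iterate n))

section Dirichlet

variable [Countable E] [MeasurableSpace E] [DiscreteMeasurableSpace E]

theorem lintegral_exitFun_of_mem_otherWells {η : E} (hη : η ∈ otherWells W x) (b : ℝ≥0∞)
    (G : (ℕ → E) × (ℕ → ℝ) → ℝ≥0∞) :
    ∫⁻ ω, Q.exitFun W b x G ω ∂Q.law η = ∫⁻ ω, G ω ∂Q.law η := by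
  refine lintegral_congr_ae ?_
  filter_upwards [Q.law_zero η] with ω h0
  exact exitFun_of_mem (by rwa [h0]) b G

/-- With its two neighbours this is the Dirichlet problem to which `MetastableSetting.uniformLimit`
applies: a resolvent equation on the well, harmonicity off the wells, and prescribed values on the
other wells. -/
theorem lintegral_exitFun_of_mem {η : E} (hη : η ∈ W x) {b : ℝ≥0∞} (hb : b ≠ 0) (hb' : b ≠ ∞)
    {G : (ℕ → E) × (ℕ → ℝ) → ℝ≥0∞} (hG : Measurable G) :
    ∫⁻ ω, Q.exitFun W b x G ω ∂Q.law η = Q.exitRate η / (Q.exitRate η + b) *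
      Q.jumpOp (fun ζ => ∫⁻ ω, Q.exitFun W b x G ω ∂Q.law ζ) η := by
  rw [← Q.lintegral_expNeg_mul_shift η hb hb' (measurable_exitFun hb x hG)]
  refine lintegral_congr_ae ?_
  filter_upwards [Q.law_zero η] with ω h0
  have h1 : ω.1 0 ∉ otherWells W x := fun h => h.2 (by rwa [h0])
  rw [exitFun_shift h1 hb, indicator_of_mem]
  rw [h0]
  exact subset_wells W x hη

theorem lintegral_exitFun_of_notMem {η : E} (hη : η ∉ wells W) {b : ℝ≥0∞} (hb : b ≠ 0)
    {G : (ℕ → E) × (ℕ → ℝ) → ℝ≥0∞} (hG : Measurable G) :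
    ∫⁻ ω, Q.exitFun W b x G ω ∂Q.law η =
      Q.jumpOp (fun ζ => ∫⁻ ω, Q.exitFun W b x G ω ∂Q.law ζ) η := by
  rw [← Q.lintegral_law_comp_shift η (measurable_exitFun hb x hG)]
  refine lintegral_congr_ae ?_
  filter_upwards [Q.law_zero η] with ω h0
  have h1 : ω.1 0 ∉ otherWells W x := fun h => hη (by rw [← h0]; exact h.1)
  rw [exitFun_shift h1 hb, indicator_of_notMem (by rwa [h0]), mul_zero, expNeg_zero, one_mul]

end Dirichlet

/-! ### The code of the sequence of visited wells -/

section Code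

variable [Fintype S]

variable (Q W) in
/-- The code `exp(-s t_i) 1{x_i = y}` of the path, where `x_i` are the successively visited wells
and `t_i` the times spent in the wells before these visits. -/
def wellCode (s : ℝ≥0∞) : ℕ → S → ((ℕ → E) × (ℕ → ℝ)) → ℝ≥0∞
  | 0, y, ω => (W y).indicator 1 (ω.1 0)
  | i + 1, y, ω => ∑ x, (W x).indicator 1 (ω.1 0) * Q.exitFun W s x (wellCode s i y) ω

theorem wellCode_succ (hW : Pairwise fun x y => Disjoint (W x) (W y)) (hx : ω.1 0 ∈ W x)
    (s : ℝ≥0∞) (i : ℕ) (y : S) :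
    Q.wellCode W s (i + 1) y ω = Q.exitFun W s x (Q.wellCode W s i y) ω := by
  rw [wellCode, Finset.sum_eq_single x]
  · rw [indicator_of_mem hx, Pi.one_apply, one_mul]
  · intro z _ hz
    rw [indicator_of_notMem, zero_mul]
    exact fun h => disjoint_left.1 (hW hz) h hx
  · simp

theorem measurable_wellCode [MeasurableSpace E] [DiscreteMeasurableSpace E] {s : ℝ≥0∞} (hs : s ≠ 0)
    (i : ℕ) (y : S) : Measurable (Q.wellCode W s i y) := by
  have hind : ∀ x, Measurable fun ω : (ℕ → E) × (ℕ → ℝ) => (W x).indicator (1 : E → ℝ≥0∞) (ω.1 0) :=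
    fun x => (measurable_one.indicator MeasurableSet.of_discrete).comp (measurable_fst_apply 0)
  induction i with
  | zero => exact hind y
  | succ i ih =>
    exact Finset.measurable_sum _ fun x _ => (hind x).mul (measurable_exitFun hs x ih)

variable (Q W) in
/-- The monomials in the code. -/
def codeMonomial (s : ℝ≥0∞) (l : List (ℕ × S)) (ω : (ℕ → E) × (ℕ → ℝ)) : ℝ≥0∞ :=
  (l.map fun c => Q.wellCode W s c.1 c.2 ω).prod

theorem measurable_codeMonomial [MeasurableSpace E] [DiscreteMeasurableSpace E] {s : ℝ≥0∞}
    (hs : s ≠ 0) (l : List (ℕ × S)) : Measurable (Q.codeMonomial W s l) := by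
  induction l with
  | nil => exact measurable_const
  | cons c l ih =>
    have : Q.codeMonomial W s (c :: l)
        = fun ω => Q.wellCode W s c.1 c.2 ω * Q.codeMonomial W s l ω := by
      funext ω; simp [codeMonomial]
    rw [this]
    exact (measurable_wellCode hs _ _).mul ih

end Code

end RateMatrix

/-! ### Factorization of monomials at the first change of well -/

section Monomials

variable {S : Type*}

/-- The factors of a monomial which depend on the path after its first step. -/
def lowerIndices : List (ℕ × S) → List (ℕ × S)
  | [] => []
  | (0, _) :: l => lowerIndices l
  | (i + 1, y) :: l => (i, y) :: lowerIndices l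

theorem lt_of_mem_lowerIndices {m : ℕ} {l : List (ℕ × S)} (h : ∀ c ∈ l, c.1 < m + 1) :
    ∀ c ∈ lowerIndices l, c.1 < m := by
  induction l with
  | nil => simp [lowerIndices]
  | cons c l ih =>
    have ih' := ih fun d hd => h d (List.mem_cons_of_mem _ hd)
    have hc := h c List.mem_cons_self
    obtain ⟨_ | i, y⟩ := c
    · exact ih'
    · intro d hd
      rcases List.mem_cons.1 hd with rfl | hd
      · exact Nat.lt_of_succ_lt_succ hc
      · exact ih' d hd

variable [DecidableEq S]

/-- The contribution of the initial well to a monomial. -/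
def headFactor (x : S) : List (ℕ × S) → ℝ≥0∞
  | [] => 1
  | (0, y) :: l => (if x = y then 1 else 0) * headFactor x l
  | (_ + 1, _) :: l => headFactor x l

theorem headFactor_le_one (x : S) (l : List (ℕ × S)) : headFactor x l ≤ 1 := by
  induction l with
  | nil => exact le_rfl
  | cons c l ih =>
    obtain ⟨_ | i, y⟩ := c
    · rw [headFactor]
      split_ifs <;> simp [ih]
    · exact ih

namespace RateMatrix

variable {E : Type*} {Q : RateMatrix E} {W : S → Set E} [Fintype S]

/-- A factor of index i + 1 is exp(-sτ) times the factor of index i of the path after the exit, so k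
such factors produce the discount exp(-ksτ). A factor of index 0 only tests the initial well. -/
theorem codeMonomial_eq (hW : Pairwise fun x y => Disjoint (W x) (W y)) {x : S}
    {ω : (ℕ → E) × (ℕ → ℝ)} (hx : ω.1 0 ∈ W x) (s : ℝ≥0∞) (l : List (ℕ × S)) :
    Q.codeMonomial W s l ω = headFactor x l * Q.exitFun W ((lowerIndices l).length * s) x
      (Q.codeMonomial W s (lowerIndices l)) ω := by
  induction l with
  | nil => simp [codeMonomial, headFactor, exitFun, lowerIndices]
  | cons c l ih =>
    have hcons : Q.codeMonomial W s (c :: l) ω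
        = Q.wellCode W s c.1 c.2 ω * Q.codeMonomial W s l ω := by simp [codeMonomial]
    rw [hcons, ih]
    obtain ⟨_ | i, y⟩ := c
    · rw [headFactor, lowerIndices, wellCode, mul_assoc]
      congr 1
      by_cases hxy : x = y
      · rw [if_pos hxy, indicator_of_mem (hxy ▸ hx), Pi.one_apply]
      · rw [if_neg hxy, indicator_of_notMem]
        exact fun h => disjoint_left.1 (hW hxy) hx h
    · rw [headFactor, lowerIndices, wellCode_succ hW hx, List.length_cons, exitFun, exitFun,
        exitFun]
      have : Q.codeMonomial W s ((i, y) :: lowerIndices l) (exitPath W x ω)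
          = Q.wellCode W s i y (exitPath W x ω)
            * Q.codeMonomial W s (lowerIndices l) (exitPath W x ω) := by simp [codeMonomial]
      rw [this]
      push_cast
      rw [add_mul, add_mul, one_mul, expNeg_add]
      ring

variable [Countable E] [MeasurableSpace E] [DiscreteMeasurableSpace E]

theorem lintegral_codeMonomial (hW : Pairwise fun x y => Disjoint (W x) (W y)) {x : S} {η : E}
    (hη : η ∈ W x) (s : ℝ≥0∞) (l : List (ℕ × S)) :
    ∫⁻ ω, Q.codeMonomial W s l ω ∂Q.law η = headFactor x l *
      ∫⁻ ω, Q.exitFun W ((lowerIndices l).length * s) x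
        (Q.codeMonomial W s (lowerIndices l)) ω ∂Q.law η := by
  rw [← lintegral_const_mul' _ _ (ne_top_of_le_ne_top ENNReal.one_ne_top (headFactor_le_one x l))]
  refine lintegral_congr_ae ?_
  filter_upwards [Q.law_zero η] with ω h0
  exact codeMonomial_eq hW (by rwa [h0]) s l

end RateMatrix

end Monomials

/-! ### Convergence of the codes -/

namespace RateMatrix

variable {E S : Type*} {Q : RateMatrix E} {W : S → Set E}

theorem exitFun_le_one {G : (ℕ → E) × (ℕ → ℝ) → ℝ≥0∞} (hG : ∀ ω, G ω ≤ 1) (b : ℝ≥0∞) (x : S)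
    (ω : (ℕ → E) × (ℕ → ℝ)) : Q.exitFun W b x G ω ≤ 1 :=
  mul_le_one' (expNeg_le_one _) (hG _)

variable [Fintype S]

theorem wellCode_le_one (hW : Pairwise fun x y => Disjoint (W x) (W y)) (s : ℝ≥0∞) (i : ℕ) (y : S)
    (ω : (ℕ → E) × (ℕ → ℝ)) : Q.wellCode W s i y ω ≤ 1 := by
  induction i generalizing ω with
  | zero =>
    rw [wellCode]
    exact indicator_le_self' (fun _ _ => zero_le) _
  | succ i ih =>
    by_cases hx : ∃ x, ω.1 0 ∈ W x
    · obtain ⟨x, hx⟩ := hx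
      rw [wellCode_succ hW hx]
      exact exitFun_le_one ih _ _ _
    · rw [wellCode, Finset.sum_eq_zero]
      · exact zero_le
      · intro x _
        rw [indicator_of_notMem (fun h => hx ⟨x, h⟩), zero_mul]

theorem codeMonomial_le_one (hW : Pairwise fun x y => Disjoint (W x) (W y)) (s : ℝ≥0∞)
    (l : List (ℕ × S)) (ω : (ℕ → E) × (ℕ → ℝ)) : Q.codeMonomial W s l ω ≤ 1 := by
  induction l with
  | nil => simp [codeMonomial]
  | cons c l ih =>
    rw [codeMonomial, List.map_cons, List.prod_cons]
    exact mul_le_one' (wellCode_le_one hW s _ _ _) ih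

variable [DecidableEq S]

theorem exitRate_ofRates (r : S → S → ℝ≥0) (x : S) :
    (ofRates r).exitRate x = ∑ z : {y // y ≠ x}, (r x z : ℝ≥0∞) := by
  have h1 : (ofRates r).holdingRate x = ∑ z ∈ Finset.univ.erase x, (r x z : ℝ) := by
    simp [holdingRate, ofRates]
  rw [exitRate, h1, ENNReal.ofReal_sum_of_nonneg fun z _ => (r x z).coe_nonneg]
  simp only [ENNReal.ofReal_coe_nnreal]
  exact Finset.sum_subtype _ (by simp) _

theorem exitRate_mul_jumpOp_ofRates (r : S → S → ℝ≥0) (x : S) (F : S → ℝ≥0∞) :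
    (ofRates r).exitRate x * (ofRates r).jumpOp F x
      = ∑ z : {y // y ≠ x}, (r x z : ℝ≥0∞) * F z := by
  rw [jumpOp, tsum_fintype, ← Finset.add_sum_erase _ _ (Finset.mem_univ x), mul_add, Finset.mul_sum]
  have h0 : (ofRates r).exitRate x * ((ofRates r).jumpProb x x * F x) = 0 := by
    rcases ((ofRates r).holdingRate_nonneg x).eq_or_lt with h | h
    · rw [exitRate, ← h, ENNReal.ofReal_zero, zero_mul]
    · rw [jumpProb_self _ h, zero_mul, mul_zero]
  rw [h0, zero_add, ← Finset.sum_subtype (s := Finset.univ.erase x) (by simp)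
    (fun z => (r x z : ℝ≥0∞) * F z)]
  refine Finset.sum_congr rfl fun z hz => ?_
  have hne : x ≠ z := (Finset.ne_of_mem_erase hz).symm
  rw [← mul_assoc, exitRate_mul_jumpProb _ hne]
  simp [ofRates, hne]

end RateMatrix

theorem pairwise_disjoint_singleton (S : Type*) :
    Pairwise fun x y : S => Disjoint ({x} : Set S) {y} := fun _ _ h => disjoint_singleton.2 h

section

variable {S : Type*} [Fintype S] [DecidableEq S] [MeasurableSpace S] [DiscreteMeasurableSpace S]
  {E : ℕ → Type*} [∀ N, Countable (E N)]
  [∀ N, MeasurableSpace (E N)] [∀ N, DiscreteMeasurableSpace (E N)]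
  {Q : ∀ N, RateMatrix (E N)} {μ : ∀ N, Measure (E N)} [∀ N, IsFiniteMeasure (μ N)]
  {W : ∀ N, S → Set (E N)} {ξ : ∀ N, S → E N} {θ : ℕ → ℝ≥0} {r : S → S → ℝ≥0}

open RateMatrix

/-- Induction on a bound for the indices. The limiting chain is treated as a chain whose wells are
the single points, with unit time-scale, so both expectations obey the same recursion. -/
theorem MetastableSetting.uniformLimit_codeMonomial [Nontrivial S]
    (h : MetastableSetting Q μ W ξ θ r) (m : ℕ) :
    ∀ l : List (ℕ × S), (∀ c ∈ l, c.1 < m) → ∀ x, UniformLimit (fun N => W N x)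
      (fun N η => ∫⁻ ω, (Q N).codeMonomial (W N) (θ N : ℝ≥0∞)⁻¹ l ω ∂(Q N).law η)
      (∫⁻ ω, (ofRates r).codeMonomial (fun y => {y}) 1 l ω ∂(ofRates r).law x) := by
  induction m with
  | zero =>
    intro l hl x ε hε
    have : l = [] := by
      rcases l with _ | ⟨c, l⟩
      · rfl
      · exact absurd (hl c List.mem_cons_self) (by omega)
    subst this
    refine Eventually.of_forall fun N η _ => ?_
    simp [codeMonomial]
  | succ m ih =>
    intro l hl x
    have hθ : ∀ N, (θ N : ℝ≥0∞)⁻¹ ≠ 0 := fun N => by simp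
    have hθ' : ∀ N, (θ N : ℝ≥0∞)⁻¹ ≠ ∞ := fun N => by simpa using (h.pos N).ne'
    have hsing := pairwise_disjoint_singleton S
    rw [lintegral_codeMonomial hsing (mem_singleton x)]
    refine UniformLimit.mul ?_ (headFactor_le_one x l)
      (fun N η hη => lintegral_codeMonomial (h.disjoint N) hη _ l)
    have ih' := ih (lowerIndices l) (lt_of_mem_lowerIndices hl)
    set l' := lowerIndices l with hl'
    -- Without factors of positive index the discount rate is 0, which the Laplace transform
    -- identities exclude; the functional is then identically 1.
    by_cases hnil : l' = []
    · intro ε _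
      refine Eventually.of_forall fun N η _ => ?_
      simp [hnil, exitFun, codeMonomial]
    have hb : (l'.length : ℝ≥0∞) ≠ 0 := by simpa using hnil
    have hb' : (l'.length : ℝ≥0∞) ≠ ∞ := ENNReal.natCast_ne_top _
    have hlim : ∫⁻ ω, (ofRates r).exitFun (fun y => {y}) (l'.length * 1) x
        ((ofRates r).codeMonomial (fun y => {y}) 1 l') ω ∂(ofRates r).law x
        = (∑ z : {y // y ≠ x}, (r x z : ℝ≥0∞) *
            ∫⁻ ω, (ofRates r).codeMonomial (fun y => {y}) 1 l' ω ∂(ofRates r).law z)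
          / (l'.length + ∑ z : {y // y ≠ x}, (r x z : ℝ≥0∞)) := by
      rw [mul_one, lintegral_exitFun_of_mem (mem_singleton x) hb hb'
        (measurable_codeMonomial one_ne_zero l'), div_eq_mul_inv, mul_right_comm,
        exitRate_mul_jumpOp_ofRates, exitRate_ofRates, add_comm, ← div_eq_mul_inv]
      congr 1
      refine Finset.sum_congr rfl fun z _ => ?_
      rw [lintegral_exitFun_of_mem_otherWells (subset_otherWells hsing z.2 (mem_singleton _))]
    rw [hlim]
    refine h.uniformLimit hb hb' (fun N η => ?_) (fun N η hη => ?_) (fun N η hη => ?_)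
      (φ := fun z => ∫⁻ ω, (ofRates r).codeMonomial (fun y => {y}) 1 l' ω ∂(ofRates r).law z)
      (fun z => ?_) (fun y hy => ?_)
    · calc _ ≤ ∫⁻ _, 1 ∂(Q N).law η := lintegral_mono fun ω =>
            exitFun_le_one (codeMonomial_le_one (h.disjoint N) _ _) _ _ _
        _ = 1 := by simp
    · rw [div_eq_mul_inv _ (θ N : ℝ≥0∞)]
      exact lintegral_exitFun_of_mem hη (mul_ne_zero hb (hθ N)) (ENNReal.mul_ne_top hb' (hθ' N))
        (measurable_codeMonomial (hθ N) l')
    · exact lintegral_exitFun_of_notMem hη (mul_ne_zero hb (hθ N))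
        (measurable_codeMonomial (hθ N) l')
    · calc _ ≤ ∫⁻ _, 1 ∂(ofRates r).law z := lintegral_mono fun ω =>
            codeMonomial_le_one hsing _ _ _
        _ = 1 := by simp
    · intro ε hε
      filter_upwards [ih' y ε hε] with N hN η hη
      rw [lintegral_exitFun_of_mem_otherWells (subset_otherWells (h.disjoint N) hy hη)]
      exact hN η hη

end

/-! ### The sequence of visited wells encodes the projected trace -/

namespace RateMatrix

variable {E S : Type*} (Q : RateMatrix E) (W : S → Set E)

/-- The index of the well which contains `η`. -/
def wellOf [Nonempty S] (η : E) : S := Classical.epsilon fun x => η ∈ W x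

variable {W} in
theorem mem_wellOf [Nonempty S] {η : E} (h : η ∈ wells W) : η ∈ W (wellOf W η) :=
  Classical.epsilon_spec (mem_iUnion.1 h)

theorem iterate_shift_fst (ω : (ℕ → E) × (ℕ → ℝ)) (k n : ℕ) :
    (shift^[k] ω).1 n = ω.1 (k + n) := by
  induction k generalizing ω with
  | zero => simp
  | succ k ih =>
    rw [Function.iterate_succ_apply, ih]
    change ω.1 (k + n + 1) = _
    rw [Nat.add_right_comm]

theorem iterate_shift_snd (ω : (ℕ → E) × (ℕ → ℝ)) (k n : ℕ) :
    (shift^[k] ω).2 n = ω.2 (k + n) := by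
  induction k generalizing ω with
  | zero => simp
  | succ k ih =>
    rw [Function.iterate_succ_apply, ih]
    change ω.2 (k + n + 1) = _
    rw [Nat.add_right_comm]

theorem traceTime_add (A : Set E) (ω : (ℕ → E) × (ℕ → ℝ)) (k n : ℕ) :
    Q.traceTime A ω (k + n) = Q.traceTime A ω k + Q.traceTime A (shift^[k] ω) n := by
  induction k generalizing ω with
  | zero => simp [traceTime_zero]
  | succ k ih =>
    rw [Nat.add_right_comm, traceTime_shift, ih, traceTime_shift, add_assoc,
      Function.iterate_succ_apply]

variable [Nonempty S]

/-- The path after its first change of well. -/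
def nextPath (ω : (ℕ → E) × (ℕ → ℝ)) : (ℕ → E) × (ℕ → ℝ) := exitPath W (wellOf W (ω.1 0)) ω

/-- The time spent in the wells before the `i`-th change of well. -/
def changeTime (ω : (ℕ → E) × (ℕ → ℝ)) (i : ℕ) : ℝ≥0∞ :=
  ∑ j ∈ Finset.range i, Q.exitTime W (wellOf W (((nextPath W)^[j] ω).1 0)) ((nextPath W)^[j] ω)

theorem changeTime_succ (ω : (ℕ → E) × (ℕ → ℝ)) (i : ℕ) : Q.changeTime W ω (i + 1)
    = Q.changeTime W ω i
      + Q.exitTime W (wellOf W (((nextPath W)^[i] ω).1 0)) ((nextPath W)^[i] ω) :=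
  Finset.sum_range_succ _ _

theorem changeTime_nextPath (ω : (ℕ → E) × (ℕ → ℝ)) (i : ℕ) : Q.changeTime W ω (i + 1)
    = Q.exitTime W (wellOf W (ω.1 0)) ω + Q.changeTime W (nextPath W ω) i := by
  rw [changeTime, Finset.sum_range_succ', add_comm]
  rfl

variable {W}

theorem nextPath_mem {ω : (ℕ → E) × (ℕ → ℝ)} (h : ω.1 0 ∈ wells W) :
    (nextPath W ω).1 0 ∈ wells W := by
  classical
  rw [nextPath, exitPath]
  split_ifs with hex
  · rw [iterate_shift_fst, add_zero]
    exact (Nat.find_spec hex).1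
  · exact h

theorem iterate_nextPath_mem {ω : (ℕ → E) × (ℕ → ℝ)} (h : ω.1 0 ∈ wells W) (i : ℕ) :
    ((nextPath W)^[i] ω).1 0 ∈ wells W := by
  induction i generalizing ω with
  | zero => exact h
  | succ i ih => rw [Function.iterate_succ_apply]; exact ih (nextPath_mem h)

open Classical in
theorem wellCode_eq [Fintype S] (hW : Pairwise fun x y => Disjoint (W x) (W y)) (s : ℝ≥0∞)
    (i : ℕ) (y : S) {ω : (ℕ → E) × (ℕ → ℝ)} (h : ω.1 0 ∈ wells W) :
    Q.wellCode W s i y ω = if wellOf W (((nextPath W)^[i] ω).1 0) = y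
      then expNeg (s * Q.changeTime W ω i) else 0 := by
  induction i generalizing ω with
  | zero =>
    have hm := mem_wellOf h
    rw [wellCode, changeTime, Finset.sum_range_zero, mul_zero, expNeg_zero,
      Function.iterate_zero_apply]
    split_ifs with hy
    · rw [indicator_of_mem (hy ▸ hm), Pi.one_apply]
    · rw [indicator_of_notMem]
      exact fun h' => disjoint_left.1 (hW hy) hm h'
  | succ i ih =>
    rw [wellCode_succ hW (mem_wellOf h), exitFun, ← nextPath, ih (nextPath_mem h),
      changeTime_nextPath, mul_add, expNeg_add, Function.iterate_succ_apply]
    split_ifs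
    · rfl
    · rw [mul_zero]

variable {Q}

/-- Each change of well happens at a jump, so the path after i changes is an iterated shift. The
bound k ≥ i serves to show that the times of change have no finite accumulation point. -/
theorem exists_index_changeTime {ω : (ℕ → E) × (ℕ → ℝ)} (h : ω.1 0 ∈ wells W) {i : ℕ}
    (hi : Q.changeTime W ω i ≠ ∞) :
    ∃ k ≥ i, (nextPath W)^[i] ω = shift^[k] ω ∧
      Q.changeTime W ω i = Q.traceTime (wells W) ω k := by
  classical
  induction i with
  | zero => exact ⟨0, le_rfl, rfl, rfl⟩
  | succ i ih =>
    rw [changeTime_succ, ENNReal.add_ne_top] at hi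
    obtain ⟨k, hk, h1, h2⟩ := ih hi.1
    have hmem := mem_wellOf (iterate_nextPath_mem h i)
    set x := wellOf W (((nextPath W)^[i] ω).1 0) with hx
    have hex : ∃ n, ((nextPath W)^[i] ω).1 n ∈ otherWells W x := by
      by_contra hex
      exact hi.2 (by rw [exitTime, dif_neg hex])
    have hpos : Nat.find hex ≠ 0 := fun h0 => by
      have := Nat.find_spec hex
      rw [h0] at this
      exact this.2 hmem
    refine ⟨k + Nat.find hex, by omega, ?_, ?_⟩
    · rw [Function.iterate_succ_apply', nextPath, ← hx, exitPath, dif_pos hex]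
      have key : ∀ J, shift^[J] ((nextPath W)^[i] ω) = shift^[k + J] ω := fun J => by
        rw [h1, ← Function.iterate_add_apply, add_comm]
      exact key _
    · rw [changeTime_succ, ← hx, exitTime, dif_pos hex, traceTime_add, h2, ← h1]

/-- The step structure of a path indexed by the time spent in the wells. -/
theorem isStepPath_of_traceTime {ω : (ℕ → E) × (ℕ → ℝ)} (h : ω.1 0 ∈ wells W)
    (hpos : ∀ n, 0 < ω.2 n) (hsup : ⨆ n, Q.traceTime (wells W) ω n = ∞) {θ : ℝ≥0} (hθ : 0 < θ)
    {Z : ℝ≥0 → Option S}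
    (hZ : ∀ n (s : ℝ≥0), Q.traceTime (wells W) ω n ≤ s → s < Q.traceTime (wells W) ω (n + 1) →
      ∀ y, ω.1 n ∈ W y → Z s = some y) :
    IsStepPath (fun i => wellOf W (((nextPath W)^[i] ω).1 0))
      (fun i => (θ : ℝ≥0∞)⁻¹ * Q.changeTime W ω i) (fun s => Z (s * θ)) := by
  classical
  have hθ0 : (θ : ℝ≥0∞) ≠ 0 := by simpa using hθ.ne'
  have hθt : (θ : ℝ≥0∞) ≠ ∞ := ENNReal.coe_ne_top
  have hinv0 : (θ : ℝ≥0∞)⁻¹ ≠ 0 := by simp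
  have hinvt : (θ : ℝ≥0∞)⁻¹ ≠ ∞ := by simpa using hθ.ne'
  refine ⟨?_, fun i hi => ?_, ?_, fun i s h1 h2 => ?_⟩
  · simp [changeTime]
  · have hi' : Q.changeTime W ω i ≠ ∞ := by
      rintro heq
      exact hi (by rw [heq, ENNReal.mul_top hinv0])
    obtain ⟨k, -, hk, -⟩ := exists_index_changeTime h hi'
    have hmem := mem_wellOf (iterate_nextPath_mem h i)
    have hmemW := iterate_nextPath_mem h i
    rw [changeTime_succ, mul_add]
    -- Two changes are separated at least by the positive holding time at the state, inside a well,
    -- where the first one leads.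
    refine ENNReal.lt_add_right hi (mul_ne_zero hinv0 (pos_iff_ne_zero.1 ?_))
    set x := wellOf W (((nextPath W)^[i] ω).1 0) with hx
    rw [exitTime]
    split_ifs with hex
    · have hf : Nat.find hex ≠ 0 := fun h0 => by
        have := Nat.find_spec hex
        rw [h0] at this
        exact this.2 hmem
      obtain ⟨m, hm⟩ := Nat.exists_eq_succ_of_ne_zero hf
      rw [hm, Nat.succ_eq_add_one, traceTime_shift, indicator_of_mem hmemW]
      refine lt_of_lt_of_le (Q.holdingTime_pos ?_) le_self_add
      rw [hk, iterate_shift_snd]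
      exact hpos _
    · exact ENNReal.zero_lt_top
  -- If all changes occur, their times dominate the trace times at the jumps, which tend to
  -- infinity; otherwise one of the change times is infinite.
  · by_cases hall : ∀ i, Q.changeTime W ω i ≠ ∞
    · rw [← ENNReal.mul_iSup]
      have : ⨆ i, Q.changeTime W ω i = ∞ := by
        refine top_unique (hsup ▸ iSup_mono fun i => ?_)
        obtain ⟨k, hk, -, heq⟩ := exists_index_changeTime h (hall i)
        rw [heq]
        exact Q.monotone_traceTime _ _ hk
      rw [this, ENNReal.mul_top hinv0]
    · push Not at hall
      obtain ⟨i, hi⟩ := hall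
      refine top_unique (le_iSup_of_le i ?_)
      rw [hi, ENNReal.mul_top hinv0]
  · have hi : Q.changeTime W ω i ≠ ∞ := by
      rintro heq
      rw [heq, ENNReal.mul_top hinv0] at h1
      exact absurd h1 (by simp)
    obtain ⟨k, -, hk, hkt⟩ := exists_index_changeTime h hi
    have h1' : Q.traceTime (wells W) ω k ≤ ((s * θ : ℝ≥0) : ℝ≥0∞) := by
      rw [mul_comm, ← div_eq_mul_inv, ENNReal.div_le_iff hθ0 hθt, hkt] at h1
      rwa [ENNReal.coe_mul]
    have h2' : ((s * θ : ℝ≥0) : ℝ≥0∞) < Q.changeTime W ω (i + 1) := by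
      rw [mul_comm, ← div_eq_mul_inv, ENNReal.lt_div_iff_mul_lt (Or.inl hθ0) (Or.inl hθt)] at h2
      rwa [ENNReal.coe_mul]
    -- The index n is the jump whose holding interval contains time s θ of the trace clock. It lies
    -- between the i-th change and the next one, so its state is still in the i-th visited well.
    have hexn : ∃ n, ((s * θ : ℝ≥0) : ℝ≥0∞) < Q.traceTime (wells W) ω n := by
      rw [← lt_iSup_iff, hsup]; exact ENNReal.coe_lt_top
    have hn0 : Nat.find hexn ≠ 0 := fun h0 => by
      have := Nat.find_spec hexn
      rw [h0, traceTime_zero] at this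
      exact absurd this not_lt_zero
    obtain ⟨n, hn⟩ := Nat.exists_eq_succ_of_ne_zero hn0
    rw [Nat.succ_eq_add_one] at hn
    have hn1 : Q.traceTime (wells W) ω n ≤ ((s * θ : ℝ≥0) : ℝ≥0∞) :=
      not_lt.1 (Nat.find_min hexn (by omega))
    have hn2 : ((s * θ : ℝ≥0) : ℝ≥0∞) < Q.traceTime (wells W) ω (n + 1) := by
      rw [← hn]; exact Nat.find_spec hexn
    have hkn : k ≤ n := by
      by_contra hlt
      exact absurd ((hn2.trans_le (Q.monotone_traceTime _ _ (by omega))).trans_le h1')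
        (lt_irrefl _)
    have hnW : ω.1 n ∈ wells W := by
      by_contra hnot
      rw [traceTime_succ, indicator_of_notMem hnot, add_zero] at hn2
      exact absurd (hn1.trans_lt hn2) (lt_irrefl _)
    refine hZ n _ hn1 hn2 _ ?_
    set x := wellOf W (((nextPath W)^[i] ω).1 0) with hx
    have hnot : ω.1 n ∉ otherWells W x := by
      intro hin
      have hin' : ((nextPath W)^[i] ω).1 (n - k) ∈ otherWells W x := by
        rw [hk, iterate_shift_fst, Nat.add_sub_cancel' hkn]
        exact hin
      have hex : ∃ n, ((nextPath W)^[i] ω).1 n ∈ otherWells W x := ⟨_, hin'⟩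
      have hle := Nat.find_min' hex hin'
      rw [changeTime_succ, ← hx, exitTime, dif_pos hex, hkt] at h2'
      have h3 : Q.traceTime (wells W) ω k +
          Q.traceTime (wells W) ((nextPath W)^[i] ω) (Nat.find hex)
          ≤ Q.traceTime (wells W) ω n := by
        have key : ∀ J, Q.traceTime (wells W) ω k +
            Q.traceTime (wells W) ((nextPath W)^[i] ω) J = Q.traceTime (wells W) ω (k + J) :=
          fun J => by rw [hk, ← traceTime_add]
        rw [key]
        exact Q.monotone_traceTime _ _ (by omega)
      exact absurd ((h2'.trans_le h3).trans_le hn1) (lt_irrefl _)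
    by_contra hx'
    exact hnot ⟨hnW, hx'⟩

end RateMatrix

/-! ### Convergence of the projected trace -/

namespace RateMatrix

/-! ### Infinite total time spent in a set -/

section TotalTime

variable {E : Type*} (Q : RateMatrix E)

theorem iSup_traceTime_shift (A : Set E) (ω : (ℕ → E) × (ℕ → ℝ)) :
    ⨆ n, Q.traceTime A ω n = A.indicator (fun _ => Q.holdingTime ω 0) (ω.1 0)
      + ⨆ n, Q.traceTime A (shift ω) n := by
  rw [ENNReal.add_iSup]
  refine le_antisymm (iSup_le fun n => ?_) (iSup_le fun n => ?_)
  · refine le_iSup_of_le n ?_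
    rw [← traceTime_shift]
    exact Q.monotone_traceTime A ω n.le_succ
  · rw [← traceTime_shift]
    exact le_iSup (Q.traceTime A ω) (n + 1)

theorem exitRate_div_lt_one (η : E) : Q.exitRate η / (Q.exitRate η + 1) < 1 := by
  refine ENNReal.div_lt_of_lt_mul ?_
  rw [one_mul]
  exact ENNReal.lt_add_right (Q.exitRate_ne_top η) one_ne_zero

theorem measurable_expNeg_iSup_traceTime [MeasurableSpace E]
    [DiscreteMeasurableSpace E] (A : Set E) :
    Measurable fun ω => expNeg (⨆ n, Q.traceTime A ω n) :=
  measurable_expNeg.comp (Measurable.iSup fun n => measurable_traceTime A n)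

variable [Countable E] [MeasurableSpace E] [DiscreteMeasurableSpace E]

/-- The Laplace transform of the total time spent in `A`. -/
def totalTimeTransform (A : Set E) (η : E) : ℝ≥0∞ :=
  ∫⁻ ω, expNeg (⨆ n, Q.traceTime A ω n) ∂Q.law η

theorem totalTimeTransform_le_one (A : Set E) (η : E) : Q.totalTimeTransform A η ≤ 1 := by
  calc _ ≤ ∫⁻ _, 1 ∂Q.law η := lintegral_mono fun ω => expNeg_le_one _
    _ = 1 := by simp

theorem totalTimeTransform_of_mem {A : Set E} {η : E} (hη : η ∈ A) :
    Q.totalTimeTransform A η = Q.exitRate η / (Q.exitRate η + 1)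
      * Q.jumpOp (Q.totalTimeTransform A) η := by
  have h := Q.lintegral_expNeg_mul_shift η one_ne_zero ENNReal.one_ne_top
    (Q.measurable_expNeg_iSup_traceTime A)
  change _ = _ * Q.jumpOp (fun ζ => ∫⁻ ω, expNeg (⨆ n, Q.traceTime A ω n) ∂Q.law ζ) η
  rw [← h]
  refine lintegral_congr_ae ?_
  filter_upwards [Q.law_zero η] with ω h0
  rw [iSup_traceTime_shift, expNeg_add, indicator_of_mem (by rwa [h0]), one_mul]

theorem totalTimeTransform_of_notMem {A : Set E} {η : E} (hη : η ∉ A) :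
    Q.totalTimeTransform A η = Q.jumpOp (Q.totalTimeTransform A) η := by
  have h := Q.lintegral_law_comp_shift η (Q.measurable_expNeg_iSup_traceTime A)
  change _ = Q.jumpOp (fun ζ => ∫⁻ ω, expNeg (⨆ n, Q.traceTime A ω n) ∂Q.law ζ) η
  rw [← h]
  refine lintegral_congr_ae ?_
  filter_upwards [Q.law_zero η] with ω h0
  rw [iSup_traceTime_shift, indicator_of_notMem (by rwa [h0]), zero_add]

variable {Q}

theorem ae_iSup_traceTime_eq_top {A : Set E} {η : E} (h : Q.totalTimeTransform A η = 0) :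
    ∀ᵐ ω ∂Q.law η, ⨆ n, Q.traceTime A ω n = ∞ := by
  have h1 := (lintegral_eq_zero_iff (Q.measurable_expNeg_iSup_traceTime A)).1 h
  filter_upwards [h1] with ω hω
  exact expNeg_eq_zero_iff.1 hω

/-- The Laplace transform of the total time is a bounded solution of a homogeneous equation whose
damping factor is less than 1 on A, so it vanishes by comparison with 0. -/
theorem Liouville.ae_iSup_traceTime (hL : Q.Liouville) {A : Set E} (hA : A.Nonempty) (η : E) :
    ∀ᵐ ω ∂Q.law η, ⨆ n, Q.traceTime A ω n = ∞ := by
  classical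
  refine ae_iSup_traceTime_eq_top (le_antisymm ?_ zero_le)
  obtain ⟨ζ, hζ⟩ := hA
  set w : E → ℝ≥0∞ := fun η => if η ∈ A then Q.exitRate η / (Q.exitRate η + 1) else 1 with hw
  refine hL.le_of_subsolution (f := Q.totalTimeTransform A) (g := fun _ => 0) (w := w)
    (b := fun _ => 0) ∅ (Q.totalTimeTransform_le_one A) (fun η => ?_) (by simp) (fun η _ => ?_)
    (fun η _ => ?_) (Or.inr ⟨ζ, by simp, ?_⟩) η
  · simp only [hw]
    split_ifs
    · exact (Q.exitRate_div_lt_one η).le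
    · exact le_rfl
  · simp only [hw, add_zero]
    split_ifs with h
    · exact (Q.totalTimeTransform_of_mem h).le
    · rw [one_mul]; exact (Q.totalTimeTransform_of_notMem h).le
  · rw [jumpOp_const, mul_zero, add_zero]
  · simp only [hw, if_pos hζ]
    exact Q.exitRate_div_lt_one ζ

/-- The limiting chain need not be recurrent. On a finite state space a maximum principle replaces
the Liouville property: at a maximum point the damping forces the transform to be 0. -/
theorem ae_iSup_jumpTime_of_finite [Finite E] (η : E) :
    ∀ᵐ ω ∂Q.law η, ⨆ n, Q.traceTime univ ω n = ∞ := by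
  refine ae_iSup_traceTime_eq_top (le_antisymm ?_ zero_le)
  have : Nonempty E := ⟨η⟩
  obtain ⟨ζ, hζ⟩ := Finite.exists_max (Q.totalTimeTransform univ)
  have h0 : Q.totalTimeTransform univ ζ = 0 := by
    by_contra hne
    have hfin : Q.totalTimeTransform univ ζ ≠ ∞ :=
      ne_top_of_le_ne_top ENNReal.one_ne_top (Q.totalTimeTransform_le_one _ _)
    have h1 : Q.jumpOp (Q.totalTimeTransform univ) ζ ≤ Q.totalTimeTransform univ ζ := by
      refine (jumpOp_mono hζ ζ).trans ?_
      rw [jumpOp_const]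
    have h2 := (Q.totalTimeTransform_of_mem (mem_univ ζ)).le.trans (mul_le_mul_right h1 _)
    have h3 := ENNReal.mul_lt_mul_left hne hfin (Q.exitRate_div_lt_one ζ)
    rw [one_mul] at h3
    exact absurd (h2.trans_lt h3) (lt_irrefl _)
  exact (hζ η).trans h0.le

end TotalTime

variable {E S : Type*} (Q : RateMatrix E) (W : S → Set E) [Fintype S]

/-- The code of the path, as a point of the cube. -/
def cubeCode (s : ℝ≥0∞) (ω : (ℕ → E) × (ℕ → ℝ)) (c : ℕ × S) : unitInterval :=
  projIcc 0 1 zero_le_one (Q.wellCode W s c.1 c.2 ω).toReal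

variable {Q W}

theorem coe_cubeCode (hW : Pairwise fun x y => Disjoint (W x) (W y)) (s : ℝ≥0∞)
    (ω : (ℕ → E) × (ℕ → ℝ)) (c : ℕ × S) :
    (Q.cubeCode W s ω c : ℝ) = (Q.wellCode W s c.1 c.2 ω).toReal := by
  rw [cubeCode, projIcc_of_mem zero_le_one ⟨ENNReal.toReal_nonneg, ?_⟩]
  exact ENNReal.toReal_le_of_le_ofReal zero_le_one (by simpa using wellCode_le_one hW s _ _ _)

theorem measurable_cubeCode [MeasurableSpace E] [DiscreteMeasurableSpace E] {s : ℝ≥0∞}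
    (hs : s ≠ 0) : Measurable (Q.cubeCode W s) :=
  measurable_pi_lambda _ fun c => continuous_projIcc.measurable.comp
    (measurable_wellCode hs c.1 c.2).ennreal_toReal

theorem prod_cubeCode (hW : Pairwise fun x y => Disjoint (W x) (W y)) (s : ℝ≥0∞)
    (ω : (ℕ → E) × (ℕ → ℝ)) (l : List (ℕ × S)) :
    (l.map fun c => (Q.cubeCode W s ω c : ℝ)).prod = (Q.codeMonomial W s l ω).toReal := by
  induction l with
  | nil => simp [codeMonomial]
  | cons c l ih =>
    rw [List.map_cons, List.prod_cons, ih, coe_cubeCode hW, ← ENNReal.toReal_mul]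
    simp [codeMonomial]

/-- The path `Z` is kept abstract so that the statement serves both the projected trace and the
limiting chain. -/
theorem isStepCode_cubeCode [Nonempty S] (hW : Pairwise fun x y => Disjoint (W x) (W y))
    {ω : (ℕ → E) × (ℕ → ℝ)} (h : ω.1 0 ∈ wells W) (hpos : ∀ n, 0 < ω.2 n)
    (hsup : ⨆ n, Q.traceTime (wells W) ω n = ∞) {θ : ℝ≥0} (hθ : 0 < θ) {Z : ℝ≥0 → Option S}
    (hZ : ∀ n (s : ℝ≥0), Q.traceTime (wells W) ω n ≤ s → s < Q.traceTime (wells W) ω (n + 1) →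
      ∀ y, ω.1 n ∈ W y → Z s = some y) :
    IsStepCode (Q.cubeCode W (θ : ℝ≥0∞)⁻¹ ω) (SkorohodSpace.ofPath fun s => Z (s * θ)) := by
  have hstep := isStepPath_of_traceTime h hpos hsup hθ hZ
  refine ⟨fun i => wellOf W (((nextPath W)^[i] ω).1 0),
    fun i => (θ : ℝ≥0∞)⁻¹ * Q.changeTime W ω i, ?_, fun i y => ?_⟩
  · rw [SkorohodSpace.ofPath, dif_pos hstep.isCadlag]
    exact hstep
  · rw [coe_cubeCode hW, ENNReal.ofReal_toReal, wellCode_eq Q hW _ i y h]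
    exact ne_top_of_le_ne_top ENNReal.one_ne_top (wellCode_le_one hW _ _ _ _)

section Law

variable [Countable E] [MeasurableSpace E] [DiscreteMeasurableSpace E]

theorem integral_map_cubeCode (hW : Pairwise fun x y => Disjoint (W x) (W y)) {s : ℝ≥0∞}
    (hs : s ≠ 0) (η : E) (l : List (ℕ × S)) :
    ∫ a : ℕ × S → unitInterval, (l.map fun c => (a c : ℝ)).prod ∂(Q.law η).map (Q.cubeCode W s)
      = (∫⁻ ω, Q.codeMonomial W s l ω ∂Q.law η).toReal := by
  have hcont : Continuous fun a : ℕ × S → unitInterval => (l.map fun c => (a c : ℝ)).prod := by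
    refine continuous_list_prod l fun c _ => ?_
    exact continuous_subtype_val.comp (continuous_apply c)
  rw [integral_map (measurable_cubeCode hs).aemeasurable hcont.aestronglyMeasurable]
  simp only [prod_cubeCode hW]
  refine integral_toReal (measurable_codeMonomial hs l).aemeasurable
    (Eventually.of_forall fun ω => ?_)
  exact (codeMonomial_le_one hW s l ω).trans_lt ENNReal.one_lt_top

theorem wellIndex_of_mem {E S : Type*} {W : S → Set E}
    (hW : Pairwise fun x y => Disjoint (W x) (W y)) {η : E} {y : S} (h : η ∈ W y) :
    wellIndex W η = some y := by
  have hex : ∃ x, η ∈ W x := ⟨y, h⟩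
  rw [wellIndex, dif_pos hex]
  by_contra hne
  exact disjoint_left.1 (hW fun h' => hne (by rw [h'])) hex.choose_spec h

theorem RecurrentReversible.ae_isStepCode [Nonempty S] {μ : Measure E}
    (h : Q.RecurrentReversible μ) (hW : Pairwise fun x y => Disjoint (W x) (W y)) {x : S} {η : E}
    (hη : η ∈ W x) {θ : ℝ≥0} (hθ : 0 < θ) :
    ∀ᵐ ω ∂Q.law η, IsStepCode (Q.cubeCode W (θ : ℝ≥0∞)⁻¹ ω)
      (SkorohodSpace.ofPath fun t => projectedTrace W (Q.process ω) (t * θ)) := by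
  have hηW := subset_wells W x hη
  filter_upwards [Q.law_zero η, Q.ae_law_snd_pos η, h.noExplosion.ae_regularPath h.pos η,
    h.liouville.ae_iSup_traceTime ⟨η, hηW⟩ η] with ω h0 hpos hr hsup
  refine isStepCode_cubeCode hW (by rwa [h0]) hpos hsup hθ
    (Z := projectedTrace W (Q.process ω)) fun n s h1 h2 y hy => ?_
  rw [projectedTrace, hr.tracePath_eq h1 h2]
  exact wellIndex_of_mem hW hy

theorem ae_isStepCode_of_finite [MeasurableSpace S] [DiscreteMeasurableSpace S] (L : RateMatrix S)
    (x : S) :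
    ∀ᵐ ω ∂L.law x, IsStepCode (L.cubeCode (fun y => {y}) 1 ω)
      (SkorohodSpace.ofPath fun t => some (L.process ω t)) := by
  have : Nonempty S := ⟨x⟩
  have hwells : wells (fun y : S => ({y} : Set S)) = univ := iUnion_of_singleton S
  have htr : ∀ ω n, L.traceTime (wells fun y : S => ({y} : Set S)) ω n = L.jumpTime ω n := by
    intro ω n
    rw [hwells, traceTime, jumpTime]
    simp
  filter_upwards [L.ae_law_snd_pos x, ae_iSup_jumpTime_of_finite (Q := L) x] with ω hpos hsup
  rw [← hwells] at hsup
  have := isStepCode_cubeCode (Q := L) (pairwise_disjoint_singleton S)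
    (by rw [hwells]; exact mem_univ _) hpos hsup one_pos
    (Z := fun t => some (L.process ω t)) fun n s h1 h2 y hy => ?_
  · simpa using this
  · rw [htr] at h1 h2
    rw [L.process_eq h1 h2]
    exact congrArg some hy

end Law

end RateMatrix

/-! ### Condition (M2) -/

section Main

variable {S : Type*} [Fintype S] [DecidableEq S] [MeasurableSpace S] [DiscreteMeasurableSpace S]
  {E : ℕ → Type*} [∀ N, Countable (E N)]
  [∀ N, MeasurableSpace (E N)] [∀ N, DiscreteMeasurableSpace (E N)]
  {Q : ∀ N, RateMatrix (E N)} {μ : ∀ N, Measure (E N)} [∀ N, IsFiniteMeasure (μ N)]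
  {W : ∀ N, S → Set (E N)} {ξ : ∀ N, S → E N} {θ : ℕ → ℝ≥0} {r : S → S → ℝ≥0}

open RateMatrix

theorem MetastableSetting.tendstoInDistribution_cubeCode [Nontrivial S]
    (h : MetastableSetting Q μ W ξ θ r) {x : S} {η : ∀ N, E N} (hη : ∀ N, η N ∈ W N x) :
    TendstoInDistribution (fun N => (Q N).cubeCode (W N) (θ N : ℝ≥0∞)⁻¹) atTop
      ((ofRates r).cubeCode (fun y => {y}) 1) (fun N => (Q N).law (η N)) ((ofRates r).law x) := by
  have hθ : ∀ N, (θ N : ℝ≥0∞)⁻¹ ≠ 0 := fun N => by simp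
  refine ⟨fun N => (measurable_cubeCode (hθ N)).aemeasurable,
    (measurable_cubeCode one_ne_zero).aemeasurable, tendsto_of_tendsto_monomials fun l => ?_⟩
  have hsing := pairwise_disjoint_singleton S
  simp only [ProbabilityMeasure.coe_mk]
  rw [integral_map_cubeCode hsing one_ne_zero]
  simp only [integral_map_cubeCode (h.disjoint _) (hθ _)]
  have hfin : ∫⁻ ω, (ofRates r).codeMonomial (fun y => {y}) 1 l ω ∂(ofRates r).law x ≠ ∞ := by
    refine ne_top_of_le_ne_top ENNReal.one_ne_top ?_
    calc _ ≤ ∫⁻ _, 1 ∂(ofRates r).law x := lintegral_mono fun ω => codeMonomial_le_one hsing _ _ _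
      _ = 1 := by simp
  -- Any bound for the indices in the finite list will do; it starts the induction of
  -- `uniformLimit_codeMonomial`.
  obtain ⟨m, hm⟩ : ∃ m, ∀ c ∈ l, c.1 < m := by
    refine ⟨(l.map Prod.fst).sum + 1, fun c hc => Nat.lt_succ_of_le ?_⟩
    exact List.single_le_sum (by simp) _ (List.mem_map_of_mem hc)
  exact (ENNReal.tendsto_toReal hfin).comp
    ((h.uniformLimit_codeMonomial m l hm x).tendsto hfin hη)

theorem MetastableSetting.projectionCondition [Nontrivial S]
    (h : MetastableSetting Q μ W ξ θ r) (x : S) : ProjectionCondition Q W θ (ofRates r) x := by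
  intro η hη
  have hθ : ∀ N, (θ N : ℝ≥0∞)⁻¹ ≠ 0 := fun N => by simp
  exact isContinuousCode_isStepCode.tendstoInDistribution
    (fun N => (h.chain N).ae_isStepCode (h.disjoint N) (hη N) (h.pos N))
    (ae_isStepCode_of_finite _ x) (h.tendstoInDistribution_cubeCode hη)
    (fun N => measurable_cubeCode (hθ N)) (measurable_cubeCode one_ne_zero)

end Main

end

theorem theorem2p8 {κ : ℕ} (hκ : 2 ≤ κ)
    (E : ℕ → Type*) [∀ N, Countable (E N)] [∀ N, MeasurableSpace (E N)]
    [∀ N, DiscreteMeasurableSpace (E N)]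
    -- the Markov processes: irreducible, positive recurrent, reversible, without explosion
    (Q : ∀ N, RateMatrix (E N)) (hexp : ∀ N, (Q N).NoExplosion)
    (hirr : ∀ N, (Q N).Irreducible) (hrec : ∀ N, (Q N).PositiveRecurrent)
    (μ : ∀ N, Measure (E N)) [∀ N, IsProbabilityMeasure (μ N)]
    (hrev : ∀ N, (Q N).Reversible (μ N))
    -- the metastates, the metapoints and the time-scale
    (W : ∀ N, Fin κ → Set (E N)) (hW : ∀ N, Pairwise fun x y => Disjoint (W N x) (W N y))
    (ξ : ∀ N, Fin κ → E N) (hξ : ∀ N x, ξ N x ∈ W N x)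
    (θ : ℕ → ℝ≥0) (hθ : ∀ N, 0 < θ N)
    -- (H1)
    (H1 : ∀ x, Tendsto (fun N => (Q N).capacity (μ N) (W N x) (otherWells (W N) x) /
        (Q N).pointCapacity (μ N) (W N x) (ξ N x)) atTop (𝓝 0))
    -- (H0)
    (r : Fin κ → Fin κ → ℝ≥0)
    (H0 : ∀ x y, x ≠ y → Tendsto (fun N => (θ N : ℝ≥0∞) *
        (Q N).meanRate (μ N) (wells (W N)) (W N x) (W N y)) atTop (𝓝 (r x y)))
    -- (M3) at the absorbing states
    (M3 : ∀ x, (∀ y, y ≠ x → r x y = 0) → NegligibleCondition Q W θ x)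
    -- (H2) at the non-absorbing states
    (H2 : ∀ x, (∃ y, y ≠ x ∧ r x y ≠ 0) →
      Tendsto (fun N => μ N (annulus (W N)) / μ N (W N x)) atTop (𝓝 0)) :
    Tunneling Q W ξ θ (RateMatrix.ofRates r) := by
  have : Nontrivial (Fin κ) := Fin.nontrivial_iff_two_le.2 hκ
  -- Two metapoints are distinct, so there are at least two states; with irreducibility this
  -- excludes absorbing states and makes all exit rates positive.
  have (N : ℕ) : Nontrivial (E N) := by
    obtain ⟨x, y, hxy⟩ := exists_pair_ne (Fin κ)
    exact ⟨ξ N x, ξ N y, (hW N hxy).ne_of_mem (hξ N x) (hξ N y)⟩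
  have h : MetastableSetting Q μ W ξ θ r :=
    ⟨fun N => (hrec N).recurrentReversible (hexp N) (hirr N) (hrev N), hW, hξ, hθ, H1, H0⟩
  intro x
  refine ⟨attractorCondition_of_capacity h.chain (fun N => hξ N x) (H1 x),
    h.projectionCondition x, ?_⟩
  by_cases hx : ∃ y, y ≠ x ∧ r x y ≠ 0
  · obtain ⟨y, hyx, hr⟩ := hx
    exact h.negligibleCondition hyx hr (H2 x ⟨y, hyx, hr⟩)
  · push Not at hx
    exact M3 x hx
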